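/- Let $K$ be a perfect field, let $P=K[X_0,\dots,X_n]$ be standard graded, and let $I_{\mathbb X}\subseteq P$ be the saturated homogeneous vanishing ideal of a $0$-dimensional closed subscheme $\mathbb X$ of $\mathbb P^n$ over $K$. Let $R=P/I_{\mathbb X}$, a graded ring of Krull dimension one, let $x_0$ be the image of $X_0$ in $R$, and assume that $x_0$ is a non-zerodivisor of $R$. Let $S=R/\langle x_0-1\rangle$, and write $f\mapsto f^{\rm deh}$ for the canonical map $R\to S$. Let $Q^h(R)$ be the $\mathbb Z$-graded ring of fractions $a/b$ with $a,b\in R$ and $b$ a homogeneous non-zerodivisor, and let $\widetilde R$ be the subring of $Q^h(R)$ generated by all homogeneous elements of non-negative degree; then $R\subseteq\widetilde R$. For a $K$-algebra $A$ let $\Omega^m_{A/K}=\Lambda^m_A\Omega^1_{A/K}$. For $A=R$ and $A=\widetilde R$ the module $\Omega^m_{A/K}$ is graded by $\deg(a\,db_1\wedge\cdots\wedge db_m)=\deg a+\deg b_1+\cdots+\deg b_m$. For a graded module $M$ over $R$ or $\widetilde R$ with $\dim_K M_i<\infty$ for all $i$ and with $\dim_K M_i$ constant for $i\gg0$, let $\mathrm{HP}(M)$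 be this constant value, and let $\mathrm{ri}(M)=\min\{i\in\mathbb Z\mid \dim_K M_j=\mathrm{HP}(M)\text{ for all }j\ge i\}$ (with $\mathrm{ri}(0)=0$). Put $r_{\mathbb X}=\mathrm{ri}(R)$. (a) There is an isomorphism of $K$-algebras $\widetilde R\cong S[x_0]$ which sends a homogeneous element $y=a/b$ of degree $d\ge0$, with $a,b\in R$ homogeneous and $b$ a non-zerodivisor, to $y^{\rm deh}x_0^d$, where $y^{\rm deh}=a^{\rm deh}/b^{\rm deh}$. For every $m\ge1$ it induces an isomorphism of graded $K[x_0]$-modules $$\Psi^{(m)}:\ \Omega^m_{\widetilde R/K}\ \cong\ K[x_0]\otimes_K\Omega^m_{S/K}\ \oplus\ K[x_0]\,dx_0\wedge\Omega^{m-1}_{S/K},$$ namely the inverse of the map $(p\otimes\omega,\;q\,dx_0\wedge\eta)\mapsto p\,\omega+q\,dx_0\wedge\eta$, where $\omega,\eta$ are sent to $\Omega^{\bullet}_{\widetilde R/K}$ via the inclusion $S\subseteq S[x_0]\cong\widetilde R$. Furthermore, for every $m\ge1$ the homogeneous components of $\Omega^m_{R/K}$ and $\Omega^m_{\widetilde R/K}$,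 as well as $\Omega^m_{S/K}$ and $\Omega^{m-1}_{S/K}$, are finite-dimensional over $K$, and the following hold. (b) Let $\Phi:\Omega^1_{R/K}\to\Omega^1_{\widetilde R/K}$ be the canonical $R$-linear map induced by $R\subseteq\widetilde R$. For every $i\ge 2r_{\mathbb X}+m$, the $K$-linear map $(\Lambda^m\Phi)_i:(\Omega^m_{R/K})_i\to(\Omega^m_{\widetilde R/K})_i$ is an isomorphism. (c) The Hilbert functions of $\Omega^m_{R/K}$ and $\Omega^m_{\widetilde R/K}$ are eventually constant, and $$\mathrm{HP}(\Omega^m_{R/K})=\mathrm{HP}(\Omega^m_{\widetilde R/K})=\dim_K(\Omega^m_{S/K})+\dim_K(\Omega^{m-1}_{S/K}).$$ (d) We have $\mathrm{ri}(\Omega^m_{R/K})\le 2r_{\mathbb X}+m$; in particular $\dim_K(\Omega^m_{R/K})_i=\mathrm{HP}(\Omega^m_{R/K})$ for all $i\ge 2r_{\mathbb X}+m$. (e) Suppose that $n\ge1$ and that $\mathrm{char}(K)=0$, or $\mathrm{char}(K)=p>0$ and $p\nmid(2r_{\mathbb X}+n+1)$. Suppose also that we are not in the case where $n=2$, $\mathrm{char}(K)=2$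 and $r_{\mathbb X}$ is even. Then $\mathrm{ri}(\Omega^{n+1}_{R/K})\le 2r_{\mathbb X}+n$; in particular $\dim_K(\Omega^{n+1}_{R/K})_i=\mathrm{HP}(\Omega^{n+1}_{R/K})$ for all $i\ge 2r_{\mathbb X}+n$. -/

import Mathlib

open scoped TensorProduct Polynomial

noncomputable section

namespace KaehlerZeroDim

section Hilbert

/-- The value `c` with `h i = c` for all `i ≫ 0`, that is, the (constant) Hilbert polynomial
belonging to the Hilbert function `h`. It is meaningful when `h` is eventually constant. -/
def hilbertPoly (h : ℤ → ℕ) : ℕ :=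
  Classical.epsilon fun c : ℕ => ∀ᶠ i in Filter.atTop, h i = c

/-- The regularity index `min {i ∈ ℤ | h j = HP for all j ≥ i}` of a Hilbert function `h`
with values eventually equal to `HP` (for `h = 0`, where there is no minimum, it is `0`). -/
def regIndex (h : ℤ → ℕ) : ℤ :=
  sInf {i : ℤ | ∀ j, i ≤ j → h j = hilbertPoly h}

variable {K : Type*} [Field K] {M : Type*} [AddCommGroup M] [Module K M]

/-- The Hilbert function of a graded vector space with homogeneous components `𝒢 i`. -/
def hilbertFun (𝒢 : ℤ → Submodule K M) (i : ℤ) : ℕ :=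
  Module.finrank K (𝒢 i)

end Hilbert

section Forms

variable (K : Type*) [Field K]

/-- The module `Ω^m_{A/K} = Λ^m_A Ω^1_{A/K}` of Kähler differential `m`-forms. -/
abbrev Forms (A : Type*) [CommRing A] [Algebra K A] (m : ℕ) : Type _ :=
  ⋀[A]^m (Ω[A⁄K])

variable {K}

/-- The homogeneous component of degree `i` of `Ω^m_{A/K}` for a graded algebra `A = ⨁ 𝒜 e`:
it is spanned by the forms `a db₁ ∧ ⋯ ∧ db_m` with `a, b₁, …, b_m` homogeneous and
`deg a + deg b₁ + ⋯ + deg b_m = i`. -/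
def formsGrade {A : Type*} [CommRing A] [Algebra K A] (𝒜 : ℤ → Submodule K A) (m : ℕ) (i : ℤ) :
    Submodule K (Forms K A m) :=
  Submodule.span K {w | ∃ (e₀ : ℤ) (e : Fin m → ℤ) (a : A) (b : Fin m → A),
    a ∈ 𝒜 e₀ ∧ (∀ j, b j ∈ 𝒜 (e j)) ∧ e₀ + ∑ j, e j = i ∧
    w = a • exteriorPower.ιMulti A m (fun j => KaehlerDifferential.D K A (b j))}

/-- The map `Ω^m_{A/K} → Ω^m_{B/K}` induced by a homomorphism of `K`-algebras `φ : A → B`: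
the `m`-th exterior power of the canonical `A`-linear map `Ω^1_{A/K} → Ω^1_{B/K}`. -/
def formsMap {A B : Type*} [CommRing A] [Algebra K A] [CommRing B] [Algebra K B]
    (φ : A →ₐ[K] B) (m : ℕ) : Forms K A m →ₗ[K] Forms K B m :=
  letI : Algebra A B := φ.toRingHom.toAlgebra
  haveI : IsScalarTower K A B := IsScalarTower.of_algebraMap_eq' φ.comp_algebraMap.symm
  let wedge : (Ω[B⁄K]) [⋀^Fin m]→ₗ[A] (⋀[B]^m (Ω[B⁄K])) :=
    { (exteriorPower.ιMulti B m (M := Ω[B⁄K])).toMultilinearMap.restrictScalars A with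
      map_eq_zero_of_eq' := (exteriorPower.ιMulti B m (M := Ω[B⁄K])).map_eq_zero_of_eq' }
  (exteriorPower.alternatingMapLinearEquiv
    (wedge.compLinearMap (KaehlerDifferential.map K K A B))).restrictScalars K

/-- `a db₁ ∧ ⋯ ∧ db_m ↦ φ(a) dφ(b₁) ∧ ⋯ ∧ dφ(b_m)`. -/
theorem formsMap_apply {A B : Type*} [CommRing A] [Algebra K A] [CommRing B] [Algebra K B]
    (φ : A →ₐ[K] B) (m : ℕ) (a : A) (b : Fin m → A) :
    formsMap φ m (a • exteriorPower.ιMulti A m (fun j => KaehlerDifferential.D K A (b j))) =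
      φ a • exteriorPower.ιMulti B m (fun j => KaehlerDifferential.D K B (φ (b j))) := by
  let _ : Algebra A B := φ.toRingHom.toAlgebra
  have _ : IsScalarTower K A B := IsScalarTower.of_algebraMap_eq' φ.comp_algebraMap.symm
  have h : ∀ x : A, algebraMap A B x = φ x := fun _ => rfl
  simp only [formsMap]
  rw [LinearMap.restrictScalars_apply, map_smul,
    exteriorPower.alternatingMapLinearEquiv_apply_ιMulti, ← h, algebraMap_smul]
  congr 1
  simp only [AlternatingMap.compLinearMap_apply, KaehlerDifferential.map_D, h]
  rfl

end Forms

section Tensor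

variable (K : Type*) [Field K] (V : Type*) [AddCommGroup V] [Module K V]

/-- The subspace `x_0^i ⊗ V` of `K[x_0] ⊗ V` (zero if `i < 0`). -/
def monomialTensor (i : ℤ) : Submodule K (K[X] ⊗[K] V) :=
  Submodule.span K {t | ∃ (a : ℕ) (v : V), (a : ℤ) = i ∧ t = (Polynomial.X ^ a : K[X]) ⊗ₜ[K] v}

end Tensor

section Splitting

variable {K : Type*} [Field K] {S B : Type*} [CommRing S] [Algebra K S] [CommRing B] [Algebra K B]

/-- Let `t ∈ B` and let `σ : S → B` be a homomorphism of `K`-algebras, for instance the inclusion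
of `S` into `B = S[t]`. This says that the isomorphism
`Ψ : Ω^m_{B/K} ≅ K[x] ⊗ Ω^m_{S/K} ⊕ K[x] ⊗ Ω^{m-1}_{S/K}` is the canonical one, i.e. that its
inverse sends `(p ⊗ ω, q ⊗ η)` to `p(t) ω + q(t) dt ∧ η`. -/
def IsCanonicalSplitting (σ : S →ₐ[K] B) (t : B) (m : ℕ)
    (Ψ : Forms K B m ≃ₗ[K] (K[X] ⊗[K] Forms K S m) × (K[X] ⊗[K] Forms K S (m - 1))) : Prop :=
  ∀ (p q : K[X]) (ω : Forms K S m) (η : Forms K S (m - 1)),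
    (Ψ.symm (p ⊗ₜ[K] ω, q ⊗ₜ[K] η) : ExteriorAlgebra B (Ω[B⁄K])) =
      Polynomial.aeval t p • (formsMap σ m ω : ExteriorAlgebra B (Ω[B⁄K])) +
      Polynomial.aeval t q • (ExteriorAlgebra.ι B (KaehlerDifferential.D K B t) *
        (formsMap σ (m - 1) η : ExteriorAlgebra B (Ω[B⁄K])))

/-- `Ψ` is `K[x]`-linear, where `x` acts on `Ω^m_{B/K}` as multiplication by `t`. -/
def IsPolyLinear (t : B) (m : ℕ)
    (Ψ : Forms K B m ≃ₗ[K] (K[X] ⊗[K] Forms K S m) × (K[X] ⊗[K] Forms K S (m - 1))) : Prop :=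
  ∀ (p : K[X]) (w : Forms K B m), Ψ (Polynomial.aeval t p • w) = p • Ψ w

/-- For a grading `ℬ` of `B`, the map `Ψ` sends the homogeneous component of degree `i` onto
`x^i ⊗ Ω^m_{S/K} ⊕ x^{i-1} ⊗ Ω^{m-1}_{S/K}`. -/
def IsGradedSplitting (ℬ : ℤ → Submodule K B) (m : ℕ)
    (Ψ : Forms K B m ≃ₗ[K] (K[X] ⊗[K] Forms K S m) × (K[X] ⊗[K] Forms K S (m - 1))) : Prop :=
  ∀ i : ℤ, (formsGrade ℬ m i).map Ψ.toLinearMap =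
    (monomialTensor K (Forms K S m) i).prod (monomialTensor K (Forms K S (m - 1)) (i - 1))

end Splitting

section Scheme

variable {K : Type*} [Field K] {n : ℕ}

/-- `I` is the homogeneous vanishing ideal `I_X ⊆ K[X_0, …, X_n]` of a zero-dimensional closed
subscheme `X` of projective `n`-space: a homogeneous, saturated ideal whose residue class ring is
one-dimensional. -/
structure IsVanishingIdeal (I : Ideal (MvPolynomial (Fin (n + 1)) K)) : Prop where
  homogeneous : ∀ f ∈ I, ∀ d : ℕ, MvPolynomial.homogeneousComponent d f ∈ I
  saturated : ∀ f, (∀ i, ∃ k : ℕ, MvPolynomial.X i ^ k * f ∈ I) → f ∈ I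
  dim_eq_one : ringKrullDim (MvPolynomial (Fin (n + 1)) K ⧸ I) = 1

variable (I : Ideal (MvPolynomial (Fin (n + 1)) K))

/-- The homogeneous coordinate ring `R = K[X_0, …, X_n] / I`. -/
abbrev CoordRing : Type _ := MvPolynomial (Fin (n + 1)) K ⧸ I

/-- The residue class `x_0` of `X_0` in `R`. -/
def x0 : CoordRing I := Ideal.Quotient.mk I (MvPolynomial.X 0)

/-- The homogeneous component `R_d`, for `d ∈ ℤ`. -/
def coordGrade (d : ℤ) : Submodule K (CoordRing I) :=
  if 0 ≤ d then
    (MvPolynomial.homogeneousSubmodule (Fin (n + 1)) K d.toNat).map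
      (Ideal.Quotient.mkₐ K I).toLinearMap
  else ⊥

/-- The affine coordinate ring `S = R / ⟨x_0 - 1⟩`. -/
abbrev AffineRing : Type _ := CoordRing I ⧸ Ideal.span {x0 I - 1}

/-- Dehomogenization `R → S`. -/
def deh : CoordRing I →ₐ[K] AffineRing I := Ideal.Quotient.mkₐ K (Ideal.span {x0 I - 1})

theorem one_mem_coordGrade : (1 : CoordRing I) ∈ coordGrade I 0 := by
  simp only [coordGrade, le_refl, if_true]
  exact ⟨1, MvPolynomial.isHomogeneous_one _ _, map_one (Ideal.Quotient.mkₐ K I)⟩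

theorem mul_mem_coordGrade {d e : ℤ} {a b : CoordRing I} (ha : a ∈ coordGrade I d)
    (hb : b ∈ coordGrade I e) : a * b ∈ coordGrade I (d + e) := by
  unfold coordGrade at ha hb ⊢
  split_ifs at ha hb with h1 h2 h2
  · rw [if_pos (add_nonneg h1 h2)]
    obtain ⟨p, hp, rfl⟩ := ha
    obtain ⟨q, hq, rfl⟩ := hb
    refine ⟨p * q, ?_, map_mul (Ideal.Quotient.mkₐ K I) p q⟩
    rw [Int.toNat_add h1 h2]
    exact MvPolynomial.IsHomogeneous.mul hp hq
  · rw [(Submodule.mem_bot K).1 hb, mul_zero]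
    exact Submodule.zero_mem _
  · rw [(Submodule.mem_bot K).1 ha, zero_mul]
    exact Submodule.zero_mem _
  · rw [(Submodule.mem_bot K).1 ha, zero_mul]
    exact Submodule.zero_mem _

/-- The multiplicative set of homogeneous non-zerodivisors of `R`. -/
def homogNZD : Submonoid (CoordRing I) where
  carrier := {b | b ∈ nonZeroDivisors (CoordRing I) ∧ ∃ d : ℤ, b ∈ coordGrade I d}
  one_mem' := ⟨one_mem _, 0, one_mem_coordGrade I⟩
  mul_mem' := by
    rintro a b ⟨ha, d, had⟩ ⟨hb, e, hbe⟩
    exact ⟨mul_mem ha hb, d + e, mul_mem_coordGrade I had hbe⟩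

/-- The homogeneous ring of quotients `Q^h(R)`. -/
abbrev HomogQuot : Type _ := Localization (homogNZD I)

/-- The homogeneous component of degree `d` of `Q^h(R)`: fractions `a / b` with `a` and `b`
homogeneous, `b` a non-zerodivisor and `deg a - deg b = d`. -/
def quotGrade (d : ℤ) : Submodule K (HomogQuot I) :=
  Submodule.span K {y | ∃ (e f : ℤ) (a : CoordRing I) (b : homogNZD I),
    a ∈ coordGrade I e ∧ (b : CoordRing I) ∈ coordGrade I f ∧ e - f = d ∧
    y = Localization.mk a b}

/-- The subring of `Q^h(R)` generated by all homogeneous elements of non-negative degree. -/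
def truncSubring : Subring (HomogQuot I) :=
  Subring.closure {y | ∃ d : ℤ, 0 ≤ d ∧ y ∈ quotGrade I d}

theorem algebraMap_mem_truncSubring (r : CoordRing I) :
    algebraMap (CoordRing I) (HomogQuot I) r ∈ truncSubring I := by
  obtain ⟨p, rfl⟩ := Ideal.Quotient.mk_surjective r
  rw [← MvPolynomial.sum_homogeneousComponent p, map_sum, map_sum]
  refine sum_mem fun i _ => Subring.subset_closure ⟨(i : ℤ), Int.natCast_nonneg i, ?_⟩
  refine Submodule.subset_span ⟨(i : ℤ), 0, _, 1, ?_, one_mem_coordGrade I, sub_zero _,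
    (Localization.mk_one_eq_algebraMap _).symm⟩
  rw [coordGrade, if_pos (Int.natCast_nonneg i), Int.toNat_natCast]
  exact ⟨_, MvPolynomial.homogeneousComponent_isHomogeneous i p, rfl⟩

/-- The truncated integral closure `R̃` of `R`: the subring of `Q^h(R)` generated by all homogeneous
elements of non-negative degree. It contains `R` and is viewed as an `R`-algebra. -/
def truncClosure : Subalgebra (CoordRing I) (HomogQuot I) :=
  { truncSubring I with algebraMap_mem' := algebraMap_mem_truncSubring I }

/-- The homogeneous component `R̃_d`, for `d ∈ ℤ`. -/
def truncGrade (d : ℤ) : Submodule K (truncClosure I) :=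
  (quotGrade I d).comap ((truncClosure I).val.restrictScalars K).toLinearMap

/-- The inclusion of `R` into `R̃`. -/
def incl : CoordRing I →ₐ[K] truncClosure I :=
  IsScalarTower.toAlgHom K (CoordRing I) (truncClosure I)

/-- The regularity index `r_X` of the scheme, i.e. that of the Hilbert function of `R`. -/
def schemeRegIndex : ℤ := regIndex (hilbertFun (coordGrade I))

/-- The Hilbert function of `Ω^m_{R/K}`. -/
def formsHF (m : ℕ) : ℤ → ℕ := hilbertFun (formsGrade (coordGrade I) m)

/-- The Hilbert function of `Ω^m_{R̃/K}`. -/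
def truncFormsHF (m : ℕ) : ℤ → ℕ := hilbertFun (formsGrade (A := truncClosure I) (truncGrade I) m)

variable {I}

/-- The inclusion of `S` into `R̃` belonging to an identification `R̃ ≅ S[x_0]`. -/
def affineIncl (θ : truncClosure I ≃ₐ[K] (AffineRing I)[X]) : AffineRing I →ₐ[K] truncClosure I :=
  θ.symm.toAlgHom.comp Polynomial.CAlgHom

/-- The isomorphism `θ : R̃ ≅ S[x_0]` is the one given by `y ↦ y^deh x_0^d` for homogeneous `y` of
degree `d ≥ 0`: if `y = a / b` with `a, b ∈ R` homogeneous, then `y^deh = a^deh / b^deh`. -/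
def IsDehomogenization (θ : truncClosure I ≃ₐ[K] (AffineRing I)[X]) : Prop :=
  ∀ (y : truncClosure I) (d : ℕ) (e f : ℤ) (a b : CoordRing I),
    a ∈ coordGrade I e → b ∈ coordGrade I f → b ∈ nonZeroDivisors (CoordRing I) →
    e - f = (d : ℤ) → y * incl I b = incl I a →
    θ y * Polynomial.C (deh I b) = Polynomial.monomial d (deh I a)

end Scheme

end KaehlerZeroDim

end

open KaehlerZeroDim

/-!
Let `S` be the affine coordinate ring and `X` a variable. Since `x_0` is a non-zerodivisor,
dehomogenization embeds each `R_d` into `S`, and the maps `a ↦ a^deh X^d` embed the graded ring `R`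
into `S[X]`. As `S` is a finite-dimensional algebra, the dehomogenization of a homogeneous
non-zerodivisor is a unit. Hence the homogeneous fractions of degree `d ≥ 0` are exactly the
monomials `s X^d`, and the truncated integral closure is `S[X]`
(`DehomSetup.exists_closure_equiv`). If `r` is the regularity index of `R`, then
`R_d → S` is bijective for `d ≥ r`; this is the only way in which `r` enters. The structure
`DehomSetup` collects what is needed of `R` and `S`.

*Forms on `S[X]`.* The forms `p ω` and `q dX ∧ η`, with `ω` and `η` forms on `S`, span all forms.
They are independent because contraction with the vector field `d/dX` recovers `q η`, and the
homomorphism that sends `dX` to zero and is the identity on forms on `S` recovers `p ω`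
(`splitMap_injective`, `exists_polynomial_splitting`). In degrees `i ≥ 1` the space of `m`-forms
has dimension `dim Ω^m_S + dim Ω^{m-1}_S`. It remains to compare forms on `R` and on `S[X]`.

*Surjectivity in degrees `i ≥ r + m`.* Since `X dx_l^deh = dx_l - x_l^deh dX`, multiplication by
`X^m` turns an `m`-form on `S` into a combination of the forms `dx_{J_1} ∧ ⋯ ∧ dx_{J_m}` with
coefficients in `S`. A further factor `X^k` with `k ≥ r` moves these coefficients into `R`
(`DehomSetup.exists_formsMap_toPoly_eq`).

*Injectivity in degrees `i ≥ 2r + m`.* The relations of `R` are generated in degrees `≤ r + 1`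
(`DehomSetup.mem_span_of_π_eq_zero`). The derivation `R → S^{n+1} / ⟨grad g⟩`, where `g` runs
through these relations, extends to `S[X]`, because `X^r S[X]` is contained in `R`
(`DehomSetup.exists_lift_of_derivation`). So if the form `w = ∑ f_J dx_J` with `f_J` of degree
`k = i - m` vanishes on `S[X]`, then `∑ f_J^deh e_J` lies in the ideal of `S ⊗ Λ(K^{n+1})` generated
by the gradients. Let `h : S → R_k` be the inverse of dehomogenization. The map
`s ⊗ e_J ↦ h(s) dx_J` sends `∑ f_J^deh e_J` to `w`, so it is enough that it kills the ideal
(`DehomSetup.eq_zero_of_extMap_toPoly_eq_zero`). For `k ≥ 2r` it does: the partial derivatives of a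
relation of degree `d ≤ r + 1` have degree `d - 1`, so the coefficient in `S` by which its gradient
is multiplied lifts to `R` in degree `k - (d - 1) ≥ r`, and the image is a multiple of `dg = 0`
(`DehomSetup.eq_zero_of_mem_xSpan`).

*Top forms in degree `2r + n`.* Now `m = n + 1` and `k = 2r - 1`, which is too small by one for the
relations of degree `r + 1`. It has to be shown that `h((∂_j g)^deh) dx_0 ∧ ⋯ ∧ dx_n = 0` for every
relation `g` of degree `2r + 1`; for relations of degree at most `2r` this holds since `∂_j g`
annihilates the top form. By Euler's formula one may assume `j ≠ 0`. Modulo multiples of `X_0` by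
relations of degree `2r`, a relation of degree `2r + 1` is a combination of relations `X^γ - X_0 f`,
so the expression is determined by elements `c j γ` which depend only on the monomial `X^γ`. They
vanish if `X_0` divides `X^γ`, they satisfy Euler's formula, and the symmetry of the product
`∂_i g ∂_j g'` for two relations `g` and `g'` of degree `r + 1` yields
`α_i c_j(α + β - ε_i) = β_j c_i(α + β - ε_j)`. That these equations have only the zero solution,
except for `n = 2`, characteristic two and even `r`, is the combinatorial statement
`eq_zero_of_relations`.
-/

open scoped TensorProduct Polynomial

noncomputable section

namespace KaehlerZeroDim

/-! ### The algebra of Kähler differential forms -/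

section FormsAlgebra

variable (K : Type*) [Field K]

/-- The algebra `⨁ Ω^m_{A/K}` of Kähler differential forms, with the wedge product. -/
abbrev FormsAlg (A : Type*) [CommRing A] [Algebra K A] : Type _ :=
  ExteriorAlgebra A (Ω[A⁄K])

variable {K} {A B : Type*} [CommRing A] [Algebra K A] [CommRing B] [Algebra K B]

/-- The differential `db`, as an element of the algebra of forms. -/
def dForm (b : A) : FormsAlg K A := ExteriorAlgebra.ι A (KaehlerDifferential.D K A b)

/-- The form `db₁ ∧ ⋯ ∧ db_m`. -/
def dProd {m : ℕ} (b : Fin m → A) : FormsAlg K A :=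
  ExteriorAlgebra.ιMulti A m (fun j => KaehlerDifferential.D K A (b j))

theorem dProd_zero (b : Fin 0 → A) : (dProd b : FormsAlg K A) = 1 :=
  ExteriorAlgebra.ιMulti_zero_apply _

theorem dProd_succ {m : ℕ} (b : Fin (m + 1) → A) :
    (dProd b : FormsAlg K A) = dForm (b 0) * dProd (fun j => b j.succ) :=
  ExteriorAlgebra.ιMulti_succ_apply _

theorem dForm_mul (a b : A) :
    (dForm (a * b) : FormsAlg K A) = a • dForm b + b • dForm a := by
  simp [dForm, Derivation.leibniz]

/-- Universal property of the algebra of forms: a homomorphism `φ : A → Q` with central image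
together with a `φ`-derivation `D : A → Q` whose values square to zero extends to it. -/
theorem exists_formsLift {Q : Type*} [Ring Q] [Algebra K Q] (φ : A →ₐ[K] Q) (D : A →ₗ[K] Q)
    (hc : ∀ a q, φ a * q = q * φ a) (hD : ∀ a b, D (a * b) = φ a * D b + φ b * D a)
    (h0 : ∀ a, D a * D a = 0) :
    ∃ L : FormsAlg K A →ₐ[K] Q, (∀ a, L (algebraMap _ _ a) = φ a) ∧ ∀ a, L (dForm a) = D a := by
  let _ : Algebra A Q := φ.toRingHom.toAlgebra' hc
  have hsm : ∀ (a : A) (q : Q), a • q = φ a * q := fun a q => Algebra.smul_def a q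
  have _ : IsScalarTower K A Q := IsScalarTower.of_algebraMap_eq' φ.comp_algebraMap.symm
  let d : Derivation K A Q := Derivation.mk' D fun a b => by rw [hD, hsm, hsm]
  let f : Ω[A⁄K] →ₗ[A] Q := d.liftKaehlerDifferential
  have hf : ∀ a, f (KaehlerDifferential.D K A a) = D a := fun a =>
    d.liftKaehlerDifferential_comp_D a
  have h1 : ∀ a b, D a * D b + D b * D a = 0 := fun a b => by
    have := h0 (a + b)
    rw [map_add, add_mul, mul_add, mul_add, h0, h0, zero_add, add_zero] at this
    exact this
  have h2 : ∀ v w, f v * f w + f w * f v = 0 := by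
    intro v w
    have hv : v ∈ Submodule.span A (Set.range (KaehlerDifferential.D K A)) := by
      rw [KaehlerDifferential.span_range_derivation]; trivial
    have hw : w ∈ Submodule.span A (Set.range (KaehlerDifferential.D K A)) := by
      rw [KaehlerDifferential.span_range_derivation]; trivial
    induction hv using Submodule.span_induction with
    | mem x hx =>
      obtain ⟨a, rfl⟩ := hx
      induction hw using Submodule.span_induction with
      | mem x hx => obtain ⟨b, rfl⟩ := hx; rw [hf, hf, h1]
      | zero => simp
      | add x y _ _ hx hy =>
        rw [map_add, mul_add, add_mul, add_add_add_comm, hx, hy, add_zero]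
      | smul a x _ hx => rw [map_smul, mul_smul_comm, smul_mul_assoc, ← smul_add, hx, smul_zero]
    | zero => simp
    | add x y _ _ hx hy => rw [map_add, mul_add, add_mul, add_add_add_comm, hx, hy, add_zero]
    | smul a x _ hx => rw [map_smul, mul_smul_comm, smul_mul_assoc, ← smul_add, hx, smul_zero]
  have h3 : ∀ v, f v * f v = 0 := by
    intro v
    have hv : v ∈ Submodule.span A (Set.range (KaehlerDifferential.D K A)) := by
      rw [KaehlerDifferential.span_range_derivation]; trivial
    induction hv using Submodule.span_induction with
    | mem x hx => obtain ⟨a, rfl⟩ := hx; rw [hf, h0]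
    | zero => simp
    | add x y _ _ hx hy =>
      rw [map_add, mul_add, add_mul, add_mul, hx, hy, zero_add, add_zero, add_comm, h2]
    | smul a x _ hx =>
      rw [map_smul, mul_smul_comm, smul_mul_assoc, hx, smul_zero, smul_zero]
  refine ⟨(ExteriorAlgebra.lift A ⟨f, h3⟩).restrictScalars K, fun a => ?_, fun a => ?_⟩
  · exact (ExteriorAlgebra.lift A ⟨f, h3⟩).commutes a
  · exact (ExteriorAlgebra.lift_ι_apply A f h3 _).trans (hf a)

/-- Two homomorphisms on the algebra of forms agree if they agree on functions and on exact
one-forms. -/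
theorem formsAlg_hom_ext {Q : Type*} [Ring Q] [Algebra K Q] {L L' : FormsAlg K A →ₐ[K] Q}
    (h : ∀ a : A, L (algebraMap _ _ a) = L' (algebraMap _ _ a))
    (h' : ∀ a : A, L (dForm a) = L' (dForm a)) : L = L' := by
  ext w
  induction w using ExteriorAlgebra.induction with
  | algebraMap a => exact h a
  | ι v =>
    have hv : v ∈ Submodule.span A (Set.range (KaehlerDifferential.D K A)) := by
      rw [KaehlerDifferential.span_range_derivation]; trivial
    induction hv using Submodule.span_induction with
    | mem x hx => obtain ⟨a, rfl⟩ := hx; exact h' a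
    | zero => simp
    | add x y _ _ hx hy => rw [map_add, map_add, map_add, hx, hy]
    | smul a x _ hx => rw [map_smul, Algebra.smul_def, map_mul, map_mul, h, hx]
  | mul x y hx hy => rw [map_mul, map_mul, hx, hy]
  | add x y hx hy => rw [map_add, map_add, hx, hy]

/-- The value of an algebra homomorphism on `a db₁ ∧ ⋯ ∧ db_m`, given its values on functions and
exact one-forms. -/
theorem map_smul_dProd {Q : Type*} [Ring Q] [Algebra K Q] (L : FormsAlg K A →ₐ[K] Q) {m : ℕ}
    (a : A) (b : Fin m → A) :
    L (a • dProd b) = L (algebraMap _ _ a) * (List.ofFn fun j => L (dForm (b j))).prod := by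
  rw [Algebra.smul_def, map_mul, dProd, ExteriorAlgebra.ιMulti_apply, map_list_prod, List.map_ofFn]
  rfl

theorem dProd_eq_prod {m : ℕ} (b : Fin m → A) :
    (dProd b : FormsAlg K A) = (List.ofFn fun j => dForm (b j)).prod :=
  ExteriorAlgebra.ιMulti_apply _

theorem exists_extMap (φ : A →ₐ[K] B) :
    ∃ L : FormsAlg K A →ₐ[K] FormsAlg K B,
      (∀ a, L (algebraMap _ _ a) = algebraMap _ _ (φ a)) ∧ ∀ a, L (dForm a) = dForm (φ a) := by
  refine exists_formsLift (((Algebra.ofId B (FormsAlg K B)).restrictScalars K).comp φ)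
    ((ExteriorAlgebra.ι B).restrictScalars K ∘ₗ
      (KaehlerDifferential.D K B).toLinearMap ∘ₗ φ.toLinearMap) ?_ ?_ ?_
  · exact fun a q => Algebra.commutes (φ a) q
  · intro a b
    change dForm (φ (a * b)) =
      algebraMap _ _ (φ a) * dForm (φ b) + algebraMap _ _ (φ b) * dForm (φ a)
    rw [map_mul, dForm_mul, Algebra.smul_def, Algebra.smul_def]
  · exact fun a => ExteriorAlgebra.ι_sq_zero _

/-- The homomorphism between algebras of forms induced by `φ : A → B`. -/
def extMap (φ : A →ₐ[K] B) : FormsAlg K A →ₐ[K] FormsAlg K B := (exists_extMap φ).choose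

@[simp] theorem extMap_algebraMap (φ : A →ₐ[K] B) (a : A) :
    extMap φ (algebraMap _ _ a) = algebraMap _ _ (φ a) := (exists_extMap φ).choose_spec.1 a

@[simp] theorem extMap_dForm (φ : A →ₐ[K] B) (a : A) :
    extMap φ (dForm a) = dForm (φ a) := (exists_extMap φ).choose_spec.2 a

theorem extMap_smul (φ : A →ₐ[K] B) (a : A) (w : FormsAlg K A) :
    extMap φ (a • w) = φ a • extMap φ w := by
  rw [Algebra.smul_def, map_mul, extMap_algebraMap, Algebra.smul_def]

theorem extMap_dProd (φ : A →ₐ[K] B) {m : ℕ} (b : Fin m → A) :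
    extMap φ (dProd b) = dProd (fun j => φ (b j)) := by
  rw [dProd_eq_prod, dProd_eq_prod, map_list_prod, List.map_ofFn]
  simp [Function.comp_def]

/-- The space of `m`-forms, as a `K`-subspace of the algebra of forms. -/
def formsIncl (K A : Type*) [Field K] [CommRing A] [Algebra K A] (m : ℕ) :
    Forms K A m →ₗ[K] FormsAlg K A :=
  (⋀[A]^m (Ω[A⁄K])).subtype.restrictScalars K

theorem formsIncl_injective (m : ℕ) : Function.Injective (formsIncl K A m) :=
  Subtype.val_injective

theorem formsIncl_smul {m : ℕ} (a : A) (w : Forms K A m) :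
    formsIncl K A m (a • w) = a • formsIncl K A m w := rfl

theorem formsIncl_ιMulti {m : ℕ} (a : A) (b : Fin m → A) :
    formsIncl K A m (a • exteriorPower.ιMulti A m (fun j => KaehlerDifferential.D K A (b j))) =
      a • dProd b := rfl

/-- If the elements `x i` generate the algebra `A`, their differentials generate `Ω^1_{A/K}`. -/
theorem span_D_of_adjoin {ι : Type*} {x : ι → A} (hx : Algebra.adjoin K (Set.range x) = ⊤) :
    Submodule.span A (Set.range fun i => KaehlerDifferential.D K A (x i)) = ⊤ := by
  rw [eq_top_iff, ← KaehlerDifferential.span_range_derivation, Submodule.span_le]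
  rintro _ ⟨a, rfl⟩
  have ha : a ∈ Algebra.adjoin K (Set.range x) := by rw [hx]; trivial
  induction ha using Algebra.adjoin_induction with
  | mem y hy => obtain ⟨i, rfl⟩ := hy; exact Submodule.subset_span ⟨i, rfl⟩
  | algebraMap r => simp
  | add a b _ _ ha hb => rw [map_add]; exact add_mem ha hb
  | mul a b _ _ ha hb =>
    rw [Derivation.leibniz]
    exact add_mem (Submodule.smul_mem _ _ hb) (Submodule.smul_mem _ _ ha)

/-- If the elements `x i` generate the algebra `A`, then the `m`-forms are spanned over `K` by the
forms `a dx_{j_1} ∧ ⋯ ∧ dx_{j_m}`. -/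
theorem forms_span_of_adjoin {ι : Type*} {x : ι → A}
    (hx : Algebra.adjoin K (Set.range x) = ⊤) (m : ℕ) :
    Submodule.span K {w : Forms K A m | ∃ (a : A) (J : Fin m → ι),
      w = a • exteriorPower.ιMulti A m (fun j => KaehlerDifferential.D K A (x (J j)))} = ⊤ := by
  rw [eq_top_iff]
  rintro w -
  have hw : w ∈ Submodule.span A (exteriorPower.ιMulti A m '' {a | Set.range a ⊆
      Set.range fun i => KaehlerDifferential.D K A (x i)}) := by
    rw [exteriorPower.ιMulti_span_of_span _ _ _ (span_D_of_adjoin hx)]; trivial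
  induction hw using Submodule.span_induction with
  | mem y hy =>
    obtain ⟨v, hv, rfl⟩ := hy
    have : ∀ j, ∃ i, KaehlerDifferential.D K A (x i) = v j := fun j => hv ⟨j, rfl⟩
    choose J hJ using this
    refine Submodule.subset_span ⟨1, J, ?_⟩
    simp only [hJ, one_smul]
  | zero => exact zero_mem _
  | add a b _ _ ha hb => exact add_mem ha hb
  | smul c y hy' hy =>
    clear hy'
    induction hy using Submodule.span_induction with
    | mem y hy =>
      obtain ⟨a, J, rfl⟩ := hy
      exact Submodule.subset_span ⟨c * a, J, by rw [mul_smul]⟩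
    | zero => rw [smul_zero]; exact zero_mem _
    | add a b _ _ ha hb => rw [smul_add]; exact add_mem ha hb
    | smul k y _ hy => rw [smul_comm]; exact Submodule.smul_mem _ _ hy

theorem forms_span (m : ℕ) :
    Submodule.span K {w : Forms K A m | ∃ (a : A) (b : Fin m → A),
      w = a • exteriorPower.ιMulti A m (fun j => KaehlerDifferential.D K A (b j))} = ⊤ := by
  have h := forms_span_of_adjoin (K := K) (A := A) (x := id) (by simp) m
  simpa using h

theorem mem_forms_span {m : ℕ} (w : Forms K A m) :
    w ∈ Submodule.span K {w : Forms K A m | ∃ (a : A) (b : Fin m → A),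
      w = a • exteriorPower.ιMulti A m (fun j => KaehlerDifferential.D K A (b j))} := by
  rw [forms_span]; trivial

/-- `Λ^mφ_*` is the restriction of the homomorphism of algebras of forms. -/
theorem formsIncl_formsMap (φ : A →ₐ[K] B) (m : ℕ) (w : Forms K A m) :
    formsIncl K B m (formsMap φ m w) = extMap φ (formsIncl K A m w) := by
  have : formsIncl K B m ∘ₗ formsMap φ m = (extMap φ).toLinearMap ∘ₗ formsIncl K A m := by
    refine LinearMap.ext_on (forms_span m) ?_
    rintro _ ⟨a, b, rfl⟩
    simp only [LinearMap.comp_apply]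
    rw [formsMap_apply, formsIncl_ιMulti, formsIncl_ιMulti, AlgHom.toLinearMap_apply, extMap_smul,
      extMap_dProd]
  exact LinearMap.congr_fun this w

theorem formsMap_comp {C : Type*} [CommRing C] [Algebra K C] (ψ : B →ₐ[K] C) (φ : A →ₐ[K] B)
    (m : ℕ) : formsMap (ψ.comp φ) m = formsMap ψ m ∘ₗ formsMap φ m := by
  refine LinearMap.ext_on (forms_span m) ?_
  rintro _ ⟨a, b, rfl⟩
  simp only [LinearMap.comp_apply, formsMap_apply, AlgHom.comp_apply]

theorem formsMap_id (m : ℕ) : formsMap (AlgHom.id K A) m = LinearMap.id := by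
  refine LinearMap.ext_on (forms_span m) ?_
  rintro _ ⟨a, b, rfl⟩
  simp only [formsMap_apply, AlgHom.id_apply, LinearMap.id_apply]

/-- The isomorphism between spaces of forms induced by an isomorphism of algebras. -/
def formsEquiv (θ : A ≃ₐ[K] B) (m : ℕ) : Forms K A m ≃ₗ[K] Forms K B m :=
  LinearEquiv.ofLinearMap (formsMap θ.toAlgHom m) (formsMap θ.symm.toAlgHom m)
    (by rw [← formsMap_comp, ← formsMap_id]; congr 1; ext; simp)
    (by rw [← formsMap_comp, ← formsMap_id]; congr 1; ext; simp)

theorem formsMap_smul (φ : A →ₐ[K] B) (m : ℕ) (a : A) (w : Forms K A m) :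
    formsMap φ m (a • w) = φ a • formsMap φ m w := by
  apply formsIncl_injective
  rw [formsIncl_smul, formsIncl_formsMap, formsIncl_formsMap, formsIncl_smul, extMap_smul]

/-- A graded homomorphism maps forms of degree `i` to forms of degree `i`. -/
theorem formsMap_mem_formsGrade (φ : A →ₐ[K] B) {𝒜 : ℤ → Submodule K A} {ℬ : ℤ → Submodule K B}
    (h : ∀ d, ∀ a ∈ 𝒜 d, φ a ∈ ℬ d) (m : ℕ) (i : ℤ) :
    formsGrade 𝒜 m i ≤ (formsGrade ℬ m i).comap (formsMap φ m) := by
  refine Submodule.span_le.2 ?_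
  rintro _ ⟨e₀, e, a, b, ha, hb, he, rfl⟩
  refine Submodule.subset_span ⟨e₀, e, φ a, fun j => φ (b j), h _ _ ha, fun j => h _ _ (hb j), he,
    formsMap_apply φ m a b⟩

theorem map_formsEquiv_formsGrade (θ : A ≃ₐ[K] B) {𝒜 : ℤ → Submodule K A}
    {ℬ : ℤ → Submodule K B} (h : ∀ d a, a ∈ 𝒜 d ↔ θ a ∈ ℬ d) (m : ℕ) (i : ℤ) :
    (formsGrade 𝒜 m i).map (formsEquiv θ m).toLinearMap = formsGrade ℬ m i := by
  apply le_antisymm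
  · exact Submodule.map_le_iff_le_comap.2
      (formsMap_mem_formsGrade θ.toAlgHom (fun d a => (h d a).1) m i)
  · intro w hw
    refine ⟨(formsEquiv θ m).symm w, ?_, (formsEquiv θ m).apply_symm_apply w⟩
    refine formsMap_mem_formsGrade θ.symm.toAlgHom (fun d b hb => ?_) m i hw
    rw [h]
    simpa using hb

end FormsAlgebra

/-! ### Differential forms on a polynomial ring -/

section PolynomialForms

variable {K : Type*} [Field K] {S : Type*} [CommRing S] [Algebra K S]

/-- The homogeneous component `S X^d` of `S[X]`, zero for `d < 0`. -/
def polyGrade (K S : Type*) [Field K] [CommRing S] [Algebra K S] (d : ℤ) : Submodule K S[X] where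
  carrier := {f | ∀ k : ℕ, (k : ℤ) ≠ d → f.coeff k = 0}
  add_mem' := fun hf hg k hk => by rw [Polynomial.coeff_add, hf k hk, hg k hk, add_zero]
  zero_mem' := fun k _ => Polynomial.coeff_zero k
  smul_mem' := fun c f hf k hk => by rw [Polynomial.coeff_smul, hf k hk, smul_zero]

theorem monomial_mem_polyGrade (a : ℕ) (s : S) : Polynomial.monomial a s ∈ polyGrade K S a :=
  fun k hk => by rw [Polynomial.coeff_monomial, if_neg]; rintro rfl; exact hk rfl

theorem exists_of_mem_polyGrade {d : ℤ} {f : S[X]} (hf : f ∈ polyGrade K S d) :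
    f = 0 ∨ ∃ (a : ℕ) (s : S), (a : ℤ) = d ∧ f = Polynomial.monomial a s := by
  by_cases hd : 0 ≤ d
  · refine Or.inr ⟨d.toNat, f.coeff d.toNat, Int.toNat_of_nonneg hd, ?_⟩
    ext k
    rw [Polynomial.coeff_monomial]
    split_ifs with h
    · rw [h]
    · exact hf k (by omega)
  · exact Or.inl (Polynomial.ext fun k => hf k (by omega))

/-- The inclusion of `S` into `S[X]`. -/
abbrev constHom (K S : Type*) [Field K] [CommRing S] [Algebra K S] : S →ₐ[K] S[X] :=
  Polynomial.CAlgHom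

/-- The retraction of the algebra of forms on `S[X]` onto polynomials whose coefficients are forms
on `S`: it sends `dX` to zero. -/
theorem exists_retraction (K S : Type*) [Field K] [CommRing S] [Algebra K S] :
    ∃ L : FormsAlg K S[X] →ₐ[K] (FormsAlg K S)[X],
      (∀ f : S[X], L (algebraMap _ _ f) = f.map (algebraMap S (FormsAlg K S))) ∧
      (∀ (a : ℕ) (s : S),
        L (dForm (Polynomial.monomial a s)) = Polynomial.monomial a (dForm s)) := by
  let φ : S[X] →ₐ[K] (FormsAlg K S)[X] :=
    Polynomial.mapAlgHom ((Algebra.ofId S (FormsAlg K S)).restrictScalars K)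
  have hφ : ∀ (a : ℕ) (s : S), φ (Polynomial.monomial a s) =
      Polynomial.monomial a (algebraMap S (FormsAlg K S) s) := fun a s =>
    Polynomial.map_monomial _
  let D : S[X] →ₗ[K] (FormsAlg K S)[X] := Polynomial.lsum fun a =>
    ((Polynomial.monomial a).restrictScalars K) ∘ₗ
      ((ExteriorAlgebra.ι S).restrictScalars K ∘ₗ (KaehlerDifferential.D K S).toLinearMap)
  have hD : ∀ (a : ℕ) (s : S),
      D (Polynomial.monomial a s) = Polynomial.monomial a (dForm s) := fun a s => by
    simp only [D, Polynomial.lsum_apply]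
    exact Polynomial.sum_monomial_index s _ (map_zero _)
  have hc : ∀ f q, φ f * q = q * φ f := by
    intro f q
    induction f using Polynomial.induction_on' with
    | add f g hf hg => rw [map_add, add_mul, mul_add, hf, hg]
    | monomial a s =>
      induction q using Polynomial.induction_on' with
      | add f g hf hg => rw [add_mul, mul_add, hf, hg]
      | monomial b w =>
        rw [hφ, Polynomial.monomial_mul_monomial, Polynomial.monomial_mul_monomial,
          Algebra.commutes, add_comm]
  have hL : ∀ f g, D (f * g) = φ f * D g + φ g * D f := by
    intro f g
    induction f using Polynomial.induction_on' with
    | add f f' hf hf' => rw [add_mul, map_add, hf, hf', map_add, map_add, add_mul, mul_add]; abel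
    | monomial a s =>
      induction g using Polynomial.induction_on' with
      | add g g' hg hg' => rw [mul_add, map_add, hg, hg', map_add, map_add, add_mul, mul_add]; abel
      | monomial b t =>
        rw [Polynomial.monomial_mul_monomial, hD, hφ, hφ, hD, hD,
          Polynomial.monomial_mul_monomial, Polynomial.monomial_mul_monomial, dForm_mul,
          Algebra.smul_def, Algebra.smul_def, map_add, add_comm b a]
  have hanti : ∀ f g, D f * D g + D g * D f = 0 := by
    intro f g
    induction f using Polynomial.induction_on' with
    | add f f' hf hf' =>
      rw [map_add, mul_add, add_mul, add_add_add_comm, hf, hf', add_zero]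
    | monomial a s =>
      induction g using Polynomial.induction_on' with
      | add f f' hf hf' =>
        rw [map_add, mul_add, add_mul, add_add_add_comm, hf, hf', add_zero]
      | monomial b t =>
        rw [hD, hD, Polynomial.monomial_mul_monomial, Polynomial.monomial_mul_monomial,
          add_comm b a, ← map_add, dForm, dForm, ExteriorAlgebra.ι_add_mul_swap, map_zero]
  have hsq : ∀ f, D f * D f = 0 := by
    intro f
    induction f using Polynomial.induction_on' with
    | add f g hf hg =>
      rw [map_add, add_mul, mul_add, mul_add, hf, hg, zero_add, add_zero, hanti]
    | monomial a s =>
      rw [hD, Polynomial.monomial_mul_monomial, dForm, ExteriorAlgebra.ι_sq_zero, map_zero]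
  obtain ⟨L, h1, h2⟩ := exists_formsLift φ D hc hL hsq
  exact ⟨L, h1, fun a s => (h2 _).trans (hD a s)⟩

/-- The `K`-linear map `p ⊗ ω ↦ p ω` from `K[X] ⊗ Ω^m_{S/K}` to forms on `S[X]`. -/
def polyWedge (K S : Type*) [Field K] [CommRing S] [Algebra K S] (m : ℕ) :
    K[X] ⊗[K] Forms K S m →ₗ[K] FormsAlg K S[X] :=
  TensorProduct.lift (LinearMap.mk₂ K
    (fun p ω =>
      Polynomial.aeval (Polynomial.X : S[X]) p • extMap (constHom K S) (formsIncl K S m ω))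
    (fun p q ω => by rw [map_add, add_smul]) (fun c p ω => by rw [map_smul, smul_assoc])
    (fun p ω η => by rw [map_add, map_add, smul_add])
    (fun c p ω => by rw [map_smul, map_smul, smul_comm]))

theorem polyWedge_tmul {m : ℕ} (p : K[X]) (ω : Forms K S m) :
    polyWedge K S m (p ⊗ₜ ω) =
      Polynomial.aeval (Polynomial.X : S[X]) p • extMap (constHom K S) (formsIncl K S m ω) := rfl

theorem polyWedge_injective (m : ℕ) : Function.Injective (polyWedge K S m) := by
  obtain ⟨L, hL, hL'⟩ := exists_retraction K S
  let e := TensorProduct.equivFinsuppOfBasisLeft (N := Forms K S m) (Polynomial.basisMonomials K)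
  have hC : ∀ w, L (extMap (constHom K S) w) = Polynomial.C w := by
    have : L.comp (extMap (constHom K S)) = Polynomial.CAlgHom := by
      refine formsAlg_hom_ext (fun a => ?_) (fun a => ?_)
      · rw [AlgHom.comp_apply, extMap_algebraMap, hL]
        exact Polynomial.map_C _
      · rw [AlgHom.comp_apply, extMap_dForm]
        exact hL' 0 a
    exact fun w => AlgHom.congr_fun this w
  have key : ∀ z k, (L (polyWedge K S m z)).coeff k = formsIncl K S m (e z k) := by
    intro z k
    induction z using TensorProduct.induction_on with
    | zero => simp
    | add x y hx hy => rw [map_add, map_add, Polynomial.coeff_add, hx, hy, map_add,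
        Finsupp.add_apply, map_add]
    | tmul p ω =>
      rw [polyWedge_tmul, Algebra.smul_def, map_mul, hC, hL, Polynomial.coeff_mul_C,
        Polynomial.coeff_map, TensorProduct.equivFinsuppOfBasisLeft_apply_tmul_apply, map_smul,
        Polynomial.aeval_X_left_eq_map, Polynomial.coeff_map, Algebra.smul_def,
        ← IsScalarTower.algebraMap_apply]
      rfl
  rw [injective_iff_map_eq_zero]
  intro z hz
  apply e.injective
  ext1 k
  apply formsIncl_injective
  rw [← key, hz]
  simp

/-- The `K`-linear map `(p ⊗ ω, q ⊗ η) ↦ p ω + q dX ∧ η`. -/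
def splitMap (K S : Type*) [Field K] [CommRing S] [Algebra K S] (m : ℕ) :
    (K[X] ⊗[K] Forms K S m) × (K[X] ⊗[K] Forms K S (m - 1)) →ₗ[K] FormsAlg K S[X] :=
  (polyWedge K S m).coprod
    (LinearMap.mulLeft K (dForm (Polynomial.X : S[X])) ∘ₗ polyWedge K S (m - 1))

theorem splitMap_tmul {m : ℕ} (p q : K[X]) (ω : Forms K S m) (η : Forms K S (m - 1)) :
    splitMap K S m (p ⊗ₜ ω, q ⊗ₜ η) =
      Polynomial.aeval (Polynomial.X : S[X]) p • extMap (constHom K S) (formsIncl K S m ω) +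
      Polynomial.aeval (Polynomial.X : S[X]) q • (dForm (Polynomial.X : S[X]) *
        extMap (constHom K S) (formsIncl K S (m - 1) η)) := by
  rw [← mul_smul_comm]
  rfl

/-- The contraction with the vector field `d/dX` recovers `η` from `ω + dX ∧ η`. -/
theorem splitMap_injective (m : ℕ) : Function.Injective (splitMap K S m) := by
  let δ : Ω[S[X]⁄K] →ₗ[S[X]] S[X] :=
    ((Polynomial.derivative').restrictScalars K).liftKaehlerDifferential
  have hδ : ∀ f, δ (KaehlerDifferential.D K S[X] f) = Polynomial.derivative f := fun f =>
    Derivation.liftKaehlerDifferential_comp_D _ f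
  let c : FormsAlg K S[X] →ₗ[S[X]] FormsAlg K S[X] := CliffordAlgebra.contractLeft δ
  have hc : ∀ (f : S[X]) (w : FormsAlg K S[X]),
      c (dForm f * w) = Polynomial.derivative f • w - dForm f * c w := fun f w => by
    rw [← hδ]; exact CliffordAlgebra.contractLeft_ι_mul δ _ _
  have h0 : ∀ n (b : Fin n → S), c (dProd (K := K) fun j => constHom K S (b j)) = 0 := by
    intro n
    induction n with
    | zero => intro b; rw [dProd_zero]; exact CliffordAlgebra.contractLeft_one (d := δ) _
    | succ n ih =>
      intro b
      rw [dProd_succ, hc, ih fun j => b j.succ]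
      simp
  have h1 : ∀ n z, c (polyWedge K S n z) = 0 := by
    intro n z
    induction z using TensorProduct.induction_on with
    | zero => simp
    | add x y hx hy => rw [map_add, map_add, hx, hy, add_zero]
    | tmul p ω =>
      rw [polyWedge_tmul, map_smul]
      have hω := mem_forms_span ω
      induction hω using Submodule.span_induction with
      | mem x hx =>
        obtain ⟨a, b, rfl⟩ := hx
        rw [formsIncl_ιMulti, extMap_smul, extMap_dProd, map_smul, h0, smul_zero, smul_zero]
      | zero => simp
      | add x y _ _ hx hy => rw [map_add, map_add, map_add, smul_add, hx, hy, add_zero]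
      | smul k x _ hx =>
        rw [map_smul, map_smul, LinearMap.map_smul_of_tower, smul_comm, hx, smul_zero]
  rw [injective_iff_map_eq_zero]
  rintro ⟨z, z'⟩ hz
  have hz : polyWedge K S m z + dForm (Polynomial.X : S[X]) * polyWedge K S (m - 1) z' = 0 := hz
  have h2 := congrArg c hz
  rw [map_add, h1, hc, h1, Polynomial.derivative_X, one_smul, mul_zero, sub_zero, zero_add,
    map_zero] at h2
  rw [h2, mul_zero, add_zero] at hz
  rw [(injective_iff_map_eq_zero _).1 (polyWedge_injective m) z hz,
    (injective_iff_map_eq_zero _).1 (polyWedge_injective (m - 1)) z' h2]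
  rfl

/-- The forms `X^i ω` and `X^{i-1} dX ∧ η` of degree `i`, with forms `ω`, `η` on `S`. -/
def splitGrade (K S : Type*) [Field K] [CommRing S] [Algebra K S] (m : ℕ) (i : ℤ) :
    Submodule K (FormsAlg K S[X]) :=
  Submodule.span K
    ({w | ∃ (a : ℕ) (ω : Forms K S m), (a : ℤ) = i ∧
        w = (Polynomial.X ^ a : S[X]) • extMap (constHom K S) (formsIncl K S m ω)} ∪
      {w | ∃ (a m' : ℕ) (η : Forms K S m'), (a : ℤ) + 1 = i ∧ m' + 1 = m ∧
        w = (Polynomial.X ^ a : S[X]) • (dForm (Polynomial.X : S[X]) *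
          extMap (constHom K S) (formsIncl K S m' η))})

theorem smul_mem_splitGrade {m : ℕ} {d i j : ℤ} {f : S[X]} (hf : f ∈ polyGrade K S d)
    {w : FormsAlg K S[X]} (hw : w ∈ splitGrade K S m i) (hj : d + i = j) :
    f • w ∈ splitGrade K S m j := by
  subst hj
  obtain rfl | ⟨a, s, rfl, rfl⟩ := exists_of_mem_polyGrade hf
  · rw [zero_smul]; exact zero_mem _
  have hmon : (Polynomial.monomial a s : S[X]) = Polynomial.X ^ a * constHom K S s := by
    rw [mul_comm]; exact (Polynomial.C_mul_X_pow_eq_monomial).symm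
  induction hw using Submodule.span_induction with
  | mem w hw =>
    rcases hw with ⟨b, ω, rfl, rfl⟩ | ⟨b, m', η, rfl, rfl, rfl⟩
    · refine Submodule.subset_span (Or.inl ⟨a + b, s • ω, by push_cast; ring, ?_⟩)
      rw [formsIncl_smul, extMap_smul, hmon, smul_smul, smul_smul, pow_add]
      congr 1
      ring
    · refine Submodule.subset_span (Or.inr ⟨a + b, m', s • η, by push_cast; ring, rfl, ?_⟩)
      rw [formsIncl_smul, extMap_smul, hmon, mul_smul_comm, smul_smul, smul_smul, pow_add]
      congr 1
      ring
  | zero => rw [smul_zero]; exact zero_mem _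
  | add x y _ _ hx hy => rw [smul_add]; exact add_mem hx hy
  | smul k x _ hx => rw [smul_comm]; exact Submodule.smul_mem _ _ hx

theorem dForm_mul_formsIncl_mem {A : Type*} [CommRing A] [Algebra K A] (s : A) {m : ℕ}
    (ω : Forms K A m) : ∃ ω' : Forms K A (m + 1), formsIncl K A (m + 1) ω' =
      dForm s * formsIncl K A m ω := by
  refine ⟨⟨dForm s * formsIncl K A m ω, ?_⟩, rfl⟩
  rw [ExteriorAlgebra.exteriorPower, pow_succ']
  exact Submodule.mul_mem_mul ⟨_, rfl⟩ ω.2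

theorem dForm_mul_mem_splitGrade {m : ℕ} {d i j : ℤ} {f : S[X]} (hf : f ∈ polyGrade K S d)
    {w : FormsAlg K S[X]} (hw : w ∈ splitGrade K S m i) (hj : d + i = j) :
    dForm f * w ∈ splitGrade K S (m + 1) j := by
  subst hj
  obtain rfl | ⟨a, s, rfl, rfl⟩ := exists_of_mem_polyGrade hf
  · rw [dForm, map_zero, map_zero, zero_mul]; exact zero_mem _
  have hC : ∀ w ∈ splitGrade K S m i,
      dForm (constHom K S s) * w ∈ splitGrade K S (m + 1) i := by
    intro w hw
    induction hw using Submodule.span_induction with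
    | mem w hw =>
      rcases hw with ⟨b, ω, rfl, rfl⟩ | ⟨b, m', η, rfl, rfl, rfl⟩
      · obtain ⟨ω', hω'⟩ := dForm_mul_formsIncl_mem s ω
        refine Submodule.subset_span (Or.inl ⟨b, ω', rfl, ?_⟩)
        rw [hω', map_mul, extMap_dForm, mul_smul_comm]
      · obtain ⟨ω', hω'⟩ := dForm_mul_formsIncl_mem s η
        rw [← neg_mem_iff]
        refine Submodule.subset_span (Or.inr ⟨b, m' + 1, ω', rfl, rfl, ?_⟩)
        rw [hω', map_mul, extMap_dForm, mul_smul_comm, ← smul_neg, ← mul_assoc, ← mul_assoc,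
          ← neg_mul]
        congr 2
        exact neg_eq_of_add_eq_zero_left (ExteriorAlgebra.ι_add_mul_swap _ _)
    | zero => rw [mul_zero]; exact zero_mem _
    | add x y _ _ hx hy => rw [mul_add]; exact add_mem hx hy
    | smul k x _ hx => rw [mul_smul_comm]; exact Submodule.smul_mem _ _ hx
  have hX : ∀ w ∈ splitGrade K S m i,
      dForm (Polynomial.X : S[X]) * w ∈ splitGrade K S (m + 1) (i + 1) := by
    intro w hw
    induction hw using Submodule.span_induction with
    | mem w hw =>
      rcases hw with ⟨b, ω, rfl, rfl⟩ | ⟨b, m', η, rfl, rfl, rfl⟩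
      · refine Submodule.subset_span (Or.inr ⟨b, m, ω, rfl, rfl, ?_⟩)
        rw [mul_smul_comm]
      · rw [mul_smul_comm, ← mul_assoc, dForm, ExteriorAlgebra.ι_sq_zero, zero_mul, smul_zero]
        exact zero_mem _
    | zero => rw [mul_zero]; exact zero_mem _
    | add x y _ _ hx hy => rw [mul_add]; exact add_mem hx hy
    | smul k x _ hx => rw [mul_smul_comm]; exact Submodule.smul_mem _ _ hx
  have hmon : (Polynomial.monomial a s : S[X]) = Polynomial.X ^ a * constHom K S s := by
    rw [mul_comm]; exact (Polynomial.C_mul_X_pow_eq_monomial).symm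
  have hXa : (Polynomial.X ^ a : S[X]) ∈ polyGrade K S a := by
    rw [← Polynomial.monomial_one_right_eq_X_pow]; exact monomial_mem_polyGrade a 1
  rw [hmon, dForm_mul, add_mul, smul_mul_assoc, smul_mul_assoc]
  refine add_mem (smul_mem_splitGrade hXa (hC w hw) rfl) ?_
  have hd : (dForm (Polynomial.X ^ a : S[X]) : FormsAlg K S[X]) =
      (a • (Polynomial.X : S[X]) ^ (a - 1)) • dForm (Polynomial.X : S[X]) := by
    rw [dForm, Derivation.leibniz_pow, map_nsmul, map_smul, smul_assoc]; rfl
  rw [hd, smul_mul_assoc, smul_smul]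
  cases a with
  | zero => rw [zero_smul, mul_zero, zero_smul]; exact zero_mem _
  | succ a =>
    refine smul_mem_splitGrade (d := a) ?_ (hX w hw) (by push_cast; ring)
    have : constHom K S s * ((a + 1) • (Polynomial.X : S[X]) ^ (a + 1 - 1)) =
        Polynomial.monomial a ((a + 1) • s) := by
      rw [mul_smul_comm, map_nsmul, add_tsub_cancel_right]
      congr 1
      exact Polynomial.C_mul_X_pow_eq_monomial
    rw [this]
    exact monomial_mem_polyGrade a _

theorem smul_dProd_mem_splitGrade {m : ℕ} {e₀ : ℤ} {e : Fin m → ℤ} {f : S[X]} {b : Fin m → S[X]}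
    (hf : f ∈ polyGrade K S e₀) (hb : ∀ j, b j ∈ polyGrade K S (e j)) :
    f • dProd b ∈ splitGrade K S m (e₀ + ∑ j, e j) := by
  refine smul_mem_splitGrade hf ?_ rfl
  clear hf
  induction m with
  | zero =>
    refine Submodule.subset_span (Or.inl ⟨0, ⟨1, ?_⟩, by simp, ?_⟩)
    · rw [ExteriorAlgebra.exteriorPower, pow_zero]; exact Submodule.one_le.1 le_rfl
    · rw [dProd_zero, pow_zero, one_smul]; exact (map_one (extMap (constHom K S))).symm
  | succ m ih =>
    rw [dProd_succ]
    exact dForm_mul_mem_splitGrade (hb 0) (ih fun j => hb j.succ) (Fin.sum_univ_succ e).symm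

/-- The forms `X^i ω` and `X^{i-1} dX ∧ η` span the forms of degree `i`, by induction on the number
of differentials in `f db_1 ∧ ⋯ ∧ db_m`. -/
theorem splitGrade_eq_map_formsGrade (m : ℕ) (i : ℤ) :
    splitGrade K S m i = (formsGrade (polyGrade K S) m i).map (formsIncl K S[X] m) := by
  apply le_antisymm
  · refine Submodule.span_le.2 ?_
    have hXa : ∀ (a : ℕ) (s : S),
        (Polynomial.X ^ a : S[X]) * constHom K S s ∈ polyGrade K S a := fun a s => by
      rw [mul_comm]
      exact (Polynomial.C_mul_X_pow_eq_monomial (R := S)).symm ▸ monomial_mem_polyGrade a s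
    have hC : ∀ s : S, constHom K S s ∈ polyGrade K S 0 := fun s => monomial_mem_polyGrade 0 s
    rintro _ (⟨a, ω, rfl, rfl⟩ | ⟨a, m', η, rfl, rfl, rfl⟩)
    · have hω := mem_forms_span ω
      induction hω using Submodule.span_induction with
      | mem x hx =>
        obtain ⟨s, b, rfl⟩ := hx
        rw [formsIncl_ιMulti, extMap_smul, extMap_dProd, smul_smul]
        refine ⟨_, Submodule.subset_span ⟨a, fun _ => 0, _, fun j => constHom K S (b j), hXa a s,
          fun j => hC _, by simp, rfl⟩, rfl⟩
      | zero => rw [map_zero, map_zero, smul_zero]; exact zero_mem _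
      | add x y _ _ hx hy => rw [map_add, map_add, smul_add]; exact add_mem hx hy
      | smul k x _ hx =>
        rw [map_smul, map_smul, smul_comm]; exact Submodule.smul_mem _ _ hx
    · have hη := mem_forms_span η
      induction hη using Submodule.span_induction with
      | mem x hx =>
        obtain ⟨s, b, rfl⟩ := hx
        rw [formsIncl_ιMulti, extMap_smul, extMap_dProd, mul_smul_comm, smul_smul]
        refine ⟨_, Submodule.subset_span ⟨a, Fin.cons 1 fun _ => 0, _,
          Fin.cons Polynomial.X fun j => constHom K S (b j), hXa a s,
          fun j => ?_, by simp [Fin.sum_univ_succ], rfl⟩, ?_⟩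
        · refine Fin.cases ?_ (fun j => ?_) j
          · exact monomial_mem_polyGrade 1 1
          · exact hC _
        · rw [formsIncl_ιMulti, dProd_succ]
          rfl
      | zero => rw [map_zero, map_zero, mul_zero, smul_zero]; exact zero_mem _
      | add x y _ _ hx hy => rw [map_add, map_add, mul_add, smul_add]; exact add_mem hx hy
      | smul k x _ hx =>
        rw [map_smul, map_smul, mul_smul_comm, smul_comm]; exact Submodule.smul_mem _ _ hx
  · rw [Submodule.map_le_iff_le_comap, formsGrade, Submodule.span_le]
    rintro _ ⟨e₀, e, a, b, ha, hb, rfl, rfl⟩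
    exact smul_dProd_mem_splitGrade ha hb

theorem splitGrade_eq_map_splitMap {m : ℕ} (hm : 1 ≤ m) (i : ℤ) :
    splitGrade K S m i = ((monomialTensor K (Forms K S m) i).prod
      (monomialTensor K (Forms K S (m - 1)) (i - 1))).map (splitMap K S m) := by
  obtain ⟨m, rfl⟩ : ∃ m', m = m' + 1 := ⟨m - 1, by omega⟩
  have hX : ∀ a : ℕ, Polynomial.aeval (Polynomial.X : S[X]) (Polynomial.X ^ a : K[X]) =
      Polynomial.X ^ a := fun a => by simp
  apply le_antisymm
  · refine Submodule.span_le.2 ?_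
    rintro _ (⟨a, ω, rfl, rfl⟩ | ⟨a, m', η, rfl, hm', rfl⟩)
    · refine ⟨((Polynomial.X ^ a : K[X]) ⊗ₜ ω, (0 : K[X]) ⊗ₜ 0),
        ⟨Submodule.subset_span ⟨a, ω, rfl, rfl⟩, by simp⟩, ?_⟩
      rw [splitMap_tmul, hX, map_zero, zero_smul, add_zero]
    · obtain rfl : m' = m := by omega
      refine ⟨((0 : K[X]) ⊗ₜ 0, (Polynomial.X ^ a : K[X]) ⊗ₜ η),
        ⟨by simp, Submodule.subset_span ⟨a, η, by simp, rfl⟩⟩, ?_⟩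
      rw [splitMap_tmul, hX, map_zero, zero_smul, zero_add]
      rfl
  · rw [Submodule.map_le_iff_le_comap]
    rintro ⟨z, z'⟩ ⟨hz, hz'⟩
    have h1 : splitMap K S (m + 1) (z, z') = polyWedge K S (m + 1) z +
      dForm (Polynomial.X : S[X]) * polyWedge K S m z' := rfl
    rw [Submodule.mem_comap, h1]
    refine add_mem ?_ ?_
    · have : monomialTensor K (Forms K S (m + 1)) i ≤
          (splitGrade K S (m + 1) i).comap (polyWedge K S (m + 1)) := by
        refine Submodule.span_le.2 ?_
        rintro _ ⟨a, ω, rfl, rfl⟩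
        refine Submodule.subset_span (Or.inl ⟨a, ω, rfl, ?_⟩)
        rw [polyWedge_tmul, hX]
      exact this hz
    · have : monomialTensor K (Forms K S m) (i - 1) ≤ (splitGrade K S (m + 1) i).comap
          (LinearMap.mulLeft K (dForm (Polynomial.X : S[X])) ∘ₗ polyWedge K S m) := by
        refine Submodule.span_le.2 ?_
        rintro _ ⟨a, ω, ha, rfl⟩
        refine Submodule.subset_span (Or.inr ⟨a, m, ω, by omega, rfl, ?_⟩)
        rw [LinearMap.comp_apply, polyWedge_tmul, hX, LinearMap.mulLeft_apply, mul_smul_comm]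
      exact this hz'

/-- Every form on `S[X]` is a sum of homogeneous forms. -/
theorem range_formsIncl_le (m : ℕ) :
    LinearMap.range (formsIncl K S[X] m) ≤ ⨆ i, splitGrade K S m i := by
  have hsm : ∀ (n : ℕ) (f : S[X]) (w : FormsAlg K S[X]), w ∈ (⨆ i, splitGrade K S n i) →
      f • w ∈ ⨆ i, splitGrade K S n i := by
    intro n f w hw
    induction f using Polynomial.induction_on' with
    | add f g hf hg => rw [add_smul]; exact add_mem hf hg
    | monomial a s =>
      induction hw using Submodule.iSup_induction' with
      | mem i x hx =>
        exact Submodule.mem_iSup_of_mem (a + i : ℤ)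
          (smul_mem_splitGrade (monomial_mem_polyGrade a s) hx rfl)
      | zero => rw [smul_zero]; exact zero_mem _
      | add x y _ _ hx hy => rw [smul_add]; exact add_mem hx hy
  have hd : ∀ (n : ℕ) (f : S[X]) (w : FormsAlg K S[X]), w ∈ (⨆ i, splitGrade K S n i) →
      dForm f * w ∈ ⨆ i, splitGrade K S (n + 1) i := by
    intro n f w hw
    induction f using Polynomial.induction_on' with
    | add f g hf hg =>
      rw [show (dForm (f + g) : FormsAlg K S[X]) = dForm f + dForm g by simp [dForm], add_mul]
      exact add_mem hf hg
    | monomial a s =>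
      induction hw using Submodule.iSup_induction' with
      | mem i x hx =>
        exact Submodule.mem_iSup_of_mem (a + i : ℤ)
          (dForm_mul_mem_splitGrade (monomial_mem_polyGrade a s) hx rfl)
      | zero => rw [mul_zero]; exact zero_mem _
      | add x y _ _ hx hy => rw [mul_add]; exact add_mem hx hy
  have hp : ∀ (n : ℕ) (b : Fin n → S[X]), (dProd b : FormsAlg K S[X]) ∈
      ⨆ i, splitGrade K S n i := by
    intro n
    induction n with
    | zero =>
      intro b
      refine Submodule.mem_iSup_of_mem 0 ?_
      have := smul_dProd_mem_splitGrade (K := K) (S := S) (m := 0) (e₀ := 0) (e := fun _ => 0)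
        (f := 1) (b := b) (monomial_mem_polyGrade 0 1) (fun j => j.elim0)
      simpa using this
    | succ n ih =>
      intro b
      rw [dProd_succ]
      exact hd n _ _ (ih _)
  rintro _ ⟨w, rfl⟩
  have hw := mem_forms_span w
  induction hw using Submodule.span_induction with
  | mem x hx => obtain ⟨f, b, rfl⟩ := hx; exact hsm m f _ (hp m b)
  | zero => rw [map_zero]; exact zero_mem _
  | add x y _ _ hx hy => rw [map_add]; exact add_mem hx hy
  | smul k x _ hx => rw [map_smul]; exact Submodule.smul_mem _ _ hx

theorem range_splitMap {m : ℕ} (hm : 1 ≤ m) :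
    LinearMap.range (splitMap K S m) = LinearMap.range (formsIncl K S[X] m) := by
  apply le_antisymm
  · rintro _ ⟨⟨z, z'⟩, rfl⟩
    obtain ⟨m, rfl⟩ : ∃ m', m = m' + 1 := ⟨m - 1, by omega⟩
    have h0 : ∀ (n : ℕ) (x : K[X] ⊗[K] Forms K S n),
        polyWedge K S n x ∈ LinearMap.range (formsIncl K S[X] n) := by
      intro n x
      induction x using TensorProduct.induction_on with
      | zero => rw [map_zero]; exact zero_mem _
      | add x y hx hy => rw [map_add]; exact add_mem hx hy
      | tmul p ω =>
        rw [polyWedge_tmul, ← formsIncl_formsMap]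
        exact ⟨Polynomial.aeval (Polynomial.X : S[X]) p • formsMap (constHom K S) n ω,
          formsIncl_smul _ _⟩
    refine add_mem (h0 _ z) ?_
    obtain ⟨ω, hω⟩ := h0 _ z'
    obtain ⟨ω', hω'⟩ := dForm_mul_formsIncl_mem (K := K) (Polynomial.X : S[X]) ω
    exact ⟨ω', hω'.trans (by rw [hω]; rfl)⟩
  · refine (range_formsIncl_le m).trans (iSup_le fun i => ?_)
    rw [splitGrade_eq_map_splitMap hm]
    exact LinearMap.map_le_range

/-- The canonical splitting of the forms on `S[X]` into forms `p ω` and `q dX ∧ η`. -/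
theorem exists_polynomial_splitting {m : ℕ} (hm : 1 ≤ m) :
    ∃ Ψ : Forms K S[X] m ≃ₗ[K] (K[X] ⊗[K] Forms K S m) × (K[X] ⊗[K] Forms K S (m - 1)),
      (∀ z, formsIncl K S[X] m (Ψ.symm z) = splitMap K S m z) ∧
      IsPolyLinear (Polynomial.X : S[X]) m Ψ ∧ IsGradedSplitting (polyGrade K S) m Ψ := by
  let Ψ := ((LinearEquiv.ofInjective _ (splitMap_injective (K := K) (S := S) m)).trans
    ((LinearEquiv.ofEq _ _ (range_splitMap hm)).trans
      (LinearEquiv.ofInjective _ (formsIncl_injective (K := K) (A := S[X]) m)).symm)).symm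
  have hΨ : ∀ z, formsIncl K S[X] m (Ψ.symm z) = splitMap K S m z := by
    intro z
    have h := LinearEquiv.apply_symm_apply
      (LinearEquiv.ofInjective _ (formsIncl_injective (K := K) (A := S[X]) m))
      (LinearEquiv.ofEq _ _ (range_splitMap hm)
        (LinearEquiv.ofInjective _ (splitMap_injective (K := K) (S := S) m) z))
    exact congrArg Subtype.val h
  refine ⟨Ψ, hΨ, ?_, ?_⟩
  · intro p w
    obtain ⟨z, rfl⟩ := Ψ.symm.surjective w
    rw [Ψ.apply_symm_apply]
    apply Ψ.symm.injective
    rw [Ψ.symm_apply_apply]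
    apply formsIncl_injective
    rw [formsIncl_smul, hΨ, hΨ]
    have h2 : ∀ (n : ℕ) (x : K[X] ⊗[K] Forms K S n), polyWedge K S n (p • x) =
        Polynomial.aeval (Polynomial.X : S[X]) p • polyWedge K S n x := by
      intro n x
      induction x using TensorProduct.induction_on with
      | zero => simp
      | add x y hx hy => rw [smul_add, map_add, map_add, hx, hy, smul_add]
      | tmul q ω =>
        rw [TensorProduct.smul_tmul', polyWedge_tmul, polyWedge_tmul, smul_eq_mul, map_mul,
          mul_smul]
    obtain ⟨z, z'⟩ := z
    change _ • (polyWedge K S m z + dForm (Polynomial.X : S[X]) * polyWedge K S (m - 1) z') =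
      polyWedge K S m (p • z) + dForm (Polynomial.X : S[X]) * polyWedge K S (m - 1) (p • z')
    rw [h2, h2, smul_add, mul_smul_comm]
  · intro i
    have h := (splitGrade_eq_map_formsGrade (K := K) (S := S) m i).symm.trans
      (splitGrade_eq_map_splitMap hm i)
    have h3 : splitMap K S m = formsIncl K S[X] m ∘ₗ Ψ.symm.toLinearMap :=
      LinearMap.ext fun z => (hΨ z).symm
    rw [h3, Submodule.map_comp] at h
    have h4 := Submodule.map_injective_of_injective (formsIncl_injective m) h
    rw [h4, ← Submodule.map_comp]
    simp

end PolynomialForms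

/-! ### Dehomogenization -/

section Dehomogenization

/-- A presentation `π : K[X_0, …, X_n] → R` of a graded ring in which `x_0` is a non-zerodivisor,
together with its dehomogenization `S = R / ⟨x_0 - 1⟩`. The arguments about forms are carried out
for abstract rings `R` and `S`; the homogeneous coordinate ring of a scheme and its affine
coordinate ring are an instance. -/
structure DehomSetup (K R S : Type*) [Field K] [CommRing R] [Algebra K R] [CommRing S] [Algebra K S]
    (n : ℕ) where
  /-- the presentation of `R` -/
  π : MvPolynomial (Fin (n + 1)) K →ₐ[K] R
  surjective : Function.Surjective π
  homogeneous : ∀ f, π f = 0 → ∀ d, π (MvPolynomial.homogeneousComponent d f) = 0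
  nzd : π (MvPolynomial.X 0) ∈ nonZeroDivisors R
  /-- the dehomogenization map -/
  deh : R →ₐ[K] S
  deh_surjective : Function.Surjective deh
  deh_x0 : deh (π (MvPolynomial.X 0)) = 1
  exists_of_deh_eq_zero : ∀ a, deh a = 0 → ∃ b, a = b * (π (MvPolynomial.X 0) - 1)

variable {K : Type*} [Field K] {n : ℕ}

theorem sum_exponents_of_isHomogeneous {p : MvPolynomial (Fin (n + 1)) K} {d : ℕ}
    (hp : p.IsHomogeneous d) {e : Fin (n + 1) →₀ ℕ} (he : e ∈ p.support) : ∑ i, e i = d := by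
  have h := hp (MvPolynomial.mem_support_iff.1 he)
  rw [Finsupp.weight_apply, Finsupp.sum_fintype _ _ (by simp)] at h
  simpa using h

theorem aeval_mul_of_isHomogeneous {A : Type*} [CommRing A] [Algebra K A] (c : A)
    (y : Fin (n + 1) → A) {p : MvPolynomial (Fin (n + 1)) K} {d : ℕ} (hp : p.IsHomogeneous d) :
    MvPolynomial.aeval (fun j => c * y j) p = c ^ d * MvPolynomial.aeval y p := by
  rw [MvPolynomial.aeval_def, MvPolynomial.aeval_def, MvPolynomial.eval₂_eq',
    MvPolynomial.eval₂_eq', Finset.mul_sum]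
  refine Finset.sum_congr rfl fun e he => ?_
  simp_rw [mul_pow]
  rw [Finset.prod_mul_distrib, Finset.prod_pow_eq_pow_sum, sum_exponents_of_isHomogeneous hp he]
  ring

namespace DehomSetup

variable {R S : Type*} [CommRing R] [Algebra K R] [CommRing S] [Algebra K S]
  (D : DehomSetup K R S n)

/-- The generators `x_j` of `R`. -/
def x (j : Fin (n + 1)) : R := D.π (MvPolynomial.X j)

/-- The homogeneous component `R_d`, for `d ∈ ℤ`. -/
def grade (d : ℤ) : Submodule K R :=
  if 0 ≤ d then (MvPolynomial.homogeneousSubmodule (Fin (n + 1)) K d.toNat).map D.π.toLinearMap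
  else ⊥

theorem mem_grade_natCast {d : ℕ} {a : R} :
    a ∈ D.grade d ↔ ∃ p : MvPolynomial (Fin (n + 1)) K, p.IsHomogeneous d ∧ D.π p = a := by
  rw [grade, if_pos (Int.natCast_nonneg d), Int.toNat_natCast]
  rfl

theorem π_mem_grade {d : ℕ} {p : MvPolynomial (Fin (n + 1)) K} (hp : p.IsHomogeneous d) :
    D.π p ∈ D.grade d := D.mem_grade_natCast.2 ⟨p, hp, rfl⟩

theorem eq_zero_of_mem_grade_neg {d : ℤ} (hd : d < 0) {a : R} (ha : a ∈ D.grade d) : a = 0 := by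
  rw [grade, if_neg (by omega)] at ha
  exact (Submodule.mem_bot K).1 ha

theorem one_mem_grade : (1 : R) ∈ D.grade 0 :=
  D.mem_grade_natCast.2 ⟨1, MvPolynomial.isHomogeneous_one _ _, map_one _⟩

theorem mul_mem_grade {d e : ℤ} {a b : R} (ha : a ∈ D.grade d) (hb : b ∈ D.grade e) :
    a * b ∈ D.grade (d + e) := by
  rcases lt_or_ge d 0 with hd | hd
  · rw [D.eq_zero_of_mem_grade_neg hd ha, zero_mul]; exact zero_mem _
  rcases lt_or_ge e 0 with he | he
  · rw [D.eq_zero_of_mem_grade_neg he hb, mul_zero]; exact zero_mem _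
  lift d to ℕ using hd
  lift e to ℕ using he
  obtain ⟨p, hp, rfl⟩ := D.mem_grade_natCast.1 ha
  obtain ⟨q, hq, rfl⟩ := D.mem_grade_natCast.1 hb
  rw [← map_mul, ← Nat.cast_add]
  exact D.π_mem_grade (hp.mul hq)

theorem x_mem_grade (j : Fin (n + 1)) : D.x j ∈ D.grade 1 :=
  D.π_mem_grade (d := 1) (MvPolynomial.isHomogeneous_X K j)

theorem x_pow_mem_grade (j : Fin (n + 1)) (k : ℕ) : D.x j ^ k ∈ D.grade k := by
  rw [x, ← map_pow]
  exact D.π_mem_grade (MvPolynomial.isHomogeneous_X_pow j k)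

@[simp] theorem deh_x_zero : D.deh (D.x 0) = 1 := D.deh_x0

/-- A linear map that vanishes on the homogeneous elements of `ker π` vanishes on `ker π`. -/
theorem map_eq_zero_of_homogeneous {A : Type*} [AddCommGroup A] [Module K A]
    (f : MvPolynomial (Fin (n + 1)) K →ₗ[K] A)
    (h : ∀ p, D.π p = 0 → ∀ d, p.IsHomogeneous d → f p = 0) {p : MvPolynomial (Fin (n + 1)) K}
    (hp : D.π p = 0) : f p = 0 := by
  rw [← MvPolynomial.sum_homogeneousComponent p, map_sum]
  exact Finset.sum_eq_zero fun i _ => h _ (D.homogeneous p hp i) i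
    (MvPolynomial.homogeneousComponent_isHomogeneous i p)

/-- Every element of `R` is a sum of homogeneous elements. -/
theorem homogeneous_induction {p : R → Prop} (h0 : p 0)
    (hadd : ∀ a b, p a → p b → p (a + b)) (h : ∀ (d : ℕ), ∀ a ∈ D.grade d, p a)
    (a : R) : p a := by
  obtain ⟨f, rfl⟩ := D.surjective a
  rw [← MvPolynomial.sum_homogeneousComponent f, map_sum]
  exact Finset.sum_induction _ p (fun a b => hadd a b) h0 fun i _ =>
    h i _ (D.π_mem_grade (MvPolynomial.homogeneousComponent_isHomogeneous i f))

theorem aeval_map_x {A : Type*} [CommRing A] [Algebra K A] (f : R →ₐ[K] A)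
    (p : MvPolynomial (Fin (n + 1)) K) :
    MvPolynomial.aeval (fun j => f (D.x j)) p = f (D.π p) := by
  have : MvPolynomial.aeval (fun j => f (D.x j)) = f.comp D.π := by
    ext j
    simp [x]
  rw [this]
  rfl

/-- For an algebra homomorphism `f : R → A` and `c ∈ A`, the rescaled homomorphism with
`a ↦ c^d f(a)` for `a` homogeneous of degree `d`. -/
theorem exists_rescale {A : Type*} [CommRing A] [Algebra K A] (f : R →ₐ[K] A) (c : A) :
    ∃ g : R →ₐ[K] A, ∀ (d : ℕ), ∀ a ∈ D.grade d, g a = c ^ d * f a := by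
  let g : MvPolynomial (Fin (n + 1)) K →ₐ[K] A := MvPolynomial.aeval fun j => c * f (D.x j)
  have hg : ∀ d p, p.IsHomogeneous d → g p = c ^ d * f (D.π p) := fun d p hp => by
    rw [← aeval_map_x]; exact aeval_mul_of_isHomogeneous _ _ hp
  have hker : ∀ p, D.π p = 0 → g p = 0 := fun p hp =>
    D.map_eq_zero_of_homogeneous g.toLinearMap (fun q hq d hd => by
      rw [AlgHom.toLinearMap_apply, hg d q hd, hq, map_zero, mul_zero]) hp
  refine ⟨AlgHom.liftOfSurjective D.π D.surjective g fun p hp => hker p hp, fun d a ha => ?_⟩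
  obtain ⟨p, hp, rfl⟩ := D.mem_grade_natCast.1 ha
  rw [← hg d p hp]
  exact AlgHom.liftOfSurjective_apply _ _ _ _ p

/-- If `x_0` becomes invertible in `L`, then there is a homomorphism `S → L` with
`a^deh ↦ a / x_0^d` for `a` homogeneous of degree `d`. -/
theorem exists_affineToQuot {L : Type*} [CommRing L] [Algebra K L] (f : R →ₐ[K] L)
    (hf : IsUnit (f (D.x 0))) :
    ∃ σ : S →ₐ[K] L, ∀ (d : ℕ), ∀ a ∈ D.grade d, σ (D.deh a) * f (D.x 0) ^ d = f a := by
  obtain ⟨u, hu⟩ := hf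
  obtain ⟨g, hg⟩ := D.exists_rescale f (↑u⁻¹ : L)
  refine ⟨AlgHom.liftOfSurjective D.deh D.deh_surjective g fun a ha => ?_, fun d a ha => ?_⟩
  · obtain ⟨b, rfl⟩ := D.exists_of_deh_eq_zero a ha
    have h1 : g (D.x 0) = 1 := by
      rw [hg 1 _ (D.x_mem_grade 0), pow_one, ← hu, Units.inv_mul]
    change g (b * (D.x 0 - 1)) = 0
    rw [map_mul, map_sub, map_one, h1, sub_self, mul_zero]
  · rw [AlgHom.liftOfSurjective_apply, hg d a ha, mul_right_comm, ← hu, ← mul_pow,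
      Units.inv_mul, one_pow, one_mul]

/-- Dehomogenization is injective on each homogeneous component. -/
theorem eq_zero_of_deh_eq_zero {d : ℤ} {a : R} (ha : a ∈ D.grade d) (h : D.deh a = 0) : a = 0 := by
  rcases lt_or_ge d 0 with hd | hd
  · exact D.eq_zero_of_mem_grade_neg hd ha
  · lift d to ℕ using hd
    let L := Localization.Away (D.x 0)
    obtain ⟨σ, hσ⟩ := D.exists_affineToQuot (IsScalarTower.toAlgHom K R L)
      (IsLocalization.Away.algebraMap_isUnit (D.x 0))
    have hinj : Function.Injective (algebraMap R L) :=
      IsLocalization.injective L (M := Submonoid.powers (D.x 0)) (Submonoid.powers_le.2 D.nzd)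
    apply hinj
    have h2 := hσ d a ha
    rw [h, map_zero, zero_mul] at h2
    rw [map_zero]
    exact h2.symm

theorem deh_injOn {d : ℤ} {a b : R} (ha : a ∈ D.grade d) (hb : b ∈ D.grade d)
    (h : D.deh a = D.deh b) : a = b :=
  sub_eq_zero.1 (D.eq_zero_of_deh_eq_zero (sub_mem ha hb) (by rw [map_sub, h, sub_self]))

theorem exists_toPoly : ∃ ρ : R →ₐ[K] S[X], ∀ (d : ℕ), ∀ a ∈ D.grade d,
    ρ a = Polynomial.monomial d (D.deh a) := by
  obtain ⟨ρ, hρ⟩ := D.exists_rescale ((constHom K S).comp D.deh) Polynomial.X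
  refine ⟨ρ, fun d a ha => ?_⟩
  rw [hρ d a ha, ← Polynomial.C_mul_X_pow_eq_monomial, mul_comm]
  rfl

/-- The homomorphism `R → S[X]` with `a ↦ a^deh X^d` for `a` homogeneous of degree `d`. -/
def toPoly : R →ₐ[K] S[X] := D.exists_toPoly.choose

theorem toPoly_apply {d : ℕ} {a : R} (ha : a ∈ D.grade d) :
    D.toPoly a = Polynomial.monomial d (D.deh a) := D.exists_toPoly.choose_spec d a ha

theorem toPoly_mem_polyGrade {d : ℤ} {a : R} (ha : a ∈ D.grade d) :
    D.toPoly a ∈ polyGrade K S d := by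
  rcases lt_or_ge d 0 with hd | hd
  · rw [D.eq_zero_of_mem_grade_neg hd ha, map_zero]; exact zero_mem _
  · lift d to ℕ using hd
    rw [D.toPoly_apply ha]
    exact monomial_mem_polyGrade d _

theorem eval_toPoly (a : R) : (D.toPoly a).eval 1 = D.deh a := by
  induction a using D.homogeneous_induction with
  | h0 => simp
  | hadd a b ha hb => rw [map_add, Polynomial.eval_add, ha, hb, map_add]
  | h d a ha => rw [D.toPoly_apply ha]; simp

theorem toPoly_x_zero : D.toPoly (D.x 0) = Polynomial.X := by
  rw [D.toPoly_apply (d := 1) (D.x_mem_grade 0), deh_x_zero]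
  rfl

/-- Every element of `S` is the dehomogenization of a homogeneous element of every large degree. -/
theorem exists_deh_eq (s : S) :
    ∃ N : ℕ, ∀ d : ℕ, N ≤ d → ∃ a ∈ D.grade d, D.deh a = s := by
  obtain ⟨a, rfl⟩ := D.deh_surjective s
  induction a using D.homogeneous_induction with
  | h0 => exact ⟨0, fun d _ => ⟨0, zero_mem _, rfl⟩⟩
  | hadd a b ha hb =>
    obtain ⟨N, hN⟩ := ha
    obtain ⟨M, hM⟩ := hb
    refine ⟨max N M, fun d hd => ?_⟩
    obtain ⟨a', ha', h⟩ := hN d (le_trans (le_max_left _ _) hd)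
    obtain ⟨b', hb', h'⟩ := hM d (le_trans (le_max_right _ _) hd)
    exact ⟨a' + b', add_mem ha' hb', by rw [map_add, map_add, h, h']⟩
  | h d a ha =>
    refine ⟨d, fun e he => ⟨D.x 0 ^ (e - d) * a, ?_, by rw [map_mul, map_pow, deh_x_zero]; simp⟩⟩
    have := D.mul_mem_grade (D.x_pow_mem_grade 0 (e - d)) ha
    rwa [← Nat.cast_add, Nat.sub_add_cancel he] at this

/-- Every polynomial is moved into the image of `R` by a large power of `X`. -/
theorem exists_toPoly_eq (f : S[X]) :
    ∃ N : ℕ, ∀ d : ℕ, N ≤ d → ∃ a, D.toPoly a = Polynomial.X ^ d * f := by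
  induction f using Polynomial.induction_on' with
  | add f g hf hg =>
    obtain ⟨N, hN⟩ := hf
    obtain ⟨M, hM⟩ := hg
    refine ⟨max N M, fun d hd => ?_⟩
    obtain ⟨a, ha⟩ := hN d (le_trans (le_max_left _ _) hd)
    obtain ⟨b, hb⟩ := hM d (le_trans (le_max_right _ _) hd)
    exact ⟨a + b, by rw [map_add, ha, hb, mul_add]⟩
  | monomial k s =>
    obtain ⟨N, hN⟩ := D.exists_deh_eq s
    refine ⟨N, fun d hd => ?_⟩
    obtain ⟨a, ha, rfl⟩ := hN (d + k) (by omega)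
    exact ⟨a, by rw [D.toPoly_apply ha, Polynomial.X_pow_mul_monomial, add_comm]⟩

/-- If `R` embeds into `L` and `x_0` becomes invertible in `L`, then `R → S[X]` extends to an
embedding of `S[X]` into `L` with `X ↦ x_0`. -/
theorem exists_polyToQuot {L : Type*} [CommRing L] [Algebra K L] (f : R →ₐ[K] L)
    (hf : Function.Injective f) (hu : IsUnit (f (D.x 0))) :
    ∃ j : S[X] →ₐ[K] L, (∀ a, j (D.toPoly a) = f a) ∧ Function.Injective j := by
  obtain ⟨σ, hσ⟩ := D.exists_affineToQuot f hu
  let j : S[X] →ₐ[K] L :=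
    { Polynomial.eval₂RingHom σ.toRingHom (f (D.x 0)) with
      commutes' := fun k => by
        change Polynomial.eval₂ _ _ (algebraMap K S[X] k) = _
        rw [IsScalarTower.algebraMap_apply K S S[X], Polynomial.algebraMap_eq, Polynomial.eval₂_C]
        exact σ.commutes k }
  have hj : ∀ (k : ℕ) (s : S), j (Polynomial.monomial k s) = σ s * f (D.x 0) ^ k := fun k s =>
    Polynomial.eval₂_monomial _ _
  have h1 : ∀ a, j (D.toPoly a) = f a := by
    intro a
    induction a using D.homogeneous_induction with
    | h0 => simp
    | hadd a b ha hb => rw [map_add, map_add, ha, hb, map_add]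
    | h d a ha => rw [D.toPoly_apply ha, hj, hσ d a ha]
  refine ⟨j, h1, (injective_iff_map_eq_zero _).2 fun g hg => ?_⟩
  obtain ⟨N, hN⟩ := D.exists_toPoly_eq g
  obtain ⟨a, ha⟩ := hN N le_rfl
  have h2 : a = 0 := by
    apply hf
    rw [← h1, ha, map_mul, hg, mul_zero, map_zero]
  rw [h2, map_zero] at ha
  exact (Polynomial.monic_X_pow N).mul_right_eq_zero_iff.1 ha.symm

/-- `R` embeds into `S[X]`: the composition with `S[X] → R[1/x_0]` is injective. -/
theorem toPoly_injective : Function.Injective D.toPoly := by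
  let L := Localization.Away (D.x 0)
  have hinj : Function.Injective (IsScalarTower.toAlgHom K R L) :=
    IsLocalization.injective L (M := Submonoid.powers (D.x 0)) (Submonoid.powers_le.2 D.nzd)
  obtain ⟨j, hj, -⟩ := D.exists_polyToQuot (IsScalarTower.toAlgHom K R L) hinj
      (IsLocalization.Away.algebraMap_isUnit (D.x 0))
  refine Function.Injective.of_comp (f := j) ?_
  rwa [show j ∘ D.toPoly = IsScalarTower.toAlgHom K R L from funext hj]

/-! ### Finiteness of the affine coordinate ring and the regularity index -/

theorem nontrivial_affine (D : DehomSetup K R S n) [Nontrivial R] : Nontrivial S := by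
  refine ⟨1, 0, fun h => one_ne_zero (α := R) ?_⟩
  exact D.eq_zero_of_deh_eq_zero D.one_mem_grade (by rw [map_one, h])

/-- `x_0 - 1` is a non-zerodivisor, because its image `X - 1` in `S[X]` is monic. -/
theorem x_zero_sub_one_mem_nonZeroDivisors : D.x 0 - 1 ∈ nonZeroDivisors R := by
  rw [mem_nonZeroDivisors_iff_right]
  intro a ha
  apply D.toPoly_injective
  have h := congrArg D.toPoly ha
  rw [map_mul, map_sub, map_one, toPoly_x_zero, map_zero, mul_comm] at h
  rw [map_zero]
  exact (Polynomial.monic_X_sub_C (1 : S)).mul_right_eq_zero_iff.1 (by rw [map_one]; exact h)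

/-- The affine coordinate ring is zero-dimensional, hence a finite-dimensional vector space. -/
theorem finite_affine (D : DehomSetup K R S n) (hR : ringKrullDim R = 1) : Module.Finite K S := by
  have h := ringKrullDim_quotient_succ_le_of_nonZeroDivisor D.x_zero_sub_one_mem_nonZeroDivisors
  rw [hR] at h
  have hker : Ideal.span {D.x 0 - 1} ≤ RingHom.ker D.deh := by
    rw [Ideal.span_singleton_le_iff_mem, RingHom.mem_ker, map_sub, deh_x_zero, map_one, sub_self]
  have hS : ringKrullDim S ≤ ringKrullDim (R ⧸ Ideal.span {D.x 0 - 1}) :=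
    ringKrullDim_le_of_surjective (Ideal.Quotient.lift _ D.deh.toRingHom hker)
      (Ideal.Quotient.lift_surjective_of_surjective _ _ D.deh_surjective)
  have h0 : ringKrullDim S ≤ 0 := by
    refine hS.trans ?_
    have h2 : ringKrullDim (R ⧸ Ideal.span {D.x 0 - 1}) < ((1 : ℕ) : WithBot ℕ∞) :=
      ENat.WithBot.add_one_le_natCast_iff.1 (by simpa using h)
    simpa using (ENat.WithBot.lt_add_one_iff (m := 0)).1 (by simpa using h2)
  have : Algebra.FiniteType K S := Algebra.FiniteType.of_surjective (D.deh.comp D.π)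
    (D.deh_surjective.comp D.surjective)
  rw [Module.finite_iff_krullDimLE_zero]
  exact Ring.krullDimLE_iff.2 h0

end DehomSetup

end Dehomogenization

/-! ### Hilbert functions -/

theorem hilbertPoly_eq {h : ℤ → ℕ} {c : ℕ} (hc : ∀ᶠ i in Filter.atTop, h i = c) :
    hilbertPoly h = c := by
  have h1 : ∀ᶠ i in Filter.atTop, h i = hilbertPoly h :=
    Classical.epsilon_spec (p := fun c : ℕ => ∀ᶠ i in Filter.atTop, h i = c) ⟨c, hc⟩
  obtain ⟨i, hi, hi'⟩ := (h1.and hc).exists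
  exact hi.symm.trans hi'

theorem hilbertPoly_eq_of_forall_ge {h : ℤ → ℕ} {c : ℕ} {N : ℤ} (hc : ∀ i, N ≤ i → h i = c) :
    hilbertPoly h = c := hilbertPoly_eq (Filter.eventually_atTop.2 ⟨N, hc⟩)

/-- The hypothesis `0 ≤ N` covers a Hilbert function that is constant on `ℤ`, for which `regIndex`
is the junk value `0` of an infimum that is not attained. -/
theorem regIndex_le {h : ℤ → ℕ} {N : ℤ} (hN : 0 ≤ N) (hc : ∀ i, N ≤ i → h i = hilbertPoly h) :
    regIndex h ≤ N := by
  by_cases hb : BddBelow {i : ℤ | ∀ j, i ≤ j → h j = hilbertPoly h}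
  · exact csInf_le hb hc
  · rw [regIndex, Int.csInf_of_not_bddBelow hb]
    exact hN

namespace DehomSetup

variable {K R S : Type*} [Field K] {n : ℕ} [CommRing R] [Algebra K R] [CommRing S] [Algebra K S]
  (D : DehomSetup K R S n)

theorem deh_grade_injective (d : ℤ) :
    Function.Injective (D.deh.toLinearMap ∘ₗ (D.grade d).subtype) := fun a b h =>
  Subtype.ext (D.deh_injOn a.2 b.2 h)

theorem finite_grade [Module.Finite K S] (d : ℤ) : Module.Finite K (D.grade d) :=
  Module.Finite.of_injective _ (D.deh_grade_injective d)

/-- The regularity index of `R` is non-negative, and from there on every element of `S` is the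
dehomogenization of a homogeneous element. -/
theorem exists_regIndex [Nontrivial R] [Module.Finite K S] :
    ∃ r : ℕ, regIndex (hilbertFun D.grade) = r ∧
      ∀ d : ℕ, r ≤ d → ∀ s, ∃ a ∈ D.grade d, D.deh a = s := by
  have := D.nontrivial_affine
  have hfin := D.finite_grade
  -- the homogeneous components are eventually isomorphic to `S`
  obtain ⟨N, hN⟩ : ∃ N : ℕ, ∀ d : ℕ, N ≤ d → ∀ s, ∃ a ∈ D.grade d, D.deh a = s := by
    choose f hf using D.exists_deh_eq
    let b := Module.finBasis K S
    refine ⟨Finset.univ.sup fun i => f (b i), fun d hd s => ?_⟩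
    have : LinearMap.range (D.deh.toLinearMap ∘ₗ (D.grade d).subtype) = ⊤ := by
      rw [eq_top_iff, ← b.span_eq, Submodule.span_le]
      rintro _ ⟨i, rfl⟩
      obtain ⟨a, ha, h⟩ := hf (b i) d
        ((Finset.le_sup (f := fun i => f (b i)) (Finset.mem_univ i)).trans hd)
      exact ⟨⟨a, ha⟩, h⟩
    obtain ⟨a, ha⟩ := LinearMap.range_eq_top.1 this s
    exact ⟨a, a.2, ha⟩
  have hsurj : ∀ d : ℕ, (∀ s, ∃ a ∈ D.grade d, D.deh a = s) ↔
      hilbertFun D.grade d = Module.finrank K S := by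
    intro d
    have hinj := D.deh_grade_injective d
    constructor
    · intro h
      refine (LinearEquiv.ofBijective _ ⟨hinj, fun s => ?_⟩).finrank_eq
      obtain ⟨a, ha, h'⟩ := h s
      exact ⟨⟨a, ha⟩, h'⟩
    · intro h s
      have h1 := LinearMap.finrank_range_of_inj hinj
      have h2 := Submodule.eq_top_of_finrank_eq (h1.trans h)
      obtain ⟨a, ha⟩ := LinearMap.range_eq_top.1 h2 s
      exact ⟨a, a.2, ha⟩
  have hge : ∀ i : ℤ, (N : ℤ) ≤ i → hilbertFun D.grade i = Module.finrank K S := by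
    intro i hi
    lift i to ℕ using by omega
    exact (hsurj i).1 (hN i (by omega))
  have hHP : hilbertPoly (hilbertFun D.grade) = Module.finrank K S :=
    hilbertPoly_eq_of_forall_ge hge
  have hpos : 0 < Module.finrank K S := Module.finrank_pos
  have hlow : ∀ i ∈ {i : ℤ | ∀ j, i ≤ j →
      hilbertFun D.grade j = hilbertPoly (hilbertFun D.grade)}, 0 ≤ i := by
    intro i hi
    by_contra hneg
    have h1 := hi i le_rfl
    have h2 : D.grade i = ⊥ := by rw [grade, if_neg hneg]
    rw [hHP, hilbertFun, h2, finrank_bot] at h1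
    omega
  have hmem : regIndex (hilbertFun D.grade) ∈ {i : ℤ | ∀ j, i ≤ j →
      hilbertFun D.grade j = hilbertPoly (hilbertFun D.grade)} :=
    Int.csInf_mem ⟨N, fun j hj => (hge j hj).trans hHP.symm⟩ ⟨0, hlow⟩
  obtain ⟨r, hr⟩ := Int.eq_ofNat_of_zero_le (hlow _ hmem)
  refine ⟨r, hr, fun d hd => (hsurj d).2 ?_⟩
  rw [← hHP]
  exact hmem d (by omega)

/-! ### The truncated integral closure -/

section Closure

/-- A homogeneous non-zerodivisor of `R` becomes a non-zerodivisor, hence a unit, of the Artinian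
ring `S`. -/
theorem isUnit_deh [Module.Finite K S] {b : R} (hb : b ∈ nonZeroDivisors R) {f : ℤ}
    (hbf : b ∈ D.grade f) : IsUnit (D.deh b) := by
  have : IsArtinianRing S := IsArtinianRing.of_finite K S
  refine IsArtinianRing.isUnit_of_mem_nonZeroDivisors ?_
  rw [mem_nonZeroDivisors_iff_right]
  intro s hs
  obtain ⟨N, hN⟩ := D.exists_deh_eq s
  obtain ⟨a, ha, rfl⟩ := hN N le_rfl
  rw [← map_mul] at hs
  have h := D.eq_zero_of_deh_eq_zero (D.mul_mem_grade ha hbf) hs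
  rw [mem_nonZeroDivisors_iff_right] at hb
  rw [hb a h, map_zero]

variable (Q : Type*) [CommRing Q] [Algebra R Q] [Algebra K Q]

/-- The elements `a / b` of degree `d` of an `R`-algebra, with `a` and `b` homogeneous and `b` a
non-zerodivisor. -/
def fractions (d : ℤ) : Set Q :=
  {y | ∃ (e f : ℤ) (a b : R), a ∈ D.grade e ∧ b ∈ D.grade f ∧ b ∈ nonZeroDivisors R ∧
    e - f = d ∧ y * algebraMap R Q b = algebraMap R Q a}

variable {Q} [IsScalarTower K R Q] [Nontrivial R] [Module.Finite K S]

/-- If `R → Q` is injective and homogeneous non-zerodivisors become units in `Q`, then the subring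
generated by the fractions of non-negative degree is canonically isomorphic to `S[X]`. -/
theorem exists_closure_equiv (hinj : Function.Injective (algebraMap R Q))
    (hu : ∀ b ∈ nonZeroDivisors R, ∀ f, b ∈ D.grade f → IsUnit (algebraMap R Q b))
    (T : Subalgebra R Q) (hT : ∀ y, y ∈ T ↔
      y ∈ Subring.closure {y | ∃ d : ℤ, 0 ≤ d ∧ y ∈ Submodule.span K (D.fractions Q d)}) :
    ∃ θ : T ≃ₐ[K] S[X], (∀ a, θ (algebraMap R T a) = D.toPoly a) ∧
      (∀ (d : ℤ) (y : T), (y : Q) ∈ Submodule.span K (D.fractions Q d) ↔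
        θ y ∈ polyGrade K S d) ∧
      ∀ (y : T) (d : ℕ) (e f : ℤ) (a b : R), a ∈ D.grade e → b ∈ D.grade f →
        b ∈ nonZeroDivisors R → e - f = (d : ℤ) → y * algebraMap R T b = algebraMap R T a →
        θ y * Polynomial.C (D.deh b) = Polynomial.monomial d (D.deh a) := by
  obtain ⟨j, hj, hjinj⟩ := D.exists_polyToQuot (IsScalarTower.toAlgHom K R Q) hinj
    (hu _ D.nzd 1 (D.x_mem_grade 0))
  have hj : ∀ a, j (D.toPoly a) = algebraMap R Q a := hj
  have hneg : ∀ b ∈ nonZeroDivisors R, ∀ f, b ∈ D.grade f → 0 ≤ f := by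
    intro b hb f hbf
    by_contra h
    exact nonZeroDivisors.ne_zero hb (D.eq_zero_of_mem_grade_neg (by omega) hbf)
  -- fractions of degree `d ≥ 0` are the images of the monomials of degree `d`
  have hfrac : ∀ (d : ℕ) (y : Q), y ∈ D.fractions Q d → ∃ s, y = j (Polynomial.monomial d s) := by
    rintro d y ⟨e, f, a, b, ha, hb, hbn, hd, hy⟩
    have hf := hneg b hbn f hb
    lift f to ℕ using hf
    obtain rfl : e = ((d + f : ℕ) : ℤ) := by push_cast; omega
    obtain ⟨u, hub⟩ := D.isUnit_deh hbn hb
    refine ⟨D.deh a * (↑u⁻¹ : S), ?_⟩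
    apply (hu b hbn f hb).mul_right_cancel
    rw [hy, ← hj b, ← hj a, ← map_mul, D.toPoly_apply ha, D.toPoly_apply hb,
      Polynomial.monomial_mul_monomial, ← hub, mul_assoc, Units.inv_mul, mul_one]
  have hfrac' : ∀ (d : ℕ) (s : S), j (Polynomial.monomial d s) ∈ D.fractions Q d := by
    intro d s
    obtain ⟨N, hN⟩ := D.exists_deh_eq s
    obtain ⟨a, ha, rfl⟩ := hN (d + N) (by omega)
    refine ⟨(d + N : ℕ), N, a, D.x 0 ^ N, ha, D.x_pow_mem_grade 0 N, pow_mem D.nzd N,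
      by push_cast; ring, ?_⟩
    rw [← hj, ← hj, ← map_mul, D.toPoly_apply ha, map_pow, toPoly_x_zero,
      Polynomial.monomial_mul_X_pow]
  have hspan : ∀ (d : ℕ) (y : Q), y ∈ Submodule.span K (D.fractions Q d) ↔
      ∃ s, y = j (Polynomial.monomial d s) := by
    intro d y
    constructor
    · intro hy
      induction hy using Submodule.span_induction with
      | mem y hy => exact hfrac d y hy
      | zero => exact ⟨0, by simp⟩
      | add y z _ _ hy hz =>
        obtain ⟨s, rfl⟩ := hy
        obtain ⟨t, rfl⟩ := hz
        exact ⟨s + t, by rw [map_add, map_add]⟩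
      | smul c y _ hy =>
        obtain ⟨s, rfl⟩ := hy
        exact ⟨c • s, by rw [← Polynomial.smul_monomial, map_smul]⟩
    · rintro ⟨s, rfl⟩
      exact Submodule.subset_span (hfrac' d s)
  have hrange : ∀ y, y ∈ T ↔ ∃ g, j g = y := by
    intro y
    rw [hT]
    constructor
    · intro hy
      have : Subring.closure {y | ∃ d : ℤ, 0 ≤ d ∧ y ∈ Submodule.span K (D.fractions Q d)} ≤
          j.toRingHom.range := by
        rw [Subring.closure_le]
        rintro z ⟨d, hd, hz⟩
        lift d to ℕ using hd
        obtain ⟨s, rfl⟩ := (hspan d z).1 hz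
        exact ⟨_, rfl⟩
      exact this hy
    · rintro ⟨g, rfl⟩
      induction g using Polynomial.induction_on' with
      | add f g hf hg => rw [map_add]; exact add_mem hf hg
      | monomial d s =>
        exact Subring.subset_closure ⟨d, Int.natCast_nonneg d, (hspan d _).2 ⟨s, rfl⟩⟩
  let j' : S[X] →ₐ[K] T :=
    { toFun := fun g => ⟨j g, (hrange _).2 ⟨g, rfl⟩⟩
      map_one' := Subtype.ext (map_one j)
      map_mul' := fun g h => Subtype.ext (map_mul j g h)
      map_zero' := Subtype.ext (map_zero j)
      map_add' := fun g h => Subtype.ext (map_add j g h)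
      commutes' := fun k => Subtype.ext (j.commutes k) }
  have hj' : ∀ g, ((j' g : T) : Q) = j g := fun g => rfl
  have hbij : Function.Bijective j' := by
    refine ⟨fun g h hgh => hjinj (congrArg Subtype.val hgh), fun y => ?_⟩
    obtain ⟨g, hg⟩ := (hrange y).1 y.2
    exact ⟨g, Subtype.ext hg⟩
  let θ : T ≃ₐ[K] S[X] := (AlgEquiv.ofBijective j' hbij).symm
  have hθ : ∀ y : T, j (θ y) = y := fun y =>
    congrArg Subtype.val ((AlgEquiv.ofBijective j' hbij).apply_symm_apply y)
  refine ⟨θ, fun a => hjinj ?_, fun d y => ?_, ?_⟩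
  · rw [hθ, hj]; rfl
  · rcases lt_or_ge d 0 with hd | hd
    · have hzero : ∀ z : T, (z : Q) ∈ Submodule.span K (D.fractions Q d) → z = 0 := by
        intro z hz
        obtain ⟨k, hk⟩ : ∃ k : ℕ, d + (k + 1 : ℕ) = 0 := ⟨(-d - 1).toNat, by omega⟩
        -- multiplication by a power of `x_0` leads to degree zero
        have h1 : ∀ w ∈ Submodule.span K (D.fractions Q d),
            w * algebraMap R Q (D.x 0 ^ (k + 1)) ∈
              Submodule.span K (D.fractions Q ((0 : ℕ) : ℤ)) := by
          intro w hz
          induction hz using Submodule.span_induction with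
          | mem w hw =>
            obtain ⟨e, f, a, b, ha, hb, hbn, hd, hy⟩ := hw
            refine Submodule.subset_span ⟨e + (k + 1 : ℕ), f, a * D.x 0 ^ (k + 1), b,
              D.mul_mem_grade ha (D.x_pow_mem_grade 0 _), hb, hbn, by push_cast at *; omega, ?_⟩
            rw [mul_right_comm, hy, map_mul]
          | zero => rw [zero_mul]; exact zero_mem _
          | add u v _ _ hu hv => rw [add_mul]; exact add_mem hu hv
          | smul c u _ hu => rw [smul_mul_assoc]; exact Submodule.smul_mem _ _ hu
        obtain ⟨s, hs⟩ := (hspan 0 _).1 (h1 z hz)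
        rw [← hθ z, ← hj, ← map_mul, map_pow, toPoly_x_zero] at hs
        have h2 := hjinj hs
        have h3 : s = 0 := by
          have := congrArg (fun g => Polynomial.coeff g 0) h2
          simpa [pow_succ, ← mul_assoc] using this.symm
        rw [h3, map_zero] at h2
        have h4 : θ z = 0 := (Polynomial.monic_X_pow (k + 1)).mul_right_eq_zero_iff.1
          (by rw [mul_comm]; exact h2)
        exact (map_eq_zero_iff θ θ.injective).1 h4
      constructor
      · intro hy
        rw [hzero y hy, map_zero]; exact zero_mem _
      · intro hy
        rcases exists_of_mem_polyGrade hy with h | ⟨a, s, ha, -⟩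
        · rw [← hθ, h, map_zero]; exact zero_mem _
        · omega
    · lift d to ℕ using hd
      rw [hspan]
      constructor
      · rintro ⟨s, hs⟩
        rw [← hθ] at hs
        rw [hjinj hs]
        exact monomial_mem_polyGrade d s
      · intro hy
        rcases exists_of_mem_polyGrade hy with h | ⟨a, s, ha, h⟩
        · exact ⟨0, by rw [← hθ, h]; simp⟩
        · obtain rfl : a = d := by omega
          exact ⟨s, by rw [← hθ, h]⟩
  · intro y d e f a b ha hb hbn hd hy
    have hf := hneg b hbn f hb
    lift f to ℕ using hf
    obtain rfl : e = ((d + f : ℕ) : ℤ) := by push_cast; omega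
    have h1 : θ y * D.toPoly b = D.toPoly a := by
      apply hjinj
      rw [map_mul, hθ, hj, hj]
      exact congrArg Subtype.val hy
    rw [D.toPoly_apply ha, D.toPoly_apply hb, ← Polynomial.C_mul_X_pow_eq_monomial, ← mul_assoc,
      ← Polynomial.monomial_mul_X_pow] at h1
    exact (Polynomial.monic_X_pow f).isRegular.right h1

end Closure

end DehomSetup

/-! ### Algebras isomorphic to a polynomial ring -/

section Transport

variable {K : Type*} [Field K] {S B C A : Type*} [CommRing S] [Algebra K S] [CommRing B]
  [Algebra K B] [CommRing C] [Algebra K C] [CommRing A] [Algebra K A]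

theorem extMap_extMap (ψ : B →ₐ[K] C) (φ : A →ₐ[K] B) (w : FormsAlg K A) :
    extMap ψ (extMap φ w) = extMap (ψ.comp φ) w := by
  have : (extMap ψ).comp (extMap φ) = extMap (ψ.comp φ) :=
    formsAlg_hom_ext (fun a => by simp) (fun a => by simp)
  exact AlgHom.congr_fun this w

/-- The canonical splitting of the forms on an algebra `B ≅ S[X]`. -/
theorem exists_splitting (θ : B ≃ₐ[K] S[X]) {ℬ : ℤ → Submodule K B}
    (hℬ : ∀ d b, b ∈ ℬ d ↔ θ b ∈ polyGrade K S d) {m : ℕ} (hm : 1 ≤ m) :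
    ∃ Ψ : Forms K B m ≃ₗ[K] (K[X] ⊗[K] Forms K S m) × (K[X] ⊗[K] Forms K S (m - 1)),
      IsCanonicalSplitting (θ.symm.toAlgHom.comp Polynomial.CAlgHom) (θ.symm Polynomial.X) m Ψ ∧
      IsPolyLinear (θ.symm Polynomial.X) m Ψ ∧ IsGradedSplitting ℬ m Ψ := by
  obtain ⟨Ψ, h1, h2, h3⟩ := exists_polynomial_splitting (K := K) (S := S) hm
  have haeval : ∀ p : K[X], θ.symm (Polynomial.aeval (Polynomial.X : S[X]) p) =
      Polynomial.aeval (θ.symm Polynomial.X) p := fun p =>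
    (Polynomial.aeval_algHom_apply θ.symm.toAlgHom Polynomial.X p).symm
  refine ⟨(formsEquiv θ m).trans Ψ, ?_, ?_, ?_⟩
  · intro p q ω η
    have h4 : formsIncl K B m (((formsEquiv θ m).trans Ψ).symm (p ⊗ₜ[K] ω, q ⊗ₜ[K] η)) =
        extMap θ.symm.toAlgHom (splitMap K S m (p ⊗ₜ[K] ω, q ⊗ₜ[K] η)) := by
      rw [← h1, ← formsIncl_formsMap]
      rfl
    have hθ : ∀ f : S[X], θ.symm.toAlgHom f = θ.symm f := fun f => rfl
    rw [splitMap_tmul, map_add, extMap_smul, extMap_smul, map_mul, extMap_dForm, extMap_extMap,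
      extMap_extMap, hθ, hθ, hθ, haeval, haeval, ← formsIncl_formsMap, ← formsIncl_formsMap] at h4
    exact h4
  · intro p w
    have h4 : θ.toAlgHom (Polynomial.aeval (θ.symm Polynomial.X) p) =
        Polynomial.aeval (Polynomial.X : S[X]) p := by
      rw [← haeval]; exact θ.apply_symm_apply _
    have h5 : formsMap θ.toAlgHom m (Polynomial.aeval (θ.symm Polynomial.X) p • w) =
        Polynomial.aeval (Polynomial.X : S[X]) p • formsMap θ.toAlgHom m w := by
      rw [formsMap_smul, h4]
    exact (congrArg Ψ h5).trans (h2 p _)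
  · intro i
    rw [← h3 i, ← map_formsEquiv_formsGrade θ hℬ m i, ← Submodule.map_comp]
    rfl

end Transport

section Dimension

variable {K : Type*} [Field K] {V : Type*} [AddCommGroup V] [Module K V]

theorem monomialTensor_neg {i : ℤ} (hi : i < 0) : monomialTensor K V i = ⊥ := by
  rw [monomialTensor, Submodule.span_eq_bot]
  rintro _ ⟨a, v, ha, rfl⟩
  omega

theorem exists_monomialTensor_equiv (a : ℕ) : Nonempty (V ≃ₗ[K] monomialTensor K V a) := by
  let f : V →ₗ[K] K[X] ⊗[K] V := TensorProduct.mk K K[X] V (Polynomial.X ^ a)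
  have hf : Function.Injective f := by
    rw [injective_iff_map_eq_zero]
    intro v hv
    have h := DFunLike.congr_fun (congrArg (TensorProduct.equivFinsuppOfBasisLeft (N := V)
      (Polynomial.basisMonomials K)) hv) a
    change TensorProduct.equivFinsuppOfBasisLeft (N := V)
      (Polynomial.basisMonomials K) ((Polynomial.X ^ a) ⊗ₜ[K] v) a = _ at h
    rw [TensorProduct.equivFinsuppOfBasisLeft_apply_tmul_apply,
      ← Polynomial.monomial_one_right_eq_X_pow] at h
    simpa [Polynomial.basisMonomials] using h
  have hr : LinearMap.range f = monomialTensor K V a := by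
    apply le_antisymm
    · rintro _ ⟨v, rfl⟩
      exact Submodule.subset_span ⟨a, v, rfl, rfl⟩
    · refine Submodule.span_le.2 ?_
      rintro _ ⟨b, v, hb, rfl⟩
      obtain rfl : b = a := by omega
      exact ⟨v, rfl⟩
  exact ⟨(LinearEquiv.ofInjective f hf).trans (LinearEquiv.ofEq _ _ hr)⟩

theorem finite_monomialTensor [Module.Finite K V] (i : ℤ) :
    Module.Finite K (monomialTensor K V i) := by
  rcases lt_or_ge i 0 with hi | hi
  · rw [monomialTensor_neg hi]; infer_instance
  · lift i to ℕ using hi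
    obtain ⟨e⟩ := exists_monomialTensor_equiv (K := K) (V := V) i
    exact Module.Finite.equiv e

theorem finrank_monomialTensor {i : ℤ} (hi : 0 ≤ i) :
    Module.finrank K (monomialTensor K V i) = Module.finrank K V := by
  lift i to ℕ using hi
  obtain ⟨e⟩ := exists_monomialTensor_equiv (K := K) (V := V) i
  exact e.finrank_eq.symm

/-- A product of subspaces is isomorphic to their direct sum. -/
def submoduleProdEquiv {W : Type*} [AddCommGroup W] [Module K W] (P : Submodule K V)
    (Q : Submodule K W) : (P.prod Q : Submodule K (V × W)) ≃ₗ[K] P × Q where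
  toFun z := (⟨z.1.1, z.2.1⟩, ⟨z.1.2, z.2.2⟩)
  map_add' _ _ := rfl
  map_smul' _ _ := rfl
  invFun z := ⟨(z.1, z.2), z.1.2, z.2.2⟩
  left_inv _ := rfl
  right_inv _ := rfl

theorem finrank_submodule_prod {W : Type*} [AddCommGroup W] [Module K W] (P : Submodule K V)
    (Q : Submodule K W) [Module.Finite K P] [Module.Finite K Q] :
    Module.finrank K (P × Q) = Module.finrank K P + Module.finrank K Q := Module.finrank_prod

end Dimension

section FormsDimension

variable {K : Type*} [Field K] {S B : Type*} [CommRing S] [Algebra K S] [CommRing B]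
  [Algebra K B]

theorem finite_forms [Module.Finite K S] (m : ℕ) : Module.Finite K (Forms K S m) := by
  have : Algebra.FiniteType K S := inferInstance
  exact Module.Finite.trans S _

/-- The dimension of the homogeneous components of the forms on `B ≅ S[X]`. -/
theorem finrank_formsGrade_of_equiv [Module.Finite K S] (θ : B ≃ₐ[K] S[X])
    {ℬ : ℤ → Submodule K B} (hℬ : ∀ d b, b ∈ ℬ d ↔ θ b ∈ polyGrade K S d) {m : ℕ} (hm : 1 ≤ m)
    (i : ℤ) : Module.Finite K (formsGrade ℬ m i) ∧
      (1 ≤ i → hilbertFun (formsGrade ℬ m) i =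
        Module.finrank K (Forms K S m) + Module.finrank K (Forms K S (m - 1))) := by
  obtain ⟨Ψ, -, -, h⟩ := exists_splitting θ hℬ hm
  have := finite_forms (K := K) (S := S)
  have h1 := finite_monomialTensor (K := K) (V := Forms K S m) i
  have h2 := finite_monomialTensor (K := K) (V := Forms K S (m - 1)) (i - 1)
  let e := (Ψ.submoduleMap (formsGrade ℬ m i)).trans ((LinearEquiv.ofEq _ _ (h i)).trans
    (submoduleProdEquiv _ _))
  refine ⟨Module.Finite.equiv e.symm, fun hi => ?_⟩
  have h3 := finrank_submodule_prod (monomialTensor K (Forms K S m) i)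
    (monomialTensor K (Forms K S (m - 1)) (i - 1))
  rw [finrank_monomialTensor (by omega), finrank_monomialTensor (by omega)] at h3
  exact e.finrank_eq.trans h3

end FormsDimension

namespace DehomSetup

variable {K R S : Type*} [Field K] {n : ℕ} [CommRing R] [Algebra K R] [CommRing S] [Algebra K S]
  (D : DehomSetup K R S n)

/-! ### Forms on the homogeneous coordinate ring -/

theorem dForm_π (p : MvPolynomial (Fin (n + 1)) K) :
    (dForm (D.π p) : FormsAlg K R) = ∑ l, D.π (MvPolynomial.pderiv l p) • dForm (D.x l) := by
  induction p using MvPolynomial.induction_on with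
  | C c =>
    simp only [MvPolynomial.pderiv_C, map_zero, zero_smul, Finset.sum_const_zero]
    rw [show D.π (MvPolynomial.C c) = algebraMap K R c from D.π.commutes c, dForm,
      Derivation.map_algebraMap, map_zero]
  | add p q hp hq =>
    have : (dForm (D.π p + D.π q) : FormsAlg K R) = dForm (D.π p) + dForm (D.π q) := by
      simp [dForm]
    rw [map_add, this, hp, hq, ← Finset.sum_add_distrib]
    refine Finset.sum_congr rfl fun l _ => ?_
    rw [map_add, map_add, add_smul]
  | mul_X p i hp =>
    have h : ∀ l, D.π (MvPolynomial.pderiv l (p * MvPolynomial.X i)) =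
        D.π p * (if i = l then 1 else 0) + D.x i * D.π (MvPolynomial.pderiv l p) := by
      intro l
      rw [MvPolynomial.pderiv_mul, MvPolynomial.pderiv_X, map_add, map_mul, map_mul, x]
      by_cases hil : i = l
      · subst hil; simp; ring
      · rw [Pi.single_eq_of_ne hil, if_neg hil]; simp; ring
    rw [map_mul, dForm_mul, hp]
    simp_rw [h, add_smul, Finset.sum_add_distrib, mul_smul]
    congr 1
    · simp [x]
    · rw [Finset.smul_sum]; rfl

/-- The form `dx_{J_1} ∧ ⋯ ∧ dx_{J_m}`. -/
def xProd {m : ℕ} (J : Fin m → Fin (n + 1)) : FormsAlg K R := dProd fun j => D.x (J j)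

theorem dForm_mul_xProd {m : ℕ} (l : Fin (n + 1)) (J : Fin m → Fin (n + 1)) :
    dForm (D.x l) * D.xProd J = D.xProd (Fin.cons l J : Fin (m + 1) → Fin (n + 1)) := by
  rw [xProd, xProd, dProd_succ]
  rfl

/-- The span of the forms `a dx_{J_1} ∧ ⋯ ∧ dx_{J_m}` with `a` homogeneous of degree `k`. -/
def xSpan (m : ℕ) (k : ℤ) : Submodule K (FormsAlg K R) :=
  Submodule.span K {w | ∃ (a : R) (J : Fin m → Fin (n + 1)), a ∈ D.grade k ∧ w = a • D.xProd J}

theorem smul_mem_xSpan {m : ℕ} {d k j : ℤ} {a : R} (ha : a ∈ D.grade d) {w : FormsAlg K R}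
    (hw : w ∈ D.xSpan m k) (hj : d + k = j) : a • w ∈ D.xSpan m j := by
  subst hj
  induction hw using Submodule.span_induction with
  | mem w hw =>
    obtain ⟨b, J, hb, rfl⟩ := hw
    exact Submodule.subset_span ⟨a * b, J, D.mul_mem_grade ha hb, (mul_smul _ _ _).symm⟩
  | zero => rw [smul_zero]; exact zero_mem _
  | add u v _ _ hu hv => rw [smul_add]; exact add_mem hu hv
  | smul c u _ hu => rw [smul_comm]; exact Submodule.smul_mem _ _ hu

theorem π_pderiv_mem_grade {d : ℕ} {p : MvPolynomial (Fin (n + 1)) K} (hp : p.IsHomogeneous d)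
    (l : Fin (n + 1)) : D.π (MvPolynomial.pderiv l p) ∈ D.grade ((d : ℤ) - 1) := by
  cases d with
  | zero =>
    rw [MvPolynomial.totalDegree_eq_zero_iff_eq_C.1 (Nat.le_zero.1 hp.totalDegree_le),
      MvPolynomial.pderiv_C, map_zero]
    exact zero_mem _
  | succ d =>
    have := D.π_mem_grade (hp.pderiv (i := l))
    rwa [Nat.add_sub_cancel, show (d : ℤ) = ((d + 1 : ℕ) : ℤ) - 1 by push_cast; ring] at this

theorem dForm_mul_mem_xSpan {m : ℕ} {d k j : ℤ} {b : R} (hb : b ∈ D.grade d) {w : FormsAlg K R}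
    (hw : w ∈ D.xSpan m k) (hj : d - 1 + k = j) : dForm b * w ∈ D.xSpan (m + 1) j := by
  subst hj
  rcases lt_or_ge d 0 with hd | hd
  · rw [D.eq_zero_of_mem_grade_neg hd hb, dForm, map_zero, map_zero, zero_mul]
    exact zero_mem _
  lift d to ℕ using hd
  obtain ⟨p, hp, rfl⟩ := D.mem_grade_natCast.1 hb
  have h1 : ∀ l, dForm (D.x l) * w ∈ D.xSpan (m + 1) k := by
    intro l
    induction hw using Submodule.span_induction with
    | mem w hw =>
      obtain ⟨b, J, hb, rfl⟩ := hw
      rw [mul_smul_comm, dForm_mul_xProd]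
      exact Submodule.subset_span ⟨b, _, hb, rfl⟩
    | zero => rw [mul_zero]; exact zero_mem _
    | add u v _ _ hu hv => rw [mul_add]; exact add_mem hu hv
    | smul c u _ hu => rw [mul_smul_comm]; exact Submodule.smul_mem _ _ hu
  rw [dForm_π, Finset.sum_mul]
  refine sum_mem fun l _ => ?_
  rw [smul_mul_assoc]
  exact D.smul_mem_xSpan (D.π_pderiv_mem_grade hp l) (h1 l) rfl

/-- The forms of degree `i` are spanned by the forms `a dx_{J_1} ∧ ⋯ ∧ dx_{J_m}` with `a` of
degree `i - m`. -/
theorem map_formsGrade_eq_xSpan (m : ℕ) (i : ℤ) :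
    (formsGrade D.grade m i).map (formsIncl K R m) = D.xSpan m (i - m) := by
  apply le_antisymm
  · rw [Submodule.map_le_iff_le_comap, formsGrade, Submodule.span_le]
    rintro _ ⟨e₀, e, a, b, ha, hb, rfl, rfl⟩
    change formsIncl K R m _ ∈ D.xSpan m _
    rw [formsIncl_ιMulti]
    refine D.smul_mem_xSpan (k := ∑ j, e j - m) ha ?_ (by ring)
    clear ha
    induction m with
    | zero =>
      exact Submodule.subset_span ⟨1, Fin.elim0, by simpa using D.one_mem_grade,
        by rw [xProd, dProd_zero, dProd_zero, one_smul]⟩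
    | succ m ih =>
      rw [dProd_succ]
      exact D.dForm_mul_mem_xSpan (hb 0) (ih (fun j => e j.succ) _ fun j => hb j.succ)
        (by rw [Fin.sum_univ_succ]; push_cast; ring)
  · refine Submodule.span_le.2 ?_
    rintro _ ⟨a, J, ha, rfl⟩
    exact ⟨_, Submodule.subset_span ⟨i - m, fun _ => 1, a, fun j => D.x (J j), ha,
      fun j => D.x_mem_grade _, by simp, rfl⟩, rfl⟩

theorem finite_formsGrade [Module.Finite K S] (m : ℕ) (i : ℤ) :
    Module.Finite K (formsGrade D.grade m i) := by
  have hfin := D.finite_grade (i - m)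
  -- the forms of degree `i` are the image of finitely many copies of `R_{i-m}`
  let f : ((Fin m → Fin (n + 1)) → D.grade (i - m)) →ₗ[K] FormsAlg K R :=
    ∑ J, (LinearMap.toSpanSingleton R (FormsAlg K R) (D.xProd J)).restrictScalars K ∘ₗ
      (D.grade (i - m)).subtype ∘ₗ LinearMap.proj J
  have hle : D.xSpan m (i - m) ≤ LinearMap.range f := by
    refine Submodule.span_le.2 ?_
    rintro _ ⟨a, J, ha, rfl⟩
    refine ⟨Pi.single J ⟨a, ha⟩, ?_⟩
    simp only [f, LinearMap.sum_apply, LinearMap.comp_apply, LinearMap.proj_apply]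
    rw [Finset.sum_eq_single J]
    · simp
    · intro J' _ hJ'
      rw [Pi.single_eq_of_ne hJ']
      simp
    · simp
  have h1 : Module.Finite K (LinearMap.range f) := inferInstance
  have h2 : Module.Finite K (D.xSpan m (i - m)) := Submodule.finiteDimensional_of_le hle
  rw [← map_formsGrade_eq_xSpan] at h2
  exact Module.Finite.equiv
    (Submodule.equivMapOfInjective (formsIncl K R m) (formsIncl_injective m) _).symm

/-! ### Surjectivity in high degrees -/

theorem adjoin_deh_x : Algebra.adjoin K (Set.range fun j => D.deh (D.x j)) = ⊤ := by
  rw [Algebra.adjoin_range_eq_range_aeval, AlgHom.range_eq_top]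
  intro s
  obtain ⟨p, rfl⟩ := (D.deh_surjective.comp D.surjective) s
  exact ⟨p, D.aeval_map_x D.deh p⟩

/-- The forms `s dx_{J_1} ∧ ⋯ ∧ dx_{J_m}` on `S[X]` with `s ∈ S`, where `x_j` stands for its image
`x_j^deh X` in `S[X]`. -/
def constSpan (m : ℕ) : Submodule K (FormsAlg K S[X]) :=
  Submodule.span K {w | ∃ (s : S) (J : Fin m → Fin (n + 1)),
    w = constHom K S s • extMap D.toPoly (D.xProd J)}

theorem smul_mem_constSpan {m : ℕ} (s : S) {w : FormsAlg K S[X]} (hw : w ∈ D.constSpan m) :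
    constHom K S s • w ∈ D.constSpan m := by
  induction hw using Submodule.span_induction with
  | mem w hw =>
    obtain ⟨t, J, rfl⟩ := hw
    exact Submodule.subset_span ⟨s * t, J, by rw [map_mul, mul_smul]⟩
  | zero => rw [smul_zero]; exact zero_mem _
  | add u v _ _ hu hv => rw [smul_add]; exact add_mem hu hv
  | smul c u _ hu => rw [smul_comm]; exact Submodule.smul_mem _ _ hu

theorem dForm_toPoly_mul_mem_constSpan {m : ℕ} (l : Fin (n + 1)) {w : FormsAlg K S[X]}
    (hw : w ∈ D.constSpan m) : dForm (D.toPoly (D.x l)) * w ∈ D.constSpan (m + 1) := by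
  induction hw using Submodule.span_induction with
  | mem w hw =>
    obtain ⟨t, J, rfl⟩ := hw
    refine Submodule.subset_span ⟨t, Fin.cons l J, ?_⟩
    rw [← dForm_mul_xProd, map_mul, extMap_dForm, mul_smul_comm]
  | zero => rw [mul_zero]; exact zero_mem _
  | add u v _ _ hu hv => rw [mul_add]; exact add_mem hu hv
  | smul c u _ hu => rw [mul_smul_comm]; exact Submodule.smul_mem _ _ hu

theorem dForm_X_mul_mem_constSpan {m : ℕ} {w : FormsAlg K S[X]}
    (hw : w ∈ D.constSpan m) : dForm (Polynomial.X : S[X]) * w ∈ D.constSpan (m + 1) := by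
  have := D.dForm_toPoly_mul_mem_constSpan 0 hw
  rwa [toPoly_x_zero] at this

/-- As `X dx_l^deh = dx_l - x_l^deh dX`, a power of `X` turns forms on `S` into combinations of
the forms `dx_{J_1} ∧ ⋯ ∧ dx_{J_m}`. -/
theorem X_pow_smul_mem_constSpan (m : ℕ) (ω : Forms K S m) :
    (Polynomial.X ^ m : S[X]) • extMap (constHom K S) (formsIncl K S m ω) ∈ D.constSpan m := by
  have hstep : ∀ (k : ℕ) (l : Fin (n + 1)), ∀ w ∈ D.constSpan k,
      (Polynomial.X : S[X]) • (dForm (constHom K S (D.deh (D.x l))) * w) ∈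
        D.constSpan (k + 1) := by
    intro k l w hw
    have h1 : (dForm (D.toPoly (D.x l)) : FormsAlg K S[X]) =
        constHom K S (D.deh (D.x l)) • dForm (Polynomial.X : S[X]) +
          (Polynomial.X : S[X]) • dForm (constHom K S (D.deh (D.x l))) := by
      rw [← dForm_mul, D.toPoly_apply (d := 1) (D.x_mem_grade l),
        ← Polynomial.C_mul_X_pow_eq_monomial, pow_one]
      rfl
    rw [← smul_mul_assoc, ← sub_eq_of_eq_add' h1, sub_mul, smul_mul_assoc]
    exact sub_mem (D.dForm_toPoly_mul_mem_constSpan l hw)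
      (D.smul_mem_constSpan _ (D.dForm_X_mul_mem_constSpan hw))
  have hprod : ∀ (k : ℕ) (J : Fin k → Fin (n + 1)),
      (Polynomial.X ^ k : S[X]) •
        dProd (K := K) (fun j => constHom K S (D.deh (D.x (J j)))) ∈ D.constSpan k := by
    intro k
    induction k with
    | zero =>
      intro J
      refine Submodule.subset_span ⟨1, Fin.elim0, ?_⟩
      rw [xProd, dProd_zero, dProd_zero, map_one, map_one, pow_zero]
    | succ k ih =>
      intro J
      rw [dProd_succ, pow_succ', mul_smul, ← mul_smul_comm]
      exact hstep k _ _ (ih fun j => J j.succ)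
  have hω := (forms_span_of_adjoin D.adjoin_deh_x m).ge (Submodule.mem_top (x := ω))
  induction hω using Submodule.span_induction with
  | mem w hw =>
    obtain ⟨s, J, rfl⟩ := hw
    rw [formsIncl_ιMulti, extMap_smul, extMap_dProd, smul_comm]
    exact D.smul_mem_constSpan s (hprod m J)
  | zero => rw [map_zero, map_zero, smul_zero]; exact zero_mem _
  | add u v _ _ hu hv => rw [map_add, map_add, smul_add]; exact add_mem hu hv
  | smul c u _ hu => rw [map_smul, map_smul, smul_comm]; exact Submodule.smul_mem _ _ hu

/-- In degrees `i ≥ r + m`, every form on `S[X]` comes from a form on `R`. -/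
theorem exists_formsMap_toPoly_eq {r : ℕ}
    (hr : ∀ d : ℕ, r ≤ d → ∀ s, ∃ a ∈ D.grade d, D.deh a = s) {m : ℕ} {i : ℤ}
    (hi : (r : ℤ) + m ≤ i) {w : Forms K S[X] m} (hw : w ∈ formsGrade (polyGrade K S) m i) :
    ∃ v ∈ formsGrade D.grade m i, formsMap D.toPoly m v = w := by
  obtain ⟨k, rfl⟩ : ∃ k : ℕ, i = k + m := ⟨(i - m).toNat, by omega⟩
  have hrk : r ≤ k := by omega
  have h1 : ∀ u ∈ D.constSpan m, (Polynomial.X ^ k : S[X]) • u ∈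
      (D.xSpan m k).map (extMap D.toPoly).toLinearMap := by
    intro u hu
    induction hu using Submodule.span_induction with
    | mem u hu =>
      obtain ⟨s, J, rfl⟩ := hu
      obtain ⟨a, ha, rfl⟩ := hr k hrk s
      refine ⟨a • D.xProd J, Submodule.subset_span ⟨a, J, ha, rfl⟩, ?_⟩
      rw [AlgHom.toLinearMap_apply, extMap_smul, smul_smul, D.toPoly_apply ha,
        ← Polynomial.C_mul_X_pow_eq_monomial, mul_comm]
      rfl
    | zero => rw [smul_zero]; exact zero_mem _
    | add u v _ _ hu hv => rw [smul_add]; exact add_mem hu hv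
    | smul c u _ hu => rw [smul_comm]; exact Submodule.smul_mem _ _ hu
  have h2 : splitGrade K S m (k + m) ≤ (D.xSpan m k).map (extMap D.toPoly).toLinearMap := by
    refine Submodule.span_le.2 ?_
    rintro _ (⟨a, ω, ha, rfl⟩ | ⟨a, m', η, ha, rfl, rfl⟩)
    · obtain rfl : a = k + m := by omega
      rw [pow_add, mul_smul]
      exact h1 _ (D.X_pow_smul_mem_constSpan m ω)
    · obtain rfl : a = k + m' := by push_cast at ha; omega
      rw [pow_add, mul_smul, ← mul_smul_comm]
      exact h1 _ (D.dForm_X_mul_mem_constSpan (D.X_pow_smul_mem_constSpan m' η))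
  rw [splitGrade_eq_map_formsGrade] at h2
  obtain ⟨u, hu, hu'⟩ := h2 ⟨w, hw, rfl⟩
  have h3 := D.map_formsGrade_eq_xSpan m (k + m)
  rw [add_sub_cancel_right] at h3
  rw [← h3] at hu
  obtain ⟨v, hv, rfl⟩ := hu
  exact ⟨v, hv, formsIncl_injective m (by rw [formsIncl_formsMap]; exact hu')⟩

end DehomSetup

/-! ### Injectivity in high degrees -/

open Pointwise in
/-- The quotient of an algebra by the two-sided ideal generated by a set. -/
theorem exists_quotient_by_generators.{u, v} {S : Type u} {E : Type v} [CommRing S] [Ring E]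
    [Algebra S E]
    (s : Set E) : ∃ (Q : Type v) (_ : Ring Q) (_ : Algebra S Q) (q : E →ₐ[S] Q),
      ∀ a, q a = 0 ↔ a ∈ AddSubgroup.closure {x | ∃ z ∈ s, ∃ b c, x = b * z * c} := by
  let T := TwoSidedIdeal.span s
  refine ⟨T.ringCon.Quotient, inferInstance, inferInstance, T.ringCon.mkₐ S, fun a => ?_⟩
  have h1 : T.ringCon.mkₐ S a = 0 ↔ a ∈ T := by
    rw [TwoSidedIdeal.mem_iff]
    exact RingCon.eq T.ringCon
  rw [h1, TwoSidedIdeal.mem_span_iff_mem_addSubgroup_closure]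
  have h2 : (Set.univ : Set E) * s * Set.univ = {x | ∃ z ∈ s, ∃ b c, x = b * z * c} := by
    ext x
    simp only [Set.mem_mul, Set.mem_univ, true_and, Set.mem_ofPred_eq]
    constructor
    · rintro ⟨_, ⟨b, z, hz, rfl⟩, c, rfl⟩
      exact ⟨z, hz, b, c, rfl⟩
    · rintro ⟨z, hz, b, c, rfl⟩
      exact ⟨_, ⟨b, z, hz, rfl⟩, c, rfl⟩
  rw [h2]

/-- The exterior algebra of `K^{n+1}`. -/
abbrev WedgeAlg (K : Type*) [Field K] (n : ℕ) : Type _ := ExteriorAlgebra K (Fin (n + 1) → K)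

/-- The standard basis vectors `e_j` in the exterior algebra of `K^{n+1}`. -/
def wedgeGen (K : Type*) [Field K] {n : ℕ} (j : Fin (n + 1)) : WedgeAlg K n :=
  ExteriorAlgebra.ι K (Pi.single j 1)

theorem sum_tmul_wedgeGen_sq {K S : Type*} [Field K] {n : ℕ} [CommRing S] [Algebra K S]
    (v : Fin (n + 1) → S) :
    (∑ j, v j ⊗ₜ[K] wedgeGen K j) * (∑ j, v j ⊗ₜ[K] wedgeGen K j) = 0 := by
  rw [Finset.sum_mul_sum, ← Finset.sum_product']
  simp only [Algebra.TensorProduct.tmul_mul_tmul]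
  refine Finset.sum_involution (fun p _ => p.swap) ?_ ?_ ?_ ?_
  · rintro ⟨i, j⟩ -
    simp only [Prod.fst_swap, Prod.snd_swap]
    rw [mul_comm (v j), ← TensorProduct.tmul_add, wedgeGen, wedgeGen,
      ExteriorAlgebra.ι_add_mul_swap, TensorProduct.tmul_zero]
  · rintro ⟨i, j⟩ - h h'
    apply h
    obtain rfl : j = i := congrArg Prod.fst h'
    simp only [wedgeGen]
    rw [ExteriorAlgebra.ι_sq_zero, TensorProduct.tmul_zero]
  · simp
  · simp

namespace DehomSetup

variable {K R S : Type*} [Field K] {n : ℕ} [CommRing R] [Algebra K R] [CommRing S] [Algebra K S]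
  (D : DehomSetup K R S n)

/-- The ideal of relations of `R` is generated by homogeneous elements of degree at most
`r + 1`. -/
theorem mem_span_of_π_eq_zero {r : ℕ}
    (hr : ∀ d : ℕ, r ≤ d → ∀ s, ∃ a ∈ D.grade d, D.deh a = s)
    {p : MvPolynomial (Fin (n + 1)) K} (hp : D.π p = 0) :
    p ∈ Ideal.span {g | D.π g = 0 ∧ ∃ d ≤ r + 1, g.IsHomogeneous d} := by
  set J := Ideal.span {g | D.π g = 0 ∧ ∃ d ≤ r + 1, g.IsHomogeneous d} with hJ
  have hJπ : ∀ f ∈ J, D.π f = 0 := by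
    have : J ≤ RingHom.ker D.π := Ideal.span_le.2 fun g hg => hg.1
    exact this
  -- modulo `J`, a polynomial of degree `r + e` is a multiple of `X_0 ^ e`
  have hmon : ∀ (e : ℕ) (α : Fin (n + 1) →₀ ℕ), ∑ i, α i = r + e →
      ∃ q : MvPolynomial (Fin (n + 1)) K, q.IsHomogeneous r ∧
        MvPolynomial.monomial α 1 - MvPolynomial.X 0 ^ e * q ∈ J := by
    intro e
    induction e with
    | zero =>
      intro α hα
      refine ⟨MvPolynomial.monomial α 1, MvPolynomial.isHomogeneous_monomial _ ?_, by simp⟩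
      rw [Finsupp.degree_eq_sum, hα, add_zero]
    | succ e ih =>
      intro α hα
      obtain ⟨j, hj⟩ : ∃ j, α j ≠ 0 := by
        by_contra! h
        simp [h] at hα
      have hle : Finsupp.single j 1 ≤ α :=
        Finsupp.single_le_iff.2 (Nat.one_le_iff_ne_zero.2 hj)
      obtain ⟨β, rfl⟩ := exists_add_of_le hle
      obtain ⟨q, hq, hqJ⟩ := ih β (by
        simp only [Finsupp.add_apply, Finset.sum_add_distrib, Finsupp.single_apply] at hα
        simp at hα; omega)
      obtain ⟨a, ha, hdeh⟩ := hr r le_rfl (D.deh (D.x j * D.π q))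
      obtain ⟨q', hq', rfl⟩ := D.mem_grade_natCast.1 ha
      have hrel : D.π (MvPolynomial.X j * q - MvPolynomial.X 0 * q') = 0 := by
        rw [map_sub, map_mul, map_mul, sub_eq_zero]
        refine D.deh_injOn (D.mul_mem_grade (D.x_mem_grade j) (D.π_mem_grade hq))
          (D.mul_mem_grade (D.x_mem_grade 0) ha) ?_
        rw [map_mul D.deh (D.π (MvPolynomial.X 0)), D.deh_x0, one_mul, hdeh]
        rfl
      have hrelJ : MvPolynomial.X j * q - MvPolynomial.X 0 * q' ∈ J := by
        refine Ideal.subset_span ⟨hrel, r + 1, le_rfl, ?_⟩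
        have h1 := ((MvPolynomial.isHomogeneous_X K j).mul hq).sub
          ((MvPolynomial.isHomogeneous_X K 0).mul hq')
        rwa [Nat.add_comm 1 r] at h1
      refine ⟨q', hq', ?_⟩
      have := add_mem (J.mul_mem_left (MvPolynomial.X j) hqJ)
        (J.mul_mem_left (MvPolynomial.X 0 ^ e) hrelJ)
      convert this using 1
      rw [show MvPolynomial.monomial (Finsupp.single j 1 + β) (1 : K) =
        MvPolynomial.X j * MvPolynomial.monomial β 1 by
          rw [MvPolynomial.X, MvPolynomial.monomial_mul, one_mul]]
      ring
  have hhom : ∀ (e : ℕ) (p : MvPolynomial (Fin (n + 1)) K), p.IsHomogeneous (r + e) →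
      ∃ q : MvPolynomial (Fin (n + 1)) K, q.IsHomogeneous r ∧
        p - MvPolynomial.X 0 ^ e * q ∈ J := by
    intro e p hp
    have hα : ∀ α ∈ p.support, ∑ i, α i = r + e := fun α hα =>
      sum_exponents_of_isHomogeneous hp hα
    choose! q hq hqJ using hmon e
    refine ⟨∑ α ∈ p.support, MvPolynomial.C (p.coeff α) * q α,
      MvPolynomial.IsHomogeneous.sum _ _ _ fun α hα' => ?_, ?_⟩
    · rw [← zero_add r]
      exact (MvPolynomial.isHomogeneous_C _ _).mul (hq α (hα α hα'))
    · have h1 : p - MvPolynomial.X 0 ^ e * ∑ α ∈ p.support, MvPolynomial.C (p.coeff α) * q α =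
          ∑ α ∈ p.support, MvPolynomial.C (p.coeff α) *
            (MvPolynomial.monomial α 1 - MvPolynomial.X 0 ^ e * q α) := by
        rw [Finset.mul_sum]
        nth_rewrite 1 [p.as_sum]
        rw [← Finset.sum_sub_distrib]
        refine Finset.sum_congr rfl fun α _ => ?_
        rw [mul_sub, MvPolynomial.C_mul_monomial, mul_one]
        ring
      rw [h1]
      exact sum_mem fun α hα' => J.mul_mem_left _ (hqJ α (hα α hα'))
  have hker : ∀ (d : ℕ) (p : MvPolynomial (Fin (n + 1)) K), p.IsHomogeneous d → D.π p = 0 →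
      p ∈ J := by
    intro d p hpd hp
    rcases le_or_gt d (r + 1) with hd | hd
    · exact Ideal.subset_span ⟨hp, d, hd, hpd⟩
    obtain ⟨e, rfl⟩ := Nat.exists_eq_add_of_le (show r ≤ d by omega)
    obtain ⟨q, hq, hqJ⟩ := hhom e p hpd
    have h1 : D.π q = 0 := by
      have h2 := hJπ _ hqJ
      rw [map_sub, hp, zero_sub, neg_eq_zero, map_mul, map_pow, mul_comm] at h2
      exact (mem_nonZeroDivisors_iff_right.1 (pow_mem D.nzd e)) _ h2
    have h3 : q ∈ J := Ideal.subset_span ⟨h1, r, by omega, hq⟩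
    have h4 := add_mem hqJ (J.mul_mem_left (MvPolynomial.X 0 ^ e) h3)
    rwa [sub_add_cancel] at h4
  rw [← MvPolynomial.sum_homogeneousComponent p]
  exact sum_mem fun i _ => hker i _ (MvPolynomial.homogeneousComponent_isHomogeneous i p)
    (D.homogeneous p hp i)

/-- A derivation of `R` with values in a module over `S` extends to `S[X]` if multiplication by
`X ^ r` maps `S[X]` into `R`. This is stated for the induced homomorphisms of algebras of forms:
under the hypotheses, the homomorphism determined by `f ↦ f^deh` and `da ↦ δ a` factors through
the algebra of forms of `S[X]`. -/
theorem exists_lift_of_derivation {r : ℕ}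
    (hr : ∀ d : ℕ, r ≤ d → ∀ s, ∃ a ∈ D.grade d, D.deh a = s)
    {Q V : Type*} [Ring Q] [Algebra K Q] [Algebra S Q] [IsScalarTower K S Q] [AddCommGroup V]
    [Module S V] (f : V →ₗ[S] Q) (hf : ∀ v, f v * f v = 0) (δ : R →ₗ[K] Q)
    (hδ : ∀ a b, δ (a * b) = D.deh a • δ b + D.deh b • δ a) (hv : ∀ a, ∃ v, δ a = f v) :
    ∃ L : FormsAlg K S[X] →ₐ[K] Q,
      (∀ a, L (extMap D.toPoly (algebraMap _ _ a)) = algebraMap S Q (D.deh a)) ∧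
      ∀ a, L (extMap D.toPoly (dForm a)) = δ a := by
  -- `κ` is multiplication by `X ^ r`, as a map from `S[X]` to `R`
  have hκ : ∃ κ : S[X] →ₗ[K] R, ∀ y, D.toPoly (κ y) = Polynomial.X ^ r * y := by
    let e := LinearEquiv.ofInjective D.toPoly.toLinearMap D.toPoly_injective
    have hmem : ∀ y, LinearMap.mulLeft K (Polynomial.X ^ r : S[X]) y ∈
        LinearMap.range D.toPoly.toLinearMap := by
      intro y
      induction y using Polynomial.induction_on' with
      | add y z hy hz => rw [map_add]; exact add_mem hy hz
      | monomial i s =>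
        obtain ⟨a, ha, rfl⟩ := hr (r + i) (by omega) s
        refine ⟨a, ?_⟩
        rw [AlgHom.toLinearMap_apply, D.toPoly_apply ha, LinearMap.mulLeft_apply, add_comm,
          Polynomial.X_pow_mul_monomial]
    refine ⟨e.symm.toLinearMap ∘ₗ LinearMap.codRestrict _ _ hmem, fun y => ?_⟩
    exact congrArg Subtype.val (e.apply_symm_apply (⟨_, hmem y⟩))
  obtain ⟨κ, hκ⟩ := hκ
  have hdehκ : ∀ y, D.deh (κ y) = y.eval 1 := fun y => by
    rw [← D.eval_toPoly, hκ, Polynomial.eval_mul, Polynomial.eval_pow, Polynomial.eval_X, one_pow,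
      one_mul]
  have hκ1 : ∀ a, κ (D.toPoly a) = D.x 0 ^ r * a := fun a => by
    apply D.toPoly_injective
    rw [hκ, map_mul, map_pow, toPoly_x_zero]
  have hκmul : ∀ y z, κ y * κ z = D.x 0 ^ r * κ (y * z) := fun y z => by
    apply D.toPoly_injective
    rw [map_mul, map_mul, hκ, hκ, hκ, map_pow, toPoly_x_zero]
    ring
  let ev : S[X] →ₐ[K] S := (Polynomial.aeval (1 : S)).restrictScalars K
  have hev : ∀ y, ev y = y.eval 1 := fun y => Polynomial.coe_aeval_eq_eval (1 : S) ▸ rfl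
  have hx : D.deh (D.x 0 ^ r) = 1 := by rw [map_pow, deh_x_zero, one_pow]
  -- the extension is `y ↦ δ (X ^ r y) - y(1) δ (x_0 ^ r)`, by the product rule for `δ (x_0 ^ r a)`
  let d : S[X] →ₗ[K] Q := δ ∘ₗ κ -
    (LinearMap.toSpanSingleton S Q (δ (D.x 0 ^ r))).restrictScalars K ∘ₗ ev.toLinearMap
  have hd : ∀ y, d y = δ (κ y) - y.eval 1 • δ (D.x 0 ^ r) := fun y => by
    rw [← hev]; rfl
  obtain ⟨L, hL1, hL2⟩ := exists_formsLift (((Algebra.ofId S Q).restrictScalars K).comp ev) d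
    (fun a q => Algebra.commutes (ev a) q) (fun y z => by
      have h1 := congrArg δ (hκmul y z)
      rw [hδ, hδ, hdehκ, hdehκ, hdehκ, hx, one_smul] at h1
      change d (y * z) = algebraMap S Q (ev y) * d z + algebraMap S Q (ev z) * d y
      rw [← Algebra.smul_def, ← Algebra.smul_def, hd, hd, hd, hev, hev, smul_sub, smul_sub,
        eq_sub_of_add_eq h1.symm, Polynomial.eval_mul, smul_smul, smul_smul,
        mul_comm (z.eval 1)]
      abel)
    (fun y => by
      obtain ⟨v, hv1⟩ := hv (κ y)
      obtain ⟨v', hv2⟩ := hv (D.x 0 ^ r)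
      rw [hd, hv1, hv2, ← map_smul, ← map_sub, hf])
  refine ⟨L, fun a => ?_, fun a => ?_⟩
  · rw [extMap_algebraMap, hL1, ← D.eval_toPoly, ← hev]
    rfl
  · rw [extMap_dForm, hL2, hd, hκ1, hδ, hx, one_smul, D.eval_toPoly, add_sub_cancel_right]

/-- The gradient of `p` in `S^{n+1}`, as an element of `S ⊗ Λ(K^{n+1})`. -/
def gradForm : MvPolynomial (Fin (n + 1)) K →ₗ[K] S ⊗[K] WedgeAlg K n :=
  ∑ j, (TensorProduct.mk K S (WedgeAlg K n)).flip (wedgeGen K j) ∘ₗ D.deh.toLinearMap ∘ₗ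
    D.π.toLinearMap ∘ₗ (MvPolynomial.pderiv j).toLinearMap

theorem gradForm_apply (p : MvPolynomial (Fin (n + 1)) K) :
    D.gradForm p = ∑ j, D.deh (D.π (MvPolynomial.pderiv j p)) ⊗ₜ[K] wedgeGen K j := by
  simp [gradForm]

theorem gradForm_mul (p q : MvPolynomial (Fin (n + 1)) K) :
    D.gradForm (p * q) = D.deh (D.π p) • D.gradForm q + D.deh (D.π q) • D.gradForm p := by
  rw [gradForm_apply, gradForm_apply, gradForm_apply, Finset.smul_sum, Finset.smul_sum,
    ← Finset.sum_add_distrib]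
  refine Finset.sum_congr rfl fun j _ => ?_
  rw [TensorProduct.smul_tmul', TensorProduct.smul_tmul', ← TensorProduct.add_tmul, smul_eq_mul,
    smul_eq_mul, MvPolynomial.pderiv_mul, map_add, map_add, map_mul, map_mul, map_mul, map_mul]
  congr 1
  ring

theorem gradForm_X (j : Fin (n + 1)) : D.gradForm (MvPolynomial.X j) = 1 ⊗ₜ wedgeGen K j := by
  rw [gradForm_apply, Finset.sum_eq_single j]
  · rw [MvPolynomial.pderiv_X_self, map_one, map_one]
  · intro l _ hl
    rw [MvPolynomial.pderiv_X_of_ne hl.symm, map_zero, map_zero, TensorProduct.zero_tmul]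
  · simp

/-- A criterion for the vanishing of a form on `R` that becomes zero on `S[X]`. The algebra of
forms on `S[X]` maps to the quotient of `S ⊗ Λ(K^{n+1})` by the gradients of the relations of
degree at most `r + 1`, with `x_j ↦ x_j^deh` and `dx_j ↦ e_j`. Hence `w = ∑ f_J dx_J` vanishes as
soon as a map `s ⊗ e_J ↦ h(s) dx_J`, where `h` is inverse to dehomogenization in degree `k`, kills
the ideal generated by these gradients. -/
theorem eq_zero_of_extMap_toPoly_eq_zero {r : ℕ}
    (hr : ∀ d : ℕ, r ≤ d → ∀ s, ∃ a ∈ D.grade d, D.deh a = s) {m : ℕ} {k : ℤ}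
    (h : S →ₗ[K] R) (hh : ∀ a ∈ D.grade k, h (D.deh a) = a)
    (l : WedgeAlg K n →ₗ[K] FormsAlg K R)
    (hl : ∀ J : Fin m → Fin (n + 1), l (List.ofFn fun i => wedgeGen K (J i)).prod = D.xProd J)
    (hkill : ∀ g, D.π g = 0 → ∀ d ≤ r + 1, g.IsHomogeneous d → ∀ s b c,
      ∑ j, h (s * D.deh (D.π (MvPolynomial.pderiv j g))) • l (b * wedgeGen K j * c) = 0)
    {w : FormsAlg K R} (hw : w ∈ D.xSpan m k) (h0 : extMap D.toPoly w = 0) : w = 0 := by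
  obtain ⟨Q, _, _, q, hq⟩ := exists_quotient_by_generators (S := S)
    (D.gradForm '' {g | D.π g = 0 ∧ ∃ d ≤ r + 1, g.IsHomogeneous d})
  let _ : Algebra K Q := Algebra.compHom Q (algebraMap K S)
  have _ : IsScalarTower K S Q := IsScalarTower.of_algebraMap_eq fun _ => rfl
  let q' : S ⊗[K] WedgeAlg K n →ₐ[K] Q := q.restrictScalars K
  -- the gradient modulo the relations descends to a derivation of `R`
  have hgrad : ∀ p, D.π p = 0 → q (D.gradForm p) = 0 := by
    intro p hp
    have hp' := D.mem_span_of_π_eq_zero hr hp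
    suffices h : D.π p = 0 ∧ q (D.gradForm p) = 0 from h.2
    induction hp' using Submodule.span_induction with
    | mem g hg =>
      refine ⟨hg.1, (hq _).2 (AddSubgroup.subset_closure ⟨_, ⟨g, hg, rfl⟩, 1, 1, ?_⟩)⟩
      rw [one_mul, mul_one]
    | zero => exact ⟨map_zero _, by rw [map_zero, map_zero]⟩
    | add a b ha hb iha ihb =>
      have h2 : ∀ c ∈ Ideal.span {g | D.π g = 0 ∧ ∃ d ≤ r + 1, g.IsHomogeneous d}, D.π c = 0 :=
        fun c hc => (Ideal.span_le (I := RingHom.ker D.π)).2 (fun g hg => hg.1) hc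
      obtain ⟨ha1, ha2⟩ := iha (h2 a ha)
      obtain ⟨hb1, hb2⟩ := ihb (h2 b hb)
      exact ⟨by rw [map_add, ha1, hb1, add_zero], by rw [map_add, map_add, ha2, hb2, add_zero]⟩
    | smul c a ha iha =>
      have h2 : ∀ c ∈ Ideal.span {g | D.π g = 0 ∧ ∃ d ≤ r + 1, g.IsHomogeneous d}, D.π c = 0 :=
        fun c hc => (Ideal.span_le (I := RingHom.ker D.π)).2 (fun g hg => hg.1) hc
      obtain ⟨ha1, ha2⟩ := iha (h2 a ha)
      refine ⟨by rw [smul_eq_mul, map_mul, ha1, mul_zero], ?_⟩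
      rw [smul_eq_mul, gradForm_mul, map_add, map_smul, map_smul, ha1, ha2, map_zero, zero_smul,
        smul_zero, add_zero]
  obtain ⟨sec, hsec⟩ := LinearMap.exists_rightInverse_of_surjective D.π.toLinearMap
    (LinearMap.range_eq_top.2 D.surjective)
  have hsec : ∀ a, D.π (sec a) = a := fun a => LinearMap.congr_fun hsec a
  let δ : R →ₗ[K] Q := q'.toLinearMap ∘ₗ D.gradForm ∘ₗ sec
  have hδ : ∀ p, δ (D.π p) = q (D.gradForm p) := by
    intro p
    rw [← sub_eq_zero]
    change q (D.gradForm (sec (D.π p))) - _ = 0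
    rw [← map_sub, ← map_sub]
    exact hgrad _ (by rw [map_sub, hsec, sub_self])
  let f : (Fin (n + 1) → S) →ₗ[S] Q := q.toLinearMap ∘ₗ
    ∑ j, (LinearMap.toSpanSingleton S (S ⊗[K] WedgeAlg K n) (1 ⊗ₜ wedgeGen K j)) ∘ₗ
      LinearMap.proj j
  have hf : ∀ v, f v = q (∑ j, v j ⊗ₜ[K] wedgeGen K j) := by
    intro v
    simp [f, TensorProduct.smul_tmul']
  obtain ⟨L, hL1, hL2⟩ := D.exists_lift_of_derivation hr f
    (fun v => by rw [hf, ← map_mul, sum_tmul_wedgeGen_sq, map_zero]) δ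
    (fun a b => by
      obtain ⟨a, rfl⟩ := D.surjective a
      obtain ⟨b, rfl⟩ := D.surjective b
      rw [← map_mul, hδ, hδ, hδ, gradForm_mul, map_add, map_smul, map_smul])
    (fun a => by
      obtain ⟨a, rfl⟩ := D.surjective a
      exact ⟨_, (hδ a).trans ((congrArg q (D.gradForm_apply a)).trans (hf _).symm)⟩)
  -- the value on `w` lifts to an element of `S ⊗ Λ(K^{n+1})` which is mapped to `w`
  let T : S ⊗[K] WedgeAlg K n →ₗ[K] FormsAlg K R :=
    TensorProduct.lift ((((LinearMap.lsmul R (FormsAlg K R)).restrictScalars₁₂ K K).compl₁₂ h l))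
  have hT : ∀ s b, T (s ⊗ₜ b) = h s • l b := fun s b => rfl
  obtain ⟨u, hu1, hu2⟩ : ∃ u, T u = w ∧ q u = L (extMap D.toPoly w) := by
    clear h0
    induction hw using Submodule.span_induction with
    | mem w hw =>
      obtain ⟨a, J, ha, rfl⟩ := hw
      refine ⟨D.deh a ⊗ₜ (List.ofFn fun i => wedgeGen K (J i)).prod, ?_, ?_⟩
      · rw [hT, hl, hh a ha]
      · have h1 := map_smul_dProd (L.comp (extMap D.toPoly)) a fun i => D.x (J i)
        rw [AlgHom.comp_apply, AlgHom.comp_apply, hL1] at h1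
        refine Eq.trans ?_ h1.symm
        have h2 : ∀ i, L (extMap D.toPoly (dForm (D.x (J i)))) = q (1 ⊗ₜ wedgeGen K (J i)) :=
          fun i => by rw [hL2, x, hδ, gradForm_X]
        simp only [AlgHom.comp_apply, h2]
        have h3 : (List.ofFn fun i => q (1 ⊗ₜ wedgeGen K (J i))).prod =
            q (1 ⊗ₜ (List.ofFn fun i => wedgeGen K (J i)).prod) := by
          have h4 : ∀ L : List (WedgeAlg K n),
              (L.map fun b => q ((1 : S) ⊗ₜ b)).prod = q (1 ⊗ₜ L.prod) := by
            intro L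
            induction L with
            | nil => exact (map_one q).symm
            | cons b L ih =>
              rw [List.map_cons, List.prod_cons, List.prod_cons, ih, ← map_mul,
                Algebra.TensorProduct.tmul_mul_tmul, one_mul]
          rw [← h4, List.map_ofFn]
          rfl
        rw [h3, ← Algebra.smul_def, ← map_smul, TensorProduct.smul_tmul', smul_eq_mul, mul_one]
    | zero => exact ⟨0, map_zero _, by rw [map_zero, map_zero, map_zero]⟩
    | add w w' _ _ hw hw' =>
      obtain ⟨u, hu, hu'⟩ := hw
      obtain ⟨v, hv, hv'⟩ := hw'
      exact ⟨u + v, by rw [map_add, hu, hv], by rw [map_add, map_add, map_add, hu', hv']⟩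
    | smul c w _ hw =>
      obtain ⟨u, hu, hu'⟩ := hw
      exact ⟨c • u, by rw [map_smul, hu], by
        rw [map_smul (extMap D.toPoly), map_smul L, ← hu']; exact map_smul q' c u⟩
  rw [h0, map_zero, hq] at hu2
  rw [← hu1]
  clear hu1
  induction hu2 using AddSubgroup.closure_induction with
  | zero => exact map_zero _
  | add u v _ _ hu hv => rw [map_add, hu, hv, add_zero]
  | neg u _ hu => rw [map_neg, hu, neg_zero]
  | mem u hu =>
    obtain ⟨_, ⟨g, ⟨hg, d, hd, hgd⟩, rfl⟩, b, c, rfl⟩ := hu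
    rw [gradForm_apply]
    induction b using TensorProduct.induction_on with
    | zero => rw [zero_mul, zero_mul, map_zero]
    | add b b' hb hb' => rw [add_mul, add_mul, map_add, hb, hb', add_zero]
    | tmul s b =>
      induction c using TensorProduct.induction_on with
      | zero => rw [mul_zero, map_zero]
      | add c c' hc hc' => rw [mul_add, map_add, hc, hc', add_zero]
      | tmul t c =>
        rw [Finset.mul_sum, Finset.sum_mul, map_sum]
        rw [← hkill g hg d hd hgd (s * t) b c]
        refine Finset.sum_congr rfl fun j _ => ?_
        rw [Algebra.TensorProduct.tmul_mul_tmul, Algebra.TensorProduct.tmul_mul_tmul, hT,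
          mul_right_comm]

end DehomSetup

namespace DehomSetup

variable {K R S : Type*} [Field K] {n : ℕ} [CommRing R] [Algebra K R] [CommRing S] [Algebra K S]
  (D : DehomSetup K R S n)

/-- In degrees in which dehomogenization is bijective, it has a linear inverse. -/
theorem exists_homogenization {k : ℤ} (hk : ∀ s, ∃ a ∈ D.grade k, D.deh a = s) :
    ∃ h : S →ₗ[K] R, (∀ s, h s ∈ D.grade k) ∧ ∀ a ∈ D.grade k, h (D.deh a) = a := by
  let e := LinearEquiv.ofBijective (D.deh.toLinearMap ∘ₗ (D.grade k).subtype)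
    ⟨D.deh_grade_injective k, fun s => by
      obtain ⟨a, ha, h⟩ := hk s
      exact ⟨⟨a, ha⟩, h⟩⟩
  exact ⟨(D.grade k).subtype ∘ₗ e.symm.toLinearMap, fun s => (e.symm s).2, fun a ha =>
    congrArg Subtype.val (e.symm_apply_apply ⟨a, ha⟩)⟩

/-- The homomorphism `Λ(K^{n+1}) → ⨁ Ω^m_{R/K}` with `e_j ↦ dx_j`. -/
theorem exists_wedgeLift :
    ∃ l : WedgeAlg K n →ₐ[K] FormsAlg K R, ∀ j, l (wedgeGen K j) = dForm (D.x j) := by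
  let f : (Fin (n + 1) → K) →ₗ[K] FormsAlg K R :=
    (ExteriorAlgebra.ι R).restrictScalars K ∘ₗ
      Fintype.linearCombination K fun j => KaehlerDifferential.D K R (D.x j)
  have hf : ∀ v, f v * f v = 0 := fun v => ExteriorAlgebra.ι_sq_zero _
  refine ⟨ExteriorAlgebra.lift K ⟨f, hf⟩, fun j => ?_⟩
  rw [wedgeGen, ExteriorAlgebra.lift_ι_apply]
  simp [f, dForm]

theorem map_prod_wedgeGen {l : WedgeAlg K n →ₐ[K] FormsAlg K R}
    (hl : ∀ j, l (wedgeGen K j) = dForm (D.x j)) {m : ℕ} (J : Fin m → Fin (n + 1)) :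
    l (List.ofFn fun i => wedgeGen K (J i)).prod = D.xProd J := by
  rw [xProd, dProd_eq_prod, map_list_prod, List.map_ofFn]
  simp [Function.comp_def, hl]

/-- In degrees `i ≥ 2r + m`, the forms on `R` inject into the forms on `S[X]`. -/
theorem eq_zero_of_mem_xSpan {r : ℕ}
    (hr : ∀ d : ℕ, r ≤ d → ∀ s, ∃ a ∈ D.grade d, D.deh a = s) {m k : ℕ} (hk : 2 * r ≤ k)
    {w : FormsAlg K R} (hw : w ∈ D.xSpan m k) (h0 : extMap D.toPoly w = 0) : w = 0 := by
  obtain ⟨h, -, hh⟩ := D.exists_homogenization (hr k (by omega))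
  obtain ⟨l, hl⟩ := D.exists_wedgeLift
  refine D.eq_zero_of_extMap_toPoly_eq_zero hr h hh l.toLinearMap
    (fun J => D.map_prod_wedgeGen hl J) (fun g hg d hd hgd s b c => ?_) hw h0
  -- there is room to lift `s` to degree `k - (d - 1) ≥ r`
  obtain ⟨a, ha, rfl⟩ := hr (k + 1 - d) (by omega) s
  have h1 : ∀ j, h (D.deh a * D.deh (D.π (MvPolynomial.pderiv j g))) =
      a * D.π (MvPolynomial.pderiv j g) := by
    intro j
    rw [← map_mul]
    refine hh _ ?_
    have := D.mul_mem_grade ha (D.π_pderiv_mem_grade hgd j)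
    rwa [show ((k + 1 - d : ℕ) : ℤ) + ((d : ℤ) - 1) = k by omega] at this
  have h2 : (dForm (D.π g) : FormsAlg K R) = 0 := by rw [hg, dForm, map_zero, map_zero]
  rw [dForm_π] at h2
  calc _ = ∑ j, a • (l b * (D.π (MvPolynomial.pderiv j g) • dForm (D.x j)) * l c) := by
        refine Finset.sum_congr rfl fun j _ => ?_
        rw [h1, AlgHom.toLinearMap_apply, map_mul, map_mul, hl, mul_smul, mul_smul_comm,
          smul_mul_assoc]
    _ = 0 := by
        rw [← Finset.smul_sum, ← Finset.sum_mul, ← Finset.mul_sum, h2, mul_zero, zero_mul,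
          smul_zero]

/-- The comparison of forms on `R` and on `S[X]` is bijective in a given degree if it is
injective there and the degree is at least `r + m`. -/
theorem bijOn_formsMap_toPoly {r : ℕ}
    (hr : ∀ d : ℕ, r ≤ d → ∀ s, ∃ a ∈ D.grade d, D.deh a = s) {m : ℕ} {i : ℤ}
    (hi : (r : ℤ) + m ≤ i)
    (hinj : ∀ w ∈ D.xSpan m (i - m), extMap D.toPoly w = 0 → w = 0) :
    Set.BijOn (formsMap D.toPoly m) (formsGrade D.grade m i)
      (formsGrade (polyGrade K S) m i) := by
  refine ⟨fun w hw => formsMap_mem_formsGrade D.toPoly (fun d a => D.toPoly_mem_polyGrade) m i hw,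
    fun v hv w hw hvw => ?_, fun w hw => ?_⟩
  · rw [← sub_eq_zero]
    apply formsIncl_injective m
    rw [map_zero]
    refine hinj _ ?_ ?_
    · rw [← map_formsGrade_eq_xSpan]
      exact ⟨_, sub_mem hv hw, rfl⟩
    · rw [← formsIncl_formsMap, map_sub, hvw, sub_self, map_zero]
  · obtain ⟨v, hv, h⟩ := D.exists_formsMap_toPoly_eq hr hi hw
    exact ⟨v, hv, h⟩

theorem finrank_eq_of_bijOn {V W : Type*} [AddCommGroup V] [Module K V] [AddCommGroup W]
    [Module K W] (f : V →ₗ[K] W) {P : Submodule K V} {P' : Submodule K W}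
    (h : Set.BijOn f P P') : Module.finrank K P = Module.finrank K P' := by
  refine (LinearEquiv.ofBijective (f.restrict fun x hx => h.mapsTo hx) ⟨?_, ?_⟩).finrank_eq
  · intro v w hvw
    exact Subtype.ext (h.injOn v.2 w.2 (congrArg Subtype.val hvw))
  · rintro ⟨w, hw⟩
    obtain ⟨v, hv, rfl⟩ := h.surjOn hw
    exact ⟨⟨v, hv⟩, rfl⟩

theorem hilbertFun_formsGrade_eq [Module.Finite K S] {r : ℕ}
    (hr : ∀ d : ℕ, r ≤ d → ∀ s, ∃ a ∈ D.grade d, D.deh a = s) {m : ℕ} (hm : 1 ≤ m) {i : ℤ}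
    (hi : (r : ℤ) + m ≤ i)
    (hinj : ∀ w ∈ D.xSpan m (i - m), extMap D.toPoly w = 0 → w = 0) :
    hilbertFun (formsGrade D.grade m) i =
      Module.finrank K (Forms K S m) + Module.finrank K (Forms K S (m - 1)) :=
  (finrank_eq_of_bijOn _ (D.bijOn_formsMap_toPoly hr hi hinj)).trans
    ((finrank_formsGrade_of_equiv (AlgEquiv.refl (R := K) (A₁ := S[X])) (fun _ _ => Iff.rfl) hm
      i).2 (by omega))

theorem eq_zero_of_mem_xSpan_of_le {r : ℕ}
    (hr : ∀ d : ℕ, r ≤ d → ∀ s, ∃ a ∈ D.grade d, D.deh a = s) {m : ℕ} {i : ℤ}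
    (hi : 2 * (r : ℤ) + m ≤ i) :
    ∀ w ∈ D.xSpan m (i - m), extMap D.toPoly w = 0 → w = 0 := by
  intro w hw
  obtain ⟨k, rfl⟩ : ∃ k : ℕ, i = k + m := ⟨(i - m).toNat, by omega⟩
  rw [add_sub_cancel_right] at hw
  exact D.eq_zero_of_mem_xSpan hr (by omega) hw

end DehomSetup

/-! ### A combinatorial vanishing criterion -/

section Combinatorics

variable {ι : Type*}

theorem degree_erase_add (σ : ι →₀ ℕ) (i : ι) : (σ.erase i).degree + σ i = σ.degree := by
  conv_rhs => rw [← Finsupp.single_add_erase i σ]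
  rw [map_add, Finsupp.degree_single, add_comm]

/-- There is a divisor of a monomial with prescribed exponent at `i` and prescribed degree. -/
theorem exists_le_degree_eq_and (σ : ι →₀ ℕ) (i : ι) {t a : ℕ} (ha : a ≤ σ i) (hat : a ≤ t)
    (ht : t + σ i ≤ σ.degree + a) : ∃ α ≤ σ, α.degree = t ∧ α i = a := by
  have hσ := degree_erase_add σ i
  obtain ⟨α, hα, hd⟩ := Finsupp.exists_le_degree_eq (σ.erase i) (t - a) (by omega)
  have hαi : α i = 0 := by simpa using hα i
  refine ⟨Finsupp.single i a + α, fun l => ?_, ?_, ?_⟩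
  · have := hα l
    rcases eq_or_ne l i with rfl | hl
    · simpa [hαi] using ha
    · rw [Finsupp.erase_ne hl] at this
      simpa [Finsupp.single_eq_of_ne hl] using this
  · rw [map_add, Finsupp.degree_single, hd]; omega
  · simp [hαi]

/-- There is a divisor of a monomial with prescribed exponents at `i` and `k` and prescribed
degree. -/
theorem exists_le_degree_eq_and_and (σ : ι →₀ ℕ) {i k : ι} (hik : i ≠ k) {t a b : ℕ} (ha : a ≤ σ i)
    (hb : b ≤ σ k) (hat : a + b ≤ t) (ht : t + σ i + σ k ≤ σ.degree + a + b) :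
    ∃ α ≤ σ, α.degree = t ∧ α i = a ∧ α k = b := by
  have hσ := degree_erase_add σ i
  have hk : (σ.erase i) k = σ k := Finsupp.erase_ne hik.symm
  obtain ⟨α, hα, hd, hαk⟩ := exists_le_degree_eq_and (σ.erase i) k (t := t - a) (a := b)
    (by rwa [hk]) (by omega) (by rw [hk]; omega)
  have hαi : α i = 0 := by simpa using hα i
  refine ⟨Finsupp.single i a + α, fun l => ?_, ?_, ?_, ?_⟩
  · have := hα l
    rcases eq_or_ne l i with rfl | hl
    · simpa [hαi] using ha
    · rw [Finsupp.erase_ne hl] at this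
      simpa [Finsupp.single_eq_of_ne hl] using this
  · rw [map_add, Finsupp.degree_single, hd]; omega
  · simp [hαi]
  · simp [Finsupp.single_eq_of_ne hik.symm, hαk]

variable [Fintype ι] [DecidableEq ι] {K M : Type*} [Field K] [AddCommGroup M] [Module K M]

/-- Let `c j γ` be indexed by `j` and by the monomials `γ` of degree `2r + 1`, let `o` be a
distinguished variable, and suppose that `c j γ = 0` if `γ` is divisible by `o`. The relations
`rel` come from products of two relations of degree `r + 1`, and the relations `euler` from
Euler's formula. They force `c j γ = 0` for `j ≠ o`, except for three variables, characteristic two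
and even `r`. -/
theorem eq_zero_of_relations {r : ℕ} (hr : 1 ≤ r) (o : ι) (c : ι → (ι →₀ ℕ) → M)
    (hzero : ∀ j γ, γ.degree = 2 * r + 1 → γ o ≠ 0 → c j γ = 0)
    (euler : ∀ ν : ι →₀ ℕ, ν.degree = 2 * r → ∑ j, c j (ν + Finsupp.single j 1) = 0)
    (rel : ∀ α β : ι →₀ ℕ, α.degree = r + 1 → β.degree = r + 1 → ∀ i j, i ≠ o → j ≠ o →
      (α i : K) • c j (α + β - Finsupp.single i 1) = (β j : K) • c i (α + β - Finsupp.single j 1))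
    (hex : ¬ (Fintype.card ι = 3 ∧ (2 : K) = 0 ∧ Even r)) {j : ι} (hj : j ≠ o) {γ : ι →₀ ℕ}
    (hγ : γ.degree = 2 * r + 1) : c j γ = 0 := by
  -- the case of a monomial which is not a power of the variable `i`
  have main : ∀ i, i ≠ o → ∀ γ : ι →₀ ℕ, γ.degree = 2 * r + 1 → ∀ l, l ≠ i → γ l ≠ 0 →
      c i γ = 0 := by
    intro i hi γ hγ l hli hl
    rcases eq_or_ne l o with rfl | hlo
    · exact hzero i γ hγ hl
    have hγi : γ i ≤ 2 * r := by
      have h1 := degree_erase_add γ i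
      have h2 := Finsupp.le_degree l (γ.erase i)
      rw [Finsupp.erase_ne hli] at h2
      omega
    -- `a` and `b` are the exponents of `i` in the two factors
    have hdiag : ∀ a b : ℕ, a + b = γ i + 1 → a ≤ r + 1 → b ≤ r + 1 →
        (a : K) • c i γ = (b : K) • c i γ := by
      intro a b hab ha hb
      have hσd : (γ + Finsupp.single i 1 : ι →₀ ℕ).degree = 2 * r + 2 := by
        rw [map_add, Finsupp.degree_single, hγ]
      have hσi : (γ + Finsupp.single i 1 : ι →₀ ℕ) i = γ i + 1 := by simp
      obtain ⟨α, hα, hαd, hαi⟩ := exists_le_degree_eq_and (γ + Finsupp.single i 1) i (t := r + 1)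
        (a := a) (by omega) ha (by omega)
      obtain ⟨β, hβ⟩ := exists_add_of_le hα
      have hβd : β.degree = r + 1 := by
        have := congrArg Finsupp.degree hβ
        rw [hσd, map_add, hαd] at this
        omega
      have hβi : β i = b := by
        have := DFunLike.congr_fun hβ i
        rw [hσi, Finsupp.add_apply, hαi] at this
        omega
      have h := rel α β hαd hβd i i hi hi
      rwa [← hβ, add_tsub_cancel_right, hαi, hβi] at h
    by_cases h2 : (2 : K) = 0
    · have hodd : ∀ a : ℕ, Odd a → (a : K) = 1 := by
        rintro _ ⟨a, rfl⟩
        push_cast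
        rw [h2, zero_mul, zero_add]
      have heven : ∀ a : ℕ, Even a → (a : K) = 0 := by
        rintro _ ⟨a, rfl⟩
        push_cast
        rw [← two_mul, h2, zero_mul]
      rcases Nat.even_or_odd (γ i) with hpar | hpar
      · -- one of the two exponents of `i` is odd, the other one is even
        obtain ⟨a, b, hab, ha, hb, hab'⟩ : ∃ a b : ℕ, a + b = γ i + 1 ∧ a ≤ r + 1 ∧ b ≤ r + 1 ∧
            Odd a ∧ Even b := by
          obtain ⟨t, ht⟩ := hpar
          rcases Nat.even_or_odd t with h | h
          · exact ⟨t + 1, t, by omega, by omega, by omega, h.add_one, h⟩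
          · exact ⟨t, t + 1, by omega, by omega, by omega, h, h.add_one⟩
        have h := hdiag a b hab ha hb
        rwa [hodd a hab'.1, heven b hab'.2, one_smul, zero_smul] at h
      · -- a third variable `k` to compare with; for even `r` it has to differ from `l`
        obtain ⟨k, hki, hko, hkl⟩ : ∃ k, k ≠ i ∧ k ≠ o ∧ (Even r → k ≠ l) := by
          by_cases he : Even r
          · have hcard : ¬ Fintype.card ι = 3 := fun h => hex ⟨h, h2, he⟩
            have h3 : ({i, o, l} : Finset ι).card = 3 := by
              rw [Finset.card_eq_three]
              exact ⟨i, o, l, hi, hli.symm, hlo.symm, rfl⟩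
            have h4 : ({i, o, l} : Finset ι) ≠ Finset.univ := by
              intro h
              rw [h, Finset.card_univ] at h3
              exact hcard h3
            obtain ⟨k, hk⟩ : ∃ k, k ∉ ({i, o, l} : Finset ι) := by
              by_contra! h
              exact h4 (Finset.eq_univ_iff_forall.2 h)
            simp only [Finset.mem_insert, Finset.mem_singleton, not_or] at hk
            exact ⟨k, hk.1, hk.2.1, fun _ => hk.2.2⟩
          · exact ⟨l, hli, hlo, fun h => absurd h he⟩
        -- the exponents `a` of `i` and `b` of `k` in the first factor, both odd
        have hd1 := degree_erase_add γ i
        have hd2 := degree_erase_add (γ.erase i) k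
        rw [Finsupp.erase_ne hki] at hd2
        obtain ⟨ρ, hρ⟩ : ∃ ρ, ρ = ((γ.erase i).erase k).degree := ⟨_, rfl⟩
        rw [← hρ] at hd2
        have hρ1 : Even r → 1 ≤ ρ := by
          intro he
          have h1 := Finsupp.le_degree l ((γ.erase i).erase k)
          rw [Finsupp.erase_ne (hkl he).symm, Finsupp.erase_ne hli] at h1
          omega
        obtain ⟨a, b, ha, hb, hai, hbk, hab, hab'⟩ : ∃ a b : ℕ, Odd a ∧ Odd b ∧ a ≤ γ i ∧
            b ≤ γ k + 1 ∧ a + b ≤ r + 1 ∧ r + 1 ≤ ρ + a + b := by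
          -- the largest even value of `a + b` that is allowed by the degree `r + 1`
          obtain ⟨T, hT, hTr, hTr'⟩ : ∃ T, Even T ∧ T ≤ r + 1 ∧ r + 1 ≤ ρ + T ∧ 2 ≤ T := by
            rcases Nat.even_or_odd r with he | he
            · have := hρ1 he
              obtain ⟨t, ht⟩ := id he
              exact ⟨r, he, by omega, by omega, by omega⟩
            · exact ⟨r + 1, he.add_one, le_rfl, by omega, by omega⟩
          -- the largest even value of `a + b` that is allowed by the exponents of `i` and `k`
          obtain ⟨U, hU, hUl, hUu⟩ : ∃ U, Even U ∧ γ i + γ k ≤ U ∧ U ≤ γ i + γ k + 1 := by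
            rcases Nat.even_or_odd (γ k) with he | he
            · exact ⟨γ i + γ k + 1, (hpar.add_even he).add_one, by omega, le_rfl⟩
            · exact ⟨γ i + γ k, hpar.add_odd he, le_rfl, by omega⟩
          obtain ⟨V, hV, hV2, hVT, hVU, hVr⟩ : ∃ V, Even V ∧ 2 ≤ V ∧ V ≤ T ∧ V ≤ U ∧
              r + 1 ≤ ρ + V := by
            rcases le_total T U with h | h
            · exact ⟨T, hT, hTr'.2, le_rfl, h, hTr'.1⟩
            · refine ⟨U, hU, ?_, h, le_rfl, by omega⟩
              obtain ⟨t, ht⟩ := hU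
              obtain ⟨u, hu⟩ := hpar
              omega
          obtain ⟨v, hv⟩ := hV
          obtain ⟨u, hu⟩ := hpar
          rcases le_total (V - 1) (γ i) with h | h
          · exact ⟨V - 1, 1, ⟨v - 1, by omega⟩, odd_one, h, by omega, by omega, by omega⟩
          · exact ⟨γ i, V - γ i, ⟨u, hu⟩, ⟨v - u - 1, by omega⟩, le_rfl, by omega, by omega,
              by omega⟩
        have hσi : (γ + Finsupp.single k 1 : ι →₀ ℕ) i = γ i := by
          simp [Finsupp.single_eq_of_ne hki.symm]
        have hσk : (γ + Finsupp.single k 1 : ι →₀ ℕ) k = γ k + 1 := by simp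
        have hσd : (γ + Finsupp.single k 1 : ι →₀ ℕ).degree = 2 * r + 2 := by
          rw [map_add, Finsupp.degree_single, hγ]
        obtain ⟨α, hα, hαd, hαi, hαk⟩ := exists_le_degree_eq_and_and (γ + Finsupp.single k 1)
          hki.symm (t := r + 1) (a := a) (b := b) (by omega) (by omega) hab (by omega)
        obtain ⟨β, hβ⟩ := exists_add_of_le hα
        have hβd : β.degree = r + 1 := by
          have := congrArg Finsupp.degree hβ
          rw [hσd, map_add, hαd] at this
          omega
        have hβi : Even (β i) := by
          have := DFunLike.congr_fun hβ i
          rw [hσi, Finsupp.add_apply, hαi] at this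
          rw [this] at hpar
          exact (Nat.odd_add.1 hpar).1 ha
        have h := rel α β hαd hβd k i hko hi
        rwa [← hβ, add_tsub_cancel_right, hαk, hodd b hb, heven _ hβi, one_smul, zero_smul] at h
    · -- compare the relations for `(a + 1, b)` and `(a, b + 1)`
      obtain ⟨a, b, hab, ha, hb⟩ : ∃ a b : ℕ, a + b = γ i ∧ a ≤ r ∧ b ≤ r :=
        ⟨γ i / 2, γ i - γ i / 2, by omega, by omega, by omega⟩
      have h1 := hdiag (a + 1) b (by omega) (by omega) (by omega)
      have h3 := hdiag a (b + 1) (by omega) (by omega) (by omega)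
      push_cast at h1 h3
      rw [add_smul, one_smul] at h1 h3
      have h4 : (2 : K) • c i γ = 0 := by
        rw [two_smul]
        rw [h3, add_assoc] at h1
        exact left_eq_add.1 h1.symm
      exact (smul_eq_zero.1 h4).resolve_left h2
  by_cases h : ∃ l, l ≠ j ∧ γ l ≠ 0
  · obtain ⟨l, hlj, hl⟩ := h
    exact main j hj γ hγ l hlj hl
  · -- a power of the variable `j`: use Euler's formula
    push Not at h
    have hγj : γ = Finsupp.single j (2 * r + 1) := by
      ext l
      rcases eq_or_ne l j with rfl | hl
      · have h1 := degree_erase_add γ l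
        have h2 : γ.erase l = 0 := by
          ext t
          rcases eq_or_ne t l with rfl | ht
          · simp
          · rw [Finsupp.erase_ne ht, h t ht]; rfl
        rw [h2, map_zero] at h1
        simp; omega
      · rw [h l hl, Finsupp.single_eq_of_ne hl]
    have h1 := euler (Finsupp.single j (2 * r)) (Finsupp.degree_single _ _)
    rw [Finset.sum_eq_single j, ← Finsupp.single_add] at h1
    · rw [hγj, h1]
    · intro i _ hij
      have hd : (Finsupp.single j (2 * r) + Finsupp.single i 1 : ι →₀ ℕ).degree = 2 * r + 1 := by
        rw [map_add, Finsupp.degree_single, Finsupp.degree_single]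
      rcases eq_or_ne i o with rfl | hio
      · exact hzero _ _ hd (by simp)
      · exact main i hio _ hd j hij.symm (by simp; omega)
    · simp

end Combinatorics

/-! ### Top forms -/

namespace DehomSetup

variable {K R S : Type*} [Field K] {n : ℕ} [CommRing R] [Algebra K R] [CommRing S] [Algebra K S]
  (D : DehomSetup K R S n)

/-- The form `dx_0 ∧ ⋯ ∧ dx_n`. -/
def topForm : FormsAlg K R := D.xProd (id : Fin (n + 1) → Fin (n + 1))

/-- The partial derivatives of the relations of `R` annihilate `dx_0 ∧ ⋯ ∧ dx_n`: replace `dx_j`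
by `dg`. -/
theorem π_pderiv_smul_topForm {g : MvPolynomial (Fin (n + 1)) K} (hg : D.π g = 0)
    (j : Fin (n + 1)) : D.π (MvPolynomial.pderiv j g) • D.topForm = 0 := by
  have h1 : (0 : Ω[R⁄K]) =
      ∑ l, D.π (MvPolynomial.pderiv l g) • KaehlerDifferential.D K R (D.x l) := by
    apply (ExteriorAlgebra.ι_leftInverse (R := R) (M := Ω[R⁄K])).injective
    have h2 : (dForm (D.π g) : FormsAlg K R) = 0 := by rw [hg, dForm, map_zero, map_zero]
    rw [dForm_π] at h2
    rw [map_zero, map_sum, ← h2]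
    simp only [map_smul, dForm]
  have h2 := congrArg (fun v => ExteriorAlgebra.ιMulti R (n + 1)
    (Function.update (fun l => KaehlerDifferential.D K R (D.x l)) j v)) h1
  simp only [AlternatingMap.map_update_zero, AlternatingMap.map_update_sum,
    AlternatingMap.map_update_smul] at h2
  rw [Finset.sum_eq_single j] at h2
  · rw [Function.update_eq_self] at h2
    exact h2.symm
  · intro l _ hl
    rw [AlternatingMap.map_update_self _ _ hl.symm, smul_zero]
  · simp

/-- The homomorphism `e_j ↦ dx_j`, restricted to the elements of degree `n + 1`. Its values are
multiples of `dx_0 ∧ ⋯ ∧ dx_n`. -/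
theorem exists_topLift : ∃ l : WedgeAlg K n →ₗ[K] FormsAlg K R,
    (∀ J : Fin (n + 1) → Fin (n + 1),
      l (List.ofFn fun i => wedgeGen K (J i)).prod = D.xProd J) ∧
    ∀ y, ∃ c : K, l y = c • D.topForm := by
  obtain ⟨l, hl⟩ := D.exists_wedgeLift
  let 𝒲 : ℕ → Submodule K (WedgeAlg K n) := fun i => ⋀[K]^i (Fin (n + 1) → K)
  have hprod : ∀ J : Fin (n + 1) → Fin (n + 1), (List.ofFn fun i => wedgeGen K (J i)).prod =
      ExteriorAlgebra.ιMulti K (n + 1) fun i => (Pi.single (J i) 1 : Fin (n + 1) → K) :=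
    fun J => (ExteriorAlgebra.ιMulti_apply _).symm
  have htop : ∀ y ∈ 𝒲 (n + 1), l y ∈ Submodule.span K {D.topForm} := by
    intro y hy
    let f : (Fin (n + 1) → K) [⋀^Fin (n + 1)]→ₗ[K]
        (FormsAlg K R ⧸ Submodule.span K {D.topForm}) :=
      ((Submodule.span K {D.topForm}).mkQ ∘ₗ l.toLinearMap).compAlternatingMap
        (ExteriorAlgebra.ιMulti K (n + 1))
    have hf : f = 0 := by
      refine Module.Basis.ext_alternating (Pi.basisFun K (Fin (n + 1))) fun v hv => ?_
      let σ : Equiv.Perm (Fin (n + 1)) :=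
        Equiv.ofBijective v (Finite.injective_iff_bijective.1 hv)
      have h1 := f.map_perm (fun i => Pi.basisFun K (Fin (n + 1)) i) σ
      have h2 : f (fun i => Pi.basisFun K (Fin (n + 1)) i) = 0 := by
        change (Submodule.span K {D.topForm}).mkQ (l (ExteriorAlgebra.ιMulti K (n + 1)
          fun i => Pi.basisFun K (Fin (n + 1)) i)) = 0
        have h3 := D.map_prod_wedgeGen hl (id : Fin (n + 1) → Fin (n + 1))
        rw [hprod] at h3
        simp only [Pi.basisFun_apply]
        rw [Submodule.mkQ_apply, Submodule.Quotient.mk_eq_zero]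
        exact h3 ▸ Submodule.mem_span_singleton_self _
      rw [h2, smul_zero] at h1
      exact h1
    have hy' : y ∈ Submodule.span K (Set.range (ExteriorAlgebra.ιMulti K (n + 1))) := by
      rw [ExteriorAlgebra.ιMulti_span_fixedDegree]; exact hy
    clear hy
    induction hy' using Submodule.span_induction with
    | mem y hy =>
      obtain ⟨v, rfl⟩ := hy
      rw [← Submodule.Quotient.mk_eq_zero]
      exact congrArg (fun f => f v) hf
    | zero => rw [map_zero]; exact zero_mem _
    | add u v _ _ hu hv => rw [map_add]; exact add_mem hu hv
    | smul c u _ hu => rw [map_smul]; exact Submodule.smul_mem _ _ hu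
  refine ⟨l.toLinearMap ∘ₗ GradedAlgebra.proj 𝒲 (n + 1), fun J => ?_, fun y => ?_⟩
  · rw [LinearMap.comp_apply, GradedAlgebra.proj_apply, DirectSum.decompose_of_mem_same]
    · exact D.map_prod_wedgeGen hl J
    · rw [hprod]
      exact ExteriorAlgebra.ιMulti_range K (n + 1) ⟨_, rfl⟩
  · obtain ⟨c, hc⟩ := Submodule.mem_span_singleton.1
      (htop _ (SetLike.coe_mem (DirectSum.decompose 𝒲 y (n + 1))))
    exact ⟨c, hc.symm⟩

/-- The linear map `p ↦ h((∂_j p)^deh) dx_0 ∧ ⋯ ∧ dx_n` on polynomials. -/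
def topDeriv (h : S →ₗ[K] R) (j : Fin (n + 1)) :
    MvPolynomial (Fin (n + 1)) K →ₗ[K] FormsAlg K R :=
  (LinearMap.toSpanSingleton R (FormsAlg K R) D.topForm).restrictScalars K ∘ₗ h ∘ₗ
    D.deh.toLinearMap ∘ₗ D.π.toLinearMap ∘ₗ (MvPolynomial.pderiv j).toLinearMap

theorem topDeriv_apply (h : S →ₗ[K] R) (j : Fin (n + 1)) (p : MvPolynomial (Fin (n + 1)) K) :
    D.topDeriv h j p = h (D.deh (D.π (MvPolynomial.pderiv j p))) • D.topForm := rfl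

theorem topDeriv_mul (h : S →ₗ[K] R) (j : Fin (n + 1)) (a : MvPolynomial (Fin (n + 1)) K)
    {g : MvPolynomial (Fin (n + 1)) K} (hg : D.π g = 0) :
    D.topDeriv h j (a * g) =
      h (D.deh (D.π a) * D.deh (D.π (MvPolynomial.pderiv j g))) • D.topForm := by
  rw [topDeriv_apply, MvPolynomial.pderiv_mul, map_add, map_mul, map_mul, hg, mul_zero, zero_add,
    map_mul]

theorem topDeriv_X_zero_mul (h : S →ₗ[K] R) (j : Fin (n + 1))
    {g : MvPolynomial (Fin (n + 1)) K} (hg : D.π g = 0) :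
    D.topDeriv h j (MvPolynomial.X 0 * g) = D.topDeriv h j g := by
  rw [topDeriv_mul _ _ _ _ hg, D.deh_x0, one_mul, topDeriv_apply]

variable {D} {r : ℕ} {h : S →ₗ[K] R}

/-- In degrees `d ≤ 2r` there is no loss of degree: `x_0 ^ (2r - d) ∂_j g` has degree `2r - 1`. -/
theorem topDeriv_eq_zero_of_degree_le (hh : ∀ a ∈ D.grade (2 * r - 1), h (D.deh a) = a)
    (j : Fin (n + 1)) {g : MvPolynomial (Fin (n + 1)) K} (hg : D.π g = 0) {d : ℕ}
    (hgd : g.IsHomogeneous d) (hd : d ≤ 2 * r) : D.topDeriv h j g = 0 := by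
  have h1 := D.mul_mem_grade (D.x_pow_mem_grade 0 (2 * r - d)) (D.π_pderiv_mem_grade hgd j)
  rw [show ((2 * r - d : ℕ) : ℤ) + ((d : ℤ) - 1) = 2 * r - 1 by omega] at h1
  have h2 := hh _ h1
  rw [map_mul, map_pow, deh_x_zero, one_pow, one_mul] at h2
  rw [topDeriv_apply, h2, mul_smul, π_pderiv_smul_topForm D hg, smul_zero]

/-- Modulo the relations of `R`, a polynomial of degree `d + 1` with `d ≥ r` is a multiple of
`X_0`. -/
theorem exists_reduction (hr : ∀ d : ℕ, r ≤ d → ∀ s, ∃ a ∈ D.grade d, D.deh a = s) {d : ℕ}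
    (hd : r ≤ d) {f : MvPolynomial (Fin (n + 1)) K} (hf : f.IsHomogeneous (d + 1)) :
    ∃ u : MvPolynomial (Fin (n + 1)) K, u.IsHomogeneous d ∧
      D.π (f - MvPolynomial.X 0 * u) = 0 := by
  obtain ⟨a, ha, hdeh⟩ := hr d hd (D.deh (D.π f))
  obtain ⟨u, hu, rfl⟩ := D.mem_grade_natCast.1 ha
  refine ⟨u, hu, ?_⟩
  rw [map_sub, map_mul, sub_eq_zero]
  have h1 := D.mul_mem_grade (D.x_mem_grade 0) ha
  rw [show (1 : ℤ) + (d : ℤ) = ((d + 1 : ℕ) : ℤ) by push_cast; ring] at h1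
  refine D.deh_injOn (D.π_mem_grade hf) h1 ?_
  rw [map_mul, D.deh_x0, one_mul, hdeh]

/-- The derivatives of the relations of degree `2r + 1` with respect to `X_j`, where `j ≠ 0`,
annihilate `dx_0 ∧ ⋯ ∧ dx_n` already after lowering their degree by one. -/
theorem topDeriv_eq_zero (hr1 : 1 ≤ r)
    (hr : ∀ d : ℕ, r ≤ d → ∀ s, ∃ a ∈ D.grade d, D.deh a = s)
    (hh : ∀ a ∈ D.grade (2 * r - 1), h (D.deh a) = a)
    (hex : ¬ (n = 2 ∧ (2 : K) = 0 ∧ Even r)) {j : Fin (n + 1)} (hj : j ≠ 0)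
    {g : MvPolynomial (Fin (n + 1)) K} (hg : D.π g = 0) (hgd : g.IsHomogeneous (2 * r + 1)) :
    D.topDeriv h j g = 0 := by
  have hhom : ∀ (γ : Fin (n + 1) →₀ ℕ) (c : K) (e : ℕ), γ.degree = e →
      (MvPolynomial.monomial γ c).IsHomogeneous e :=
    fun γ c e he => MvPolynomial.isHomogeneous_monomial c he
  have hX0 : ∀ v, D.π (MvPolynomial.X 0 * v) = 0 → D.π v = 0 := by
    intro v hv
    rw [map_mul, mul_comm] at hv
    exact (mem_nonZeroDivisors_iff_right.1 D.nzd) _ hv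
  -- the values on the relations `X^γ - X_0 f` depend only on `γ`
  have hu : ∀ γ : Fin (n + 1) →₀ ℕ, γ.degree = 2 * r + 1 →
      ∃ u : MvPolynomial (Fin (n + 1)) K, u.IsHomogeneous (2 * r) ∧
        D.π (MvPolynomial.monomial γ 1 - MvPolynomial.X 0 * u) = 0 :=
    fun γ hγ => exists_reduction hr (by omega) (hhom γ 1 _ hγ)
  choose! u hu huπ using hu
  let c : Fin (n + 1) → (Fin (n + 1) →₀ ℕ) → FormsAlg K R := fun j γ =>
    D.topDeriv h j (MvPolynomial.monomial γ 1 - MvPolynomial.X 0 * u γ)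
  have hzero : ∀ j v, v.IsHomogeneous (2 * r) → D.π (MvPolynomial.X 0 * v) = 0 →
      D.topDeriv h j (MvPolynomial.X 0 * v) = 0 := by
    intro j v hv hv0
    rw [topDeriv_X_zero_mul _ _ _ (hX0 v hv0)]
    exact topDeriv_eq_zero_of_degree_le hh j (hX0 v hv0) hv le_rfl
  have hc : ∀ j γ, γ.degree = 2 * r + 1 → ∀ f, f.IsHomogeneous (2 * r) →
      D.π (MvPolynomial.monomial γ 1 - MvPolynomial.X 0 * f) = 0 →
      D.topDeriv h j (MvPolynomial.monomial γ 1 - MvPolynomial.X 0 * f) = c j γ := by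
    intro j γ hγ f hf hfπ
    have h1 : MvPolynomial.monomial γ 1 - MvPolynomial.X 0 * f -
        (MvPolynomial.monomial γ 1 - MvPolynomial.X 0 * u γ) =
        MvPolynomial.X 0 * (u γ - f) := by ring
    rw [← sub_eq_zero]
    change _ - D.topDeriv h j _ = 0
    rw [← map_sub, h1]
    refine hzero j _ ((hu γ hγ).sub hf) ?_
    rw [← h1, map_sub, hfπ, huπ γ hγ, sub_zero]
  have hmono : ∀ γ δ : Fin (n + 1) →₀ ℕ, MvPolynomial.monomial γ (1 : K) *
      MvPolynomial.monomial δ 1 = MvPolynomial.monomial (γ + δ) 1 := fun γ δ => by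
    rw [MvPolynomial.monomial_mul, one_mul]
  have hcvan : ∀ γ : Fin (n + 1) →₀ ℕ, γ.degree = 2 * r + 1 → c j γ = 0 := by
    intro γ hγ
    refine eq_zero_of_relations (K := K) hr1 (0 : Fin (n + 1)) c ?_ ?_ ?_ (by
      rwa [Fintype.card_fin, show n + 1 = 3 ↔ n = 2 by omega]) hj hγ
    · intro j γ hγ h0
      obtain ⟨δ, rfl⟩ := exists_add_of_le (Finsupp.single_le_iff.2 (Nat.one_le_iff_ne_zero.2 h0))
      have h1 : MvPolynomial.monomial (Finsupp.single 0 1 + δ) (1 : K) -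
          MvPolynomial.X 0 * MvPolynomial.monomial δ 1 = 0 := by
        rw [MvPolynomial.X, hmono, sub_self]
      rw [map_add, Finsupp.degree_single] at hγ
      rw [← hc j _ (by rw [map_add, Finsupp.degree_single, hγ]) (MvPolynomial.monomial δ 1)
        (hhom _ _ _ (by omega)) (by rw [h1, map_zero]), h1, map_zero]
    · intro ν hν
      obtain ⟨β, hβ, hβd⟩ := Finsupp.exists_le_degree_eq ν (r + 1) (by omega)
      obtain ⟨μ, rfl⟩ := exists_add_of_le hβ
      rw [map_add, hβd] at hν
      obtain ⟨v, hv, hvπ⟩ := exists_reduction hr le_rfl (hhom β 1 _ hβd)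
      have h1 : ∀ j, c j (β + μ + Finsupp.single j 1) = h (D.deh (D.π
          (MvPolynomial.monomial μ 1 * (MvPolynomial.X j * MvPolynomial.pderiv j
            (MvPolynomial.monomial β 1 - MvPolynomial.X 0 * v))))) • D.topForm := by
        intro j
        have h2 : MvPolynomial.monomial (β + μ + Finsupp.single j 1) (1 : K) -
            MvPolynomial.X 0 * (MvPolynomial.monomial (μ + Finsupp.single j 1) 1 * v) =
            MvPolynomial.monomial (μ + Finsupp.single j 1) 1 *
              (MvPolynomial.monomial β 1 - MvPolynomial.X 0 * v) := by
          rw [add_assoc, ← hmono β]; ring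
        rw [← hc j _ (by rw [map_add, map_add, Finsupp.degree_single, hβd, ← hν])
          (MvPolynomial.monomial (μ + Finsupp.single j 1) 1 * v) ?_ ?_, h2,
          topDeriv_mul _ _ _ _ hvπ, ← map_mul, ← map_mul, ← hmono μ,
          show MvPolynomial.monomial (Finsupp.single j 1) (1 : K) = MvPolynomial.X j from rfl,
          mul_assoc]
        · have h3 := (hhom (μ + Finsupp.single j 1) (1 : K) r (by
            rw [map_add, Finsupp.degree_single]; omega)).mul hv
          rwa [← two_mul] at h3
        · rw [h2, map_mul, hvπ, mul_zero]
      simp_rw [h1]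
      rw [← Finset.sum_smul, ← map_sum, ← map_sum, ← map_sum, ← Finset.mul_sum]
      have hvd : (MvPolynomial.monomial β 1 - MvPolynomial.X 0 * v).IsHomogeneous (r + 1) := by
        have h3 := (MvPolynomial.isHomogeneous_X K (0 : Fin (n + 1))).mul hv
        rw [Nat.add_comm 1 r] at h3
        exact (hhom β 1 _ hβd).sub h3
      rw [hvd.sum_X_mul_pderiv, map_mul, map_nsmul, hvπ, smul_zero, mul_zero, map_zero, map_zero,
        zero_smul]
    · intro α β hα hβ i j hi hj
      obtain ⟨v, hv, hvπ⟩ := exists_reduction hr le_rfl (hhom α 1 _ hα)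
      obtain ⟨w, hw, hwπ⟩ := exists_reduction hr le_rfl (hhom β 1 _ hβ)
      -- both sides are the value of `h` at the product of two derivatives
      have key : ∀ (α β : Fin (n + 1) →₀ ℕ) (v w : MvPolynomial (Fin (n + 1)) K),
          α.degree = r + 1 → β.degree = r + 1 → v.IsHomogeneous r → w.IsHomogeneous r →
          D.π (MvPolynomial.monomial α 1 - MvPolynomial.X 0 * v) = 0 →
          D.π (MvPolynomial.monomial β 1 - MvPolynomial.X 0 * w) = 0 → ∀ i j, i ≠ 0 →
          (α i : K) • c j (α + β - Finsupp.single i 1) =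
            h (D.deh (D.π (MvPolynomial.pderiv i
              (MvPolynomial.monomial α 1 - MvPolynomial.X 0 * v))) *
              D.deh (D.π (MvPolynomial.pderiv j
                (MvPolynomial.monomial β 1 - MvPolynomial.X 0 * w)))) • D.topForm := by
        intro α β v w hα hβ hv hw hvπ hwπ i j hi
        have h1 : MvPolynomial.pderiv i (MvPolynomial.monomial α 1 - MvPolynomial.X 0 * v) =
            MvPolynomial.monomial (α - Finsupp.single i 1) (α i : K) -
              MvPolynomial.X 0 * MvPolynomial.pderiv i v := by
          rw [map_sub, MvPolynomial.pderiv_monomial, one_mul, MvPolynomial.pderiv_mul,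
            MvPolynomial.pderiv_X_of_ne hi.symm, zero_mul, zero_add]
        have hwd : (MvPolynomial.monomial β 1 - MvPolynomial.X 0 * w).IsHomogeneous (r + 1) := by
          have h3 := (MvPolynomial.isHomogeneous_X K (0 : Fin (n + 1))).mul hw
          rw [Nat.add_comm 1 r] at h3
          exact (hhom β 1 _ hβ).sub h3
        have h4 : D.topDeriv h j (MvPolynomial.X 0 * (MvPolynomial.pderiv i v *
            (MvPolynomial.monomial β 1 - MvPolynomial.X 0 * w))) = 0 := by
          have h3 := (hv.pderiv (i := i)).mul hwd
          rw [show r - 1 + (r + 1) = 2 * r by omega] at h3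
          exact hzero j _ h3 (by rw [map_mul, map_mul, hwπ, mul_zero, mul_zero])
        rw [← topDeriv_mul _ _ _ _ hwπ, h1, sub_mul, map_sub, mul_assoc, h4, sub_zero]
        rcases eq_or_ne (α i) 0 with h0 | h0
        · rw [h0, Nat.cast_zero, zero_smul, map_zero, zero_mul, map_zero]
        · obtain ⟨δ, rfl⟩ := exists_add_of_le
            (Finsupp.single_le_iff.2 (Nat.one_le_iff_ne_zero.2 h0))
          rw [map_add, Finsupp.degree_single] at hα
          rw [add_tsub_cancel_left, add_assoc, add_tsub_cancel_left]
          have h2 : MvPolynomial.monomial (δ + β) (1 : K) -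
              MvPolynomial.X 0 * (MvPolynomial.monomial δ 1 * w) =
              MvPolynomial.monomial δ 1 *
                (MvPolynomial.monomial β 1 - MvPolynomial.X 0 * w) := by
            rw [← hmono δ]; ring
          rw [← hc j _ (by rw [map_add, hβ]; omega) (MvPolynomial.monomial δ 1 * w) ?_ ?_, h2,
            ← map_smul, ← smul_mul_assoc, MvPolynomial.smul_monomial, smul_eq_mul, mul_one]
          · have h3 := (hhom δ (1 : K) r (by omega)).mul hw
            rwa [← two_mul] at h3
          · rw [h2, map_mul, hwπ, mul_zero]
      rw [key α β v w hα hβ hv hw hvπ hwπ i j hi, add_comm α β,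
        key β α w v hβ hα hw hv hwπ hvπ j i hj, mul_comm]
  -- an arbitrary relation is a combination of relations `X^γ - X_0 f`
  have hdeg : ∀ γ ∈ g.support, γ.degree = 2 * r + 1 := fun γ hγ => by
    rw [Finsupp.degree_eq_sum]; exact sum_exponents_of_isHomogeneous hgd hγ
  let v := ∑ γ ∈ g.support, g.coeff γ • u γ
  have h1 : g - MvPolynomial.X 0 * v = ∑ γ ∈ g.support,
      g.coeff γ • (MvPolynomial.monomial γ 1 - MvPolynomial.X 0 * u γ) := by
    simp only [v]
    rw [Finset.mul_sum]
    nth_rewrite 1 [g.as_sum]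
    rw [← Finset.sum_sub_distrib]
    refine Finset.sum_congr rfl fun γ _ => ?_
    rw [smul_sub, MvPolynomial.smul_monomial, smul_eq_mul, mul_one, mul_smul_comm]
  have h2 : D.π (MvPolynomial.X 0 * v) = 0 := by
    have h3 := congrArg D.π h1
    rw [map_sub, hg, zero_sub, map_sum, Finset.sum_eq_zero, neg_eq_zero] at h3
    · exact h3
    · intro γ hγ
      rw [map_smul, huπ γ (hdeg γ hγ), smul_zero]
  have h3 : v.IsHomogeneous (2 * r) := MvPolynomial.IsHomogeneous.sum _ _ _ fun γ hγ =>
    (MvPolynomial.homogeneousSubmodule _ K (2 * r)).smul_mem _ (hu γ (hdeg γ hγ))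
  rw [← sub_add_cancel g (MvPolynomial.X 0 * v), map_add, hzero j v h3 h2, add_zero, h1, map_sum]
  refine Finset.sum_eq_zero fun γ hγ => ?_
  rw [map_smul, show D.topDeriv h j _ = c j γ from rfl, hcvan γ (hdeg γ hγ), smul_zero]

/-- The top forms on `R` of degree `2r + n` inject into the forms on `S[X]`. -/
theorem eq_zero_of_mem_xSpan_top (hr1 : 1 ≤ r)
    (hr : ∀ d : ℕ, r ≤ d → ∀ s, ∃ a ∈ D.grade d, D.deh a = s)
    (hex : ¬ (n = 2 ∧ (2 : K) = 0 ∧ Even r))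
    {w : FormsAlg K R} (hw : w ∈ D.xSpan (n + 1) (2 * r - 1)) (h0 : extMap D.toPoly w = 0) :
    w = 0 := by
  have hk := hr (2 * r - 1) (by omega)
  rw [show ((2 * r - 1 : ℕ) : ℤ) = 2 * r - 1 by omega] at hk
  obtain ⟨h, -, hh⟩ := D.exists_homogenization hk
  obtain ⟨l, hl, hl'⟩ := D.exists_topLift
  refine D.eq_zero_of_extMap_toPoly_eq_zero hr h hh l hl (fun g hg d hd hgd s b c => ?_) hw h0
  have hpos : ∀ s, ∀ j ≠ 0,
      h (s * D.deh (D.π (MvPolynomial.pderiv j g))) • D.topForm = 0 := by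
    intro s j hj
    obtain ⟨a, ha, rfl⟩ := hr r le_rfl s
    obtain ⟨p, hp, rfl⟩ := D.mem_grade_natCast.1 ha
    rw [← topDeriv_mul _ _ _ _ hg]
    have hpg : D.π (p * g) = 0 := by rw [map_mul, hg, mul_zero]
    rcases eq_or_lt_of_le hd with rfl | hd
    · refine topDeriv_eq_zero hr1 hr hh hex hj hpg ?_
      have := hp.mul hgd
      rwa [show r + (r + 1) = 2 * r + 1 by ring] at this
    · exact topDeriv_eq_zero_of_degree_le hh j hpg (hp.mul hgd) (by omega)
  -- by Euler's formula, the derivative with respect to `X_0` is a combination of the others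
  have hall : ∀ j, h (s * D.deh (D.π (MvPolynomial.pderiv j g))) • D.topForm = 0 := by
    intro j
    rcases eq_or_ne j 0 with rfl | hj
    · have h1 := congrArg (fun p => D.deh (D.π p)) hgd.sum_X_mul_pderiv
      simp only [map_nsmul, hg, smul_zero, map_sum, map_mul] at h1
      rw [Fin.sum_univ_succ, D.deh_x0, one_mul, map_zero] at h1
      rw [eq_neg_of_add_eq_zero_left h1, mul_neg, Finset.mul_sum, map_neg, map_sum, neg_smul,
        Finset.sum_smul, neg_eq_zero]
      refine Finset.sum_eq_zero fun i _ => ?_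
      rw [← mul_assoc]
      exact hpos _ _ (Fin.succ_ne_zero i)
    · exact hpos s j hj
  refine Finset.sum_eq_zero fun j _ => ?_
  obtain ⟨t, ht⟩ := hl' (b * wedgeGen K j * c)
  rw [ht, smul_comm, hall, smul_zero]

end DehomSetup

/-- A quotient of the base field has no differential forms. -/
theorem finrank_forms_eq_zero {K S : Type*} [Field K] [CommRing S] [Algebra K S]
    (h : Function.Surjective (algebraMap K S)) {m : ℕ} (hm : 1 ≤ m) :
    Module.finrank K (Forms K S m) = 0 := by
  obtain ⟨m, rfl⟩ := Nat.exists_eq_add_of_le' hm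
  have h1 : (⊤ : Submodule K (Forms K S (m + 1))) = ⊥ := by
    rw [← forms_span, Submodule.span_eq_bot]
    rintro _ ⟨a, b, rfl⟩
    obtain ⟨c, hc⟩ := h (b 0)
    rw [AlternatingMap.map_coord_zero _ (0 : Fin (m + 1)), smul_zero]
    rw [← hc, Derivation.map_algebraMap]
  rw [← finrank_top, h1, finrank_bot]

namespace DehomSetup

variable {K R S : Type*} [Field K] {n : ℕ} [CommRing R] [Algebra K R] [CommRing S] [Algebra K S]
  (D : DehomSetup K R S n)

/-- The dimension of the space of top forms on `R` in degrees `i ≥ 2r + n`. If `r = 0`, then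
`S = K`, and there are no top forms of degree `n` on `R`. -/
theorem hilbertFun_topForms_eq [Module.Finite K S] {r : ℕ}
    (hr : ∀ d : ℕ, r ≤ d → ∀ s, ∃ a ∈ D.grade d, D.deh a = s)
    (hn : 1 ≤ n) (hex : ¬ (n = 2 ∧ (2 : K) = 0 ∧ Even r)) {i : ℤ} (hi : 2 * (r : ℤ) + n ≤ i) :
    hilbertFun (formsGrade D.grade (n + 1)) i =
      Module.finrank K (Forms K S (n + 1)) + Module.finrank K (Forms K S n) := by
  rcases eq_or_lt_of_le hi with rfl | hi
  · rcases Nat.eq_zero_or_pos r with rfl | hr1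
    · have hS : Function.Surjective (algebraMap K S) := by
        intro s
        obtain ⟨a, ha, rfl⟩ := hr 0 le_rfl s
        obtain ⟨p, hp, rfl⟩ := D.mem_grade_natCast.1 ha
        rw [MvPolynomial.totalDegree_eq_zero_iff_eq_C.1 (Nat.le_zero.1 hp.totalDegree_le)]
        refine ⟨p.coeff 0, ?_⟩
        exact ((D.deh.comp D.π).commutes _).symm
      have h1 : formsGrade D.grade (n + 1) (2 * ((0 : ℕ) : ℤ) + n) = ⊥ := by
        apply Submodule.map_injective_of_injective (formsIncl_injective (n + 1))
        rw [Submodule.map_bot, map_formsGrade_eq_xSpan, xSpan, Submodule.span_eq_bot]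
        rintro _ ⟨a, J, ha, rfl⟩
        rw [D.eq_zero_of_mem_grade_neg (by push_cast; omega) ha, zero_smul]
      rw [finrank_forms_eq_zero hS (by omega), finrank_forms_eq_zero hS hn, hilbertFun, h1,
        finrank_bot]
    · refine D.hilbertFun_formsGrade_eq hr (by omega) (by push_cast; omega) fun w hw h0 => ?_
      refine eq_zero_of_mem_xSpan_top hr1 hr hex ?_ h0
      rwa [show 2 * (r : ℤ) + n - ((n + 1 : ℕ) : ℤ) = 2 * r - 1 by push_cast; ring] at hw
  · exact D.hilbertFun_formsGrade_eq hr (by omega) (by push_cast; omega)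
      (D.eq_zero_of_mem_xSpan_of_le hr (by push_cast; omega))

/-! ### Comparison of Hilbert functions -/

variable {B : Type*} [CommRing B] [Algebra K B] {f : R →ₐ[K] B} {θ : B ≃ₐ[K] S[X]}
  {ℬ : ℤ → Submodule K B} {r : ℕ} {m : ℕ} {i : ℤ}

theorem symm_X_eq (hθ : ∀ a, θ (f a) = D.toPoly a) : θ.symm Polynomial.X = f (D.x 0) := by
  rw [AlgEquiv.symm_apply_eq, hθ, toPoly_x_zero]

/-- In degrees `i ≥ 2r + m` the forms on `R` and on `B` agree. -/
theorem bijOn_formsMap (hθ : ∀ a, θ (f a) = D.toPoly a)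
    (hℬ : ∀ d b, b ∈ ℬ d ↔ θ b ∈ polyGrade K S d)
    (hr : ∀ d : ℕ, r ≤ d → ∀ s, ∃ a ∈ D.grade d, D.deh a = s)
    (hi : 2 * (r : ℤ) + m ≤ i) :
    Set.BijOn (formsMap f m) (formsGrade D.grade m i) (formsGrade ℬ m i) := by
  have h1 := D.bijOn_formsMap_toPoly hr (m := m) (i := i) (by omega)
    (D.eq_zero_of_mem_xSpan_of_le hr hi)
  have h2 : ∀ w, formsMap D.toPoly m w = formsEquiv θ m (formsMap f m w) := by
    intro w
    have h3 : θ.toAlgHom.comp f = D.toPoly := AlgHom.ext hθ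
    rw [← h3, formsMap_comp]
    rfl
  have h4 := map_formsEquiv_formsGrade θ hℬ m i
  refine ⟨fun w hw => ?_, fun v hv w hw h => ?_, fun y hy => ?_⟩
  · have h5 : formsEquiv θ m (formsMap f m w) ∈
        (formsGrade ℬ m i).map (formsEquiv θ m).toLinearMap := by
      rw [h4, ← h2]; exact h1.mapsTo hw
    obtain ⟨y, hy, hyw⟩ := h5
    rwa [← (formsEquiv θ m).injective hyw]
  · exact h1.injOn hv hw (by rw [h2, h2, h])
  · have h5 : formsEquiv θ m y ∈ formsGrade (polyGrade K S) m i := by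
      rw [← h4]; exact ⟨y, hy, rfl⟩
    obtain ⟨w, hw, h⟩ := h1.surjOn h5
    exact ⟨w, hw, (formsEquiv θ m).injective (by rw [← h2, h])⟩

/-- The comparison of forms on `R` and on a ring `B ≅ S[X]` over `R`. -/
theorem forms_comparison [Module.Finite K S] (hθ : ∀ a, θ (f a) = D.toPoly a)
    (hℬ : ∀ d b, b ∈ ℬ d ↔ θ b ∈ polyGrade K S d)
    (hr : ∀ d : ℕ, r ≤ d → ∀ s, ∃ a ∈ D.grade d, D.deh a = s) {ρ : ℤ} (hρ : ρ = r)
    (m : ℕ) (hm : 1 ≤ m) :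
    (∀ i : ℤ, Module.Finite K (formsGrade D.grade m i) ∧ Module.Finite K (formsGrade ℬ m i)) ∧
      Module.Finite K (Forms K S m) ∧ Module.Finite K (Forms K S (m - 1)) ∧
      (∀ i : ℤ, 2 * ρ + m ≤ i →
        Set.BijOn (formsMap f m) (formsGrade D.grade m i) (formsGrade ℬ m i)) ∧
      (∀ᶠ i in Filter.atTop, hilbertFun (formsGrade D.grade m) i =
        hilbertPoly (hilbertFun (formsGrade D.grade m))) ∧
      (∀ᶠ i in Filter.atTop, hilbertFun (formsGrade ℬ m) i =
        hilbertPoly (hilbertFun (formsGrade ℬ m))) ∧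
      hilbertPoly (hilbertFun (formsGrade D.grade m)) =
        hilbertPoly (hilbertFun (formsGrade ℬ m)) ∧
      hilbertPoly (hilbertFun (formsGrade D.grade m)) =
        Module.finrank K (Forms K S m) + Module.finrank K (Forms K S (m - 1)) ∧
      (∀ i : ℤ, 2 * ρ + m ≤ i → hilbertFun (formsGrade D.grade m) i =
        hilbertPoly (hilbertFun (formsGrade D.grade m))) ∧
      regIndex (hilbertFun (formsGrade D.grade m)) ≤ 2 * ρ + m := by
  subst hρ
  have hdim : ∀ i : ℤ, 2 * (r : ℤ) + m ≤ i → hilbertFun (formsGrade D.grade m) i =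
      Module.finrank K (Forms K S m) + Module.finrank K (Forms K S (m - 1)) := fun i hi =>
    D.hilbertFun_formsGrade_eq hr hm (by omega) (D.eq_zero_of_mem_xSpan_of_le hr hi)
  have hdim' : ∀ i : ℤ, 1 ≤ i → hilbertFun (formsGrade ℬ m) i =
      Module.finrank K (Forms K S m) + Module.finrank K (Forms K S (m - 1)) := fun i hi =>
    (finrank_formsGrade_of_equiv θ hℬ hm i).2 hi
  have hHP := hilbertPoly_eq_of_forall_ge hdim
  have hHP' := hilbertPoly_eq_of_forall_ge hdim'
  refine ⟨fun i => ⟨D.finite_formsGrade m i, (finrank_formsGrade_of_equiv θ hℬ hm i).1⟩,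
    finite_forms m, finite_forms (m - 1), fun i hi => D.bijOn_formsMap hθ hℬ hr hi,
    Filter.eventually_atTop.2 ⟨_, fun i hi => (hdim i hi).trans hHP.symm⟩,
    Filter.eventually_atTop.2 ⟨_, fun i hi => (hdim' i hi).trans hHP'.symm⟩,
    hHP.trans hHP'.symm, hHP, fun i hi => (hdim i hi).trans hHP.symm,
    regIndex_le (by omega) fun i hi => (hdim i hi).trans hHP.symm⟩

/-- The comparison of top forms, which starts one degree earlier. -/
theorem topForms_regIndex_le [Module.Finite K S]
    (hr : ∀ d : ℕ, r ≤ d → ∀ s, ∃ a ∈ D.grade d, D.deh a = s) {ρ : ℤ} (hρ : ρ = r)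
    (hn : 1 ≤ n) (hex : ¬ (n = 2 ∧ ringChar K = 2 ∧ Even ρ)) :
    (∀ i : ℤ, 2 * ρ + n ≤ i → hilbertFun (formsGrade D.grade (n + 1)) i =
        hilbertPoly (hilbertFun (formsGrade D.grade (n + 1)))) ∧
      regIndex (hilbertFun (formsGrade D.grade (n + 1))) ≤ 2 * ρ + n := by
  subst hρ
  have hdim := fun i hi => D.hilbertFun_topForms_eq hr hn (i := i) (by
    rintro ⟨h1, h2, h3⟩
    exact hex ⟨h1, CharP.ringChar_of_prime_eq_zero Nat.prime_two (by exact_mod_cast h2),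
      by exact_mod_cast h3⟩) hi
  have hHP := hilbertPoly_eq_of_forall_ge hdim
  exact ⟨fun i hi => (hdim i hi).trans hHP.symm,
    regIndex_le (by omega) fun i hi => (hdim i hi).trans hHP.symm⟩

end DehomSetup

/-! ### Zero-dimensional schemes -/

section Scheme

variable {K : Type*} [Field K] {n : ℕ} {I : Ideal (MvPolynomial (Fin (n + 1)) K)}

/-- The dehomogenization of the homogeneous coordinate ring of a zero-dimensional scheme. -/
def dehomSetup (hI : IsVanishingIdeal I) (hx0 : x0 I ∈ nonZeroDivisors (CoordRing I)) :
    DehomSetup K (CoordRing I) (AffineRing I) n where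
  π := Ideal.Quotient.mkₐ K I
  surjective := Ideal.Quotient.mkₐ_surjective K I
  homogeneous f hf d :=
    Ideal.Quotient.eq_zero_iff_mem.2 (hI.homogeneous f (Ideal.Quotient.eq_zero_iff_mem.1 hf) d)
  nzd := hx0
  deh := deh I
  deh_surjective := Ideal.Quotient.mkₐ_surjective K _
  deh_x0 := by
    have h : deh I (x0 I - 1) = 0 :=
      Ideal.Quotient.eq_zero_iff_mem.2 (Ideal.mem_span_singleton_self _)
    rw [map_sub, map_one, sub_eq_zero] at h
    exact h
  exists_of_deh_eq_zero a ha := by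
    obtain ⟨b, hb⟩ := Ideal.mem_span_singleton'.1 (Ideal.Quotient.eq_zero_iff_mem.1 ha)
    exact ⟨b, hb.symm⟩

/-- `Q^h(R)` is graded by the fractions of `fractions`, in which the quotient `a / b` is expressed
by the equation `y b = a`. -/
theorem quotGrade_eq (hI : IsVanishingIdeal I) (hx0 : x0 I ∈ nonZeroDivisors (CoordRing I))
    (d : ℤ) : quotGrade I d =
      Submodule.span K ((dehomSetup hI hx0).fractions (HomogQuot I) d) := by
  rw [quotGrade]
  congr 1
  ext y
  constructor
  · rintro ⟨e, f, a, b, ha, hb, hd, rfl⟩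
    refine ⟨e, f, a, b, ha, hb, b.2.1, hd, ?_⟩
    rw [Localization.mk_eq_mk']
    exact IsLocalization.mk'_spec _ _ _
  · rintro ⟨e, f, a, b, ha, hb, hbn, hd, hy⟩
    refine ⟨e, f, a, ⟨b, hbn, f, hb⟩, ha, hb, hd, ?_⟩
    rw [Localization.mk_eq_mk']
    exact IsLocalization.eq_mk'_iff_mul_eq.2 hy

theorem homogNZD_le : homogNZD I ≤ nonZeroDivisors (CoordRing I) := fun _ hb => hb.1

/-- The truncated integral closure is canonically isomorphic to `S[x_0]`. -/
theorem exists_truncClosure_equiv [Nontrivial (CoordRing I)] [Module.Finite K (AffineRing I)]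
    (hI : IsVanishingIdeal I) (hx0 : x0 I ∈ nonZeroDivisors (CoordRing I)) :
    ∃ θ : truncClosure I ≃ₐ[K] (AffineRing I)[X],
      (∀ a, θ (incl I a) = (dehomSetup hI hx0).toPoly a) ∧
      (∀ (d : ℤ) (y : truncClosure I), y ∈ truncGrade I d ↔ θ y ∈ polyGrade K (AffineRing I) d) ∧
      θ.symm Polynomial.X = incl I (x0 I) ∧ IsDehomogenization θ := by
  obtain ⟨θ, h1, h2, h3⟩ := (dehomSetup hI hx0).exists_closure_equiv (Q := HomogQuot I)
    (IsLocalization.injective (HomogQuot I) homogNZD_le)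
    (fun b hb f hbf => IsLocalization.map_units (HomogQuot I) (⟨b, hb, f, hbf⟩ : homogNZD I))
    (truncClosure I) (fun y => by
      simp only [← quotGrade_eq]
      rfl)
  have hX : θ.symm Polynomial.X = incl I ((dehomSetup hI hx0).x 0) :=
    (dehomSetup hI hx0).symm_X_eq (B := truncClosure I) (f := incl I) (θ := θ) h1
  refine ⟨θ, h1, fun d y => ?_, hX, h3⟩
  rw [← h2, ← quotGrade_eq]
  rfl

theorem nontrivial_coordRing (hI : IsVanishingIdeal I) : Nontrivial (CoordRing I) := by
  rw [← not_subsingleton_iff_nontrivial]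
  intro h
  have h1 := hI.dim_eq_one
  rw [ringKrullDim_eq_bot_of_subsingleton] at h1
  exact absurd h1 (by decide)

theorem finite_affineRing (hI : IsVanishingIdeal I) (hx0 : x0 I ∈ nonZeroDivisors (CoordRing I)) :
    Module.Finite K (AffineRing I) := (dehomSetup hI hx0).finite_affine hI.dim_eq_one

/-- `r_X` is a natural number `r`, and `R_d → S` is surjective for `d ≥ r`. -/
theorem exists_schemeRegIndex_eq (hI : IsVanishingIdeal I)
    (hx0 : x0 I ∈ nonZeroDivisors (CoordRing I)) :
    ∃ r : ℕ, schemeRegIndex I = r ∧ ∀ d : ℕ, r ≤ d → ∀ s, ∃ a ∈ (dehomSetup hI hx0).grade d,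
      (dehomSetup hI hx0).deh a = s := by
  have := nontrivial_coordRing hI
  have := finite_affineRing hI hx0
  exact (dehomSetup hI hx0).exists_regIndex

set_option maxHeartbeats 1000000 in
/-- The graded splitting of the forms on the truncated integral closure. -/
theorem exists_truncClosure_splitting {θ : truncClosure I ≃ₐ[K] (AffineRing I)[X]}
    (hgrade : ∀ (d : ℤ) (y : truncClosure I), y ∈ truncGrade I d ↔
      θ y ∈ polyGrade K (AffineRing I) d) (hX : θ.symm Polynomial.X = incl I (x0 I)) {m : ℕ}
    (hm : 1 ≤ m) :
    ∃ Ψ : Forms K (truncClosure I) m ≃ₗ[K]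
        (K[X] ⊗[K] Forms K (AffineRing I) m) × (K[X] ⊗[K] Forms K (AffineRing I) (m - 1)),
      IsCanonicalSplitting (affineIncl θ) (incl I (x0 I)) m Ψ ∧
      IsPolyLinear (incl I (x0 I)) m Ψ ∧ IsGradedSplitting (truncGrade I) m Ψ := by
  obtain ⟨Ψ, h1, h2, h3⟩ := exists_splitting (K := K) (S := AffineRing I)
    (B := truncClosure I) θ hgrade hm
  refine ⟨Ψ, ?_, ?_, h3⟩
  · rw [hX] at h1
    exact h1
  · rw [hX] at h2
    exact h2

end Scheme

end KaehlerZeroDim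

end

set_option maxHeartbeats 4000000 in
theorem mainTheorem2 {K : Type*} [Field K] [PerfectField K] {n : ℕ}
    (I : Ideal (MvPolynomial (Fin (n + 1)) K)) (hI : IsVanishingIdeal I)
    (hx0 : x0 I ∈ nonZeroDivisors (CoordRing I)) :
    -- (a)
    (∃ θ : truncClosure I ≃ₐ[K] (AffineRing I)[X], IsDehomogenization θ ∧
      ∀ m : ℕ, 1 ≤ m →
        ∃ Ψ : Forms K (truncClosure I) m ≃ₗ[K]
            (K[X] ⊗[K] Forms K (AffineRing I) m) × (K[X] ⊗[K] Forms K (AffineRing I) (m - 1)),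
          IsCanonicalSplitting (affineIncl θ) (incl I (x0 I)) m Ψ ∧
          IsPolyLinear (incl I (x0 I)) m Ψ ∧
          IsGradedSplitting (truncGrade I) m Ψ) ∧
    (∀ m : ℕ, 1 ≤ m →
      -- the vector spaces whose dimensions are taken are finite-dimensional
      (∀ i : ℤ, Module.Finite K (formsGrade (coordGrade I) m i) ∧
        Module.Finite K (formsGrade (A := truncClosure I) (truncGrade I) m i)) ∧
      Module.Finite K (Forms K (AffineRing I) m) ∧
      Module.Finite K (Forms K (AffineRing I) (m - 1)) ∧
      -- (b)
      (∀ i : ℤ, 2 * schemeRegIndex I + m ≤ i →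
        Set.BijOn (formsMap (A := CoordRing I) (B := truncClosure I) (incl I) m)
          (formsGrade (coordGrade I) m i)
          (formsGrade (A := truncClosure I) (truncGrade I) m i)) ∧
      -- (c)
      (∀ᶠ i in Filter.atTop, formsHF I m i = hilbertPoly (formsHF I m)) ∧
      (∀ᶠ i in Filter.atTop, truncFormsHF I m i = hilbertPoly (truncFormsHF I m)) ∧
      hilbertPoly (formsHF I m) = hilbertPoly (truncFormsHF I m) ∧
      hilbertPoly (formsHF I m) =
        Module.finrank K (Forms K (AffineRing I) m) +
          Module.finrank K (Forms K (AffineRing I) (m - 1)) ∧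
      -- (d)
      (∀ i : ℤ, 2 * schemeRegIndex I + m ≤ i →
        formsHF I m i = hilbertPoly (formsHF I m)) ∧
      regIndex (formsHF I m) ≤ 2 * schemeRegIndex I + m) ∧
    -- (e)
    (1 ≤ n →
      (ringChar K = 0 ∨ ¬ ((ringChar K : ℤ) ∣ 2 * schemeRegIndex I + n + 1)) →
      ¬ (n = 2 ∧ ringChar K = 2 ∧ Even (schemeRegIndex I)) →
      (∀ i : ℤ, 2 * schemeRegIndex I + n ≤ i →
        formsHF I (n + 1) i = hilbertPoly (formsHF I (n + 1))) ∧
      regIndex (formsHF I (n + 1)) ≤ 2 * schemeRegIndex I + n) := by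
  have hfin := finite_affineRing hI hx0
  have hnt := nontrivial_coordRing hI
  obtain ⟨r, hreg, hr⟩ := exists_schemeRegIndex_eq hI hx0
  obtain ⟨θ, hθ, hgrade, hX, hdeh⟩ := exists_truncClosure_equiv hI hx0
  refine ⟨⟨θ, hdeh, fun m hm => exists_truncClosure_splitting hgrade hX hm⟩, fun m hm => ?_,
    fun hn _ hex => (dehomSetup hI hx0).topForms_regIndex_le hr hreg hn hex⟩
  obtain ⟨h1, h2, h3, h4, h5, h6, h7, h8, h9, h10⟩ :=
    (dehomSetup hI hx0).forms_comparison (B := truncClosure I) (f := incl I) (θ := θ)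
      (ℬ := truncGrade I) hθ hgrade hr hreg m hm
  exact ⟨h1, h2, h3, h4, h5, h6, h7, h8, h9, h10⟩
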